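/- **Conventions.** An inverse monoid is a monoid $M$ in which every $a$ has a unique $a^{-1}$ with $aa^{-1}a=a$ and $a^{-1}aa^{-1}=a^{-1}$. Its natural partial order is given by $a\le b$ iff $a=eb$ for some idempotent $e$; $E(M)$ is the set of idempotents and $\sigma$ the least group congruence. $M$ is *$E$-unitary* if $e,em\in E(M)$ implies $m\in E(M)$; *finite-above* if $\{n:n\ge m\}$ is finite for every $m$; *$F$-inverse* if every $\sigma$-class has a greatest element; *quasi-$A$-generated* ($A\subseteq M$) if $A\cup E(M)$ generates $M$ as an inverse monoid. Let $\max M^-$ be the set of the maximal elements of $M$ different from $1$. For a group variety $\mathbf U$ (the class of all groups satisfying a given set of laws), $M$ *has an $F$-inverse cover via $\mathbf U$* if there are an $F$-inverse monoid $F$ and a surjective idempotent-separating homomorphism $F\to M$ such that the kernel of the induced homomorphism $F/\sigma\to M/\sigma$ belongs to $\mathbf U$. Inverse categories and their natural partial order are defined analogously (a category in which every arrow $f$ has a unique $f^{-1}$ with $ff^{-1}f=f$, $f^{-1}ff^{-1}=f^{-1}$; and $f\le g$ iff $f=gh$ for an idempotent arrow $h$). A *dual premorphism* between inverse monoids (inverse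 categories) is a map (a graph morphism) $\psi$ that preserves identities and inverses and satisfies $(xy)\psi\ge x\psi\cdot y\psi$ for all elements (consecutive arrows) $x,y$. It is *canonical* if it maps the distinguished generators of the domain to the corresponding ones of the codomain. **Setting.** Let $M$ be a quasi-$A$-generated finite-above $E$-unitary inverse monoid with $A\subseteq\max M^-$, let $G=M/\sigma$, and let $\mathbf U$ be a group variety. Fix $I\subseteq E(M)$ such that $A\cup I$ generates $M$ as an inverse monoid. *Graphs.* Let $\Gamma^I$ be the graph with vertex set $G$ and edges $(g,m,g\cdot m\sigma)$, $g\in G$, $m\in A\cup I$, from $g$ to $g\cdot m\sigma$; the edges with $m\in A$ form the Cayley graph $\Gamma$ of $G$. For $a\in A$ let $e_a=(1,a,a\sigma)$. The group $G$ acts on these graphs by left translation. Paths may traverse edges in both directions, and may be empty; $\langle p\rangle$ is the subgraph spanned by a path $p$, and $\lambda(p)\in M$ is the product of the labels along $p$, inverted for the edges traversed backwards. Connectedness is undirected, and connected graphs are non-empty. For a finite connected subgraph $X$ of $\Gamma^I$ and vertices $i,j$ of $X$, let $\lambda_{(i,j)}(X)=\lambda(p)$ for any path $p$ from $i$ to $j$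 with $\langle p\rangle=X$ (this is independent of $p$). The closure $\overline X$ of such an $X$ is the union of all finite connected subgraphs $Y$ of $\Gamma^I$ containing $i,j$ with $\lambda_{(i,j)}(Y)\ge\lambda_{(i,j)}(X)$ (this is independent of $i,j\in V_X$); the closure of an arbitrary subgraph $X$ is the union of the closures of its finite connected subgraphs. Write $X_1\vee\dots\vee X_k=\overline{X_1\cup\dots\cup X_k}$ for $k\ge1$, and let $\mathrm{Cl}$ be the set of the closures of all finite connected subgraphs of $\Gamma^I$. *Categories and monoids.* $\mathcal X_{cl}$ is the inverse category with object set $G$ whose arrows from $i$ to $j$ are the triples $(i,X,j)$ with $X\in\mathrm{Cl}$, $i,j\in V_X$, with product $(i,X,j)(j,Y,k)=(i,X\vee Y,k)$; every edge $e$ of $\Gamma$, from $i$ to $j$, gives its generator $(i,\overline e,j)$. $\mathcal X_{cl}/G$ is the inverse monoid of the pairs $(X,g)$ with $X\in\mathrm{Cl}$, $1,g\in V_X$, and product $(X,g)(Y,h)=(X\vee gY,gh)$, with generators $(\overline{e_a},a\sigma)$, $a\in A$. Let $F_{\mathbf U}(E_\Gamma)$ be the relatively free group of $\mathbf U$ on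 the set of edges of $\Gamma$, and $[p]_{\mathbf U}$ the value in it of a path $p$ of $\Gamma$ regarded as a word in the edges and their inverses. The free $g\mathbf U$-category $F_{g\mathbf U}(\Gamma)$ on $\Gamma$ has object set $G$ and arrows $x=(i,[p]_{\mathbf U},j)$, where $p$ is a path of $\Gamma$ from $i$ to $j$, with product $(i,[p]_{\mathbf U},j)(j,[q]_{\mathbf U},k)=(i,[pq]_{\mathbf U},k)$; put $\iota x=i$, $\tau x=j$; every edge $e$ of $\Gamma$, from $i$ to $j$, gives its generator $(i,[e]_{\mathbf U},j)$. $G^{\mathbf U}$ is the subgroup of $F_{\mathbf U}(E_\Gamma)\rtimes G$ consisting of the pairs $([p]_{\mathbf U},g)$ where $p$ is a path of $\Gamma$ from $1$ to $g$, with generators $([e_a]_{\mathbf U},a\sigma)$, $a\in A$. The generators of $M$ are the elements $a\in A$. *Chains.* For an arrow $x$ of $F_{g\mathbf U}(\Gamma)$ let $C_0(x)$ be the intersection of all $\overline{\langle p\rangle}$, where $p$ is a path of $\Gamma$ with $x=(\iota x,[p]_{\mathbf U},\tau x)$; let $C_{n+1}(x)$ be the intersection of all $P_n(x_1)\vee\dots\vee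 P_n(x_k)$, where $k\ge0$ and $x=x_1\cdots x_k$ is a product of consecutive arrows (for $k=0$, when $x$ is an identity arrow, the join is read as the closure of the one-vertex graph $\{\iota x\}$); and let $P_n(x)$ be the component of $C_n(x)$ containing $\iota x$ $(n\ge 0)$. **Theorem.** The following statements are equivalent. 1. $M$ has an $F$-inverse cover via $\mathbf U$. 2. There exists a canonical dual premorphism $G^{\mathbf U}\to M$. 3. There exists a canonical dual premorphism $G^{\mathbf U}\to\mathcal X_{cl}/G$. 4. There exists a canonical dual premorphism $F_{g\mathbf U}(\Gamma)\to\mathcal X_{cl}$. 5. For every arrow $x$ of $F_{g\mathbf U}(\Gamma)$ and every $n\ge0$, the graph $P_n(x)$ contains the vertex $\tau x$. -/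

import Mathlib

universe u

namespace FInvCov

/-! ### Inverse monoids -/

/-- Inverse monoids: every element `a` has a unique `b` with `a b a = a` and `b a b = b`. -/
class InverseMonoid (M : Type u) extends Monoid M, Inv M where
  mul_inv_mul : ∀ a : M, a * a⁻¹ * a = a
  inv_mul_inv : ∀ a : M, a⁻¹ * a * a⁻¹ = a⁻¹
  inv_unique : ∀ a b : M, a * b * a = a → b * a * b = b → b = a⁻¹

attribute [instance 50] InverseMonoid.toMonoid InverseMonoid.toInv

instance (priority := 50) groupInverseMonoid (H : Type u) [Group H] : InverseMonoid H where
  mul_inv_mul a := by simp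
  inv_mul_inv a := by simp
  inv_unique a b h _ := by
    have h1 : a * b = 1 := mul_eq_right.mp h
    exact (inv_eq_of_mul_eq_one_right h1).symm

section Basics

variable {M : Type u} [InverseMonoid M]

/-- The natural partial order. -/
def natLE (a b : M) : Prop := ∃ e : M, IsIdempotentElem e ∧ a = e * b

theorem inv_idem {e : M} (he : IsIdempotentElem e) : e⁻¹ = e := by
  have h : e * e = e := he
  exact (InverseMonoid.inv_unique e e (by rw [h, h]) (by rw [h, h])).symm

theorem inv_inv' (a : M) : a⁻¹⁻¹ = a :=
  (InverseMonoid.inv_unique a⁻¹ a (InverseMonoid.inv_mul_inv a)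
    (InverseMonoid.mul_inv_mul a)).symm

theorem idem_mul_idem {e f : M} (he : IsIdempotentElem e) (hf : IsIdempotentElem f) :
    IsIdempotentElem (e * f) := by
  have he' : ∀ x, e * (e * x) = e * x := fun x => by rw [← mul_assoc, he]
  have hf' : ∀ x, f * (f * x) = f * x := fun x => by rw [← mul_assoc, hf]
  have h1 := InverseMonoid.mul_inv_mul (e * f)
  have h2 := InverseMonoid.inv_mul_inv (e * f)
  set x := (e * f)⁻¹ with hx
  have h2' : ∀ y, x * (e * (f * (x * y))) = x * y := fun y => by
    conv_rhs => rw [← h2]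
    simp only [mul_assoc]
  have h3 : f * x * e = x := by
    apply InverseMonoid.inv_unique
    · simp only [mul_assoc, he', hf']
      simpa only [mul_assoc] using h1
    · simp only [mul_assoc, he', hf', h2']
  have h4 : IsIdempotentElem x := by
    change x * x = x
    conv_lhs => rw [← h3]
    simp only [mul_assoc, h2']
    simpa only [mul_assoc] using h3
  have h5 : x⁻¹ = e * f := by rw [hx, inv_inv']
  rw [← h5, inv_idem h4]
  exact h4

theorem idem_comm {e f : M} (he : IsIdempotentElem e) (hf : IsIdempotentElem f) :
    e * f = f * e := by
  have he' : ∀ x, e * (e * x) = e * x := fun x => by rw [← mul_assoc, he]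
  have hf' : ∀ x, f * (f * x) = f * x := fun x => by rw [← mul_assoc, hf]
  have h1 := idem_mul_idem he hf
  have h2 := idem_mul_idem hf he
  have h3 : f * e = (e * f)⁻¹ := by
    apply InverseMonoid.inv_unique
    · simp only [mul_assoc, he', hf']
      rw [← mul_assoc]
      exact h1
    · simp only [mul_assoc, he', hf']
      rw [← mul_assoc]
      exact h2
  rw [h3, inv_idem h1]

theorem idem_mul_inv (a : M) : IsIdempotentElem (a * a⁻¹) := by
  change a * a⁻¹ * (a * a⁻¹) = a * a⁻¹
  rw [← mul_assoc, InverseMonoid.mul_inv_mul]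

theorem idem_inv_mul (a : M) : IsIdempotentElem (a⁻¹ * a) := by
  change a⁻¹ * a * (a⁻¹ * a) = a⁻¹ * a
  rw [← mul_assoc, InverseMonoid.inv_mul_inv]

theorem mul_inv_rev' (a b : M) : (a * b)⁻¹ = b⁻¹ * a⁻¹ := by
  have hc := idem_comm (idem_inv_mul a) (idem_mul_inv b)
  symm
  apply InverseMonoid.inv_unique
  · calc a * b * (b⁻¹ * a⁻¹) * (a * b) = a * ((b * b⁻¹) * (a⁻¹ * a)) * b := by
          simp only [mul_assoc]
      _ = (a * a⁻¹ * a) * (b * b⁻¹ * b) := by rw [← hc]; simp only [mul_assoc]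
      _ = a * b := by rw [InverseMonoid.mul_inv_mul, InverseMonoid.mul_inv_mul]
  · calc b⁻¹ * a⁻¹ * (a * b) * (b⁻¹ * a⁻¹) = b⁻¹ * ((a⁻¹ * a) * (b * b⁻¹)) * a⁻¹ := by
          simp only [mul_assoc]
      _ = (b⁻¹ * b * b⁻¹) * (a⁻¹ * a * a⁻¹) := by rw [hc]; simp only [mul_assoc]
      _ = b⁻¹ * a⁻¹ := by rw [InverseMonoid.inv_mul_inv, InverseMonoid.inv_mul_inv]

theorem idem_conj (a : M) {f : M} (hf : IsIdempotentElem f) :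
    IsIdempotentElem (a * f * a⁻¹) := by
  have hc := idem_comm (idem_inv_mul a) hf
  change a * f * a⁻¹ * (a * f * a⁻¹) = a * f * a⁻¹
  calc a * f * a⁻¹ * (a * f * a⁻¹) = a * f * ((a⁻¹ * a) * f) * a⁻¹ := by
        simp only [mul_assoc]
    _ = a * (f * f) * (a⁻¹ * a * a⁻¹) := by rw [hc]; simp only [mul_assoc]
    _ = a * f * a⁻¹ := by rw [hf, InverseMonoid.inv_mul_inv]

theorem conj_mul (a : M) {f : M} (hf : IsIdempotentElem f) : a * f * a⁻¹ * a = a * f := by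
  calc a * f * a⁻¹ * a = a * (f * (a⁻¹ * a)) := by simp only [mul_assoc]
    _ = (a * a⁻¹ * a) * f := by rw [← idem_comm (idem_inv_mul a) hf]; simp only [mul_assoc]
    _ = a * f := by rw [InverseMonoid.mul_inv_mul]

end Basics

section Sigma

variable (M : Type u) [InverseMonoid M]

/-- The least group congruence `σ` (see `sigma_isLeast`). -/
def sigma : Con M where
  r a b := ∃ e : M, IsIdempotentElem e ∧ e * a = e * b
  iseqv :=
    { refl := fun a => ⟨1, one_mul 1, rfl⟩
      symm := fun ⟨e, he, h⟩ => ⟨e, he, h.symm⟩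
      trans := by
        rintro a b c ⟨e, he, h⟩ ⟨f, hf, h'⟩
        refine ⟨e * f, idem_mul_idem he hf, ?_⟩
        rw [mul_assoc e f c, ← h', ← mul_assoc, idem_comm he hf, mul_assoc, mul_assoc, h] }
  mul' := by
    rintro a b c d ⟨e, he, h⟩ ⟨f, hf, h'⟩
    have hk := idem_conj a hf
    refine ⟨e * (a * f * a⁻¹), idem_mul_idem he hk, ?_⟩
    calc e * (a * f * a⁻¹) * (a * c) = e * (a * f * a⁻¹ * a) * c := by simp only [mul_assoc]
      _ = e * a * (f * c) := by rw [conj_mul a hf]; simp only [mul_assoc]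
      _ = e * (a * f * a⁻¹ * a) * d := by rw [h', conj_mul a hf]; simp only [mul_assoc]
      _ = (e * (a * f * a⁻¹)) * a * d := by simp only [mul_assoc]
      _ = (a * f * a⁻¹) * (e * a) * d := by rw [idem_comm he hk]; simp only [mul_assoc]
      _ = e * (a * f * a⁻¹) * (b * d) := by rw [h, idem_comm he hk]; simp only [mul_assoc]

/-- The greatest group homomorphic image `M/σ`. -/
def MaxGrp : Type u := (sigma M).Quotient

theorem sigma_inv {a b : M} (h : sigma M a b) : sigma M a⁻¹ b⁻¹ := by
  obtain ⟨e, he, h⟩ := h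
  have h1 : a⁻¹ * e = b⁻¹ * e := by
    have := congrArg (fun x => x⁻¹) h
    simpa only [mul_inv_rev', inv_idem he] using this
  have key : ∀ c : M, c⁻¹ * e * c * c⁻¹ = c⁻¹ * e := fun c => by
    have := conj_mul c⁻¹ he
    rwa [inv_inv'] at this
  refine ⟨a⁻¹ * e * a, ?_, ?_⟩
  · have := idem_conj a⁻¹ he
    rwa [inv_inv'] at this
  · have h2 : a⁻¹ * e * a = b⁻¹ * e * b := by
      calc a⁻¹ * e * a = a⁻¹ * (e * a) := by rw [mul_assoc]
        _ = a⁻¹ * e * b := by rw [h, mul_assoc]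
        _ = b⁻¹ * e * b := by rw [h1]
    rw [key a, h2, key b, h1]

instance : Group (MaxGrp M) :=
  { (inferInstance : Monoid (sigma M).Quotient) with
    inv := Quotient.map' (fun a => a⁻¹) (fun _ _ h => sigma_inv M h)
    inv_mul_cancel := by
      intro x
      induction x using Quotient.inductionOn' with
      | h a =>
        apply (Con.eq (sigma M)).mpr
        refine ⟨a⁻¹ * a, idem_inv_mul a, ?_⟩
        rw [mul_one, idem_inv_mul a] }

variable {M}

/-- The natural homomorphism `M → M/σ`. -/
def toG : M →* MaxGrp M := (sigma M).mk'

theorem toG_eq {a b : M} : toG a = toG b ↔ ∃ e : M, IsIdempotentElem e ∧ e * a = e * b :=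
  Con.eq (sigma M)

theorem toG_idem {e : M} (he : IsIdempotentElem e) : toG e = 1 := by
  rw [← map_one toG, toG_eq]
  exact ⟨e, he, by rw [mul_one, he]⟩

theorem toG_inv (a : M) : toG a⁻¹ = (toG a)⁻¹ := by
  rw [eq_inv_iff_mul_eq_one, ← map_mul]
  exact toG_idem (idem_inv_mul a)

theorem toG_surjective : Function.Surjective (toG : M → MaxGrp M) :=
  Con.mk'_surjective

theorem sigma_isLeast :
    IsLeast {c : Con M | ∀ x : c.Quotient, IsUnit x} (sigma M) := by
  constructor
  · intro x
    exact Group.isUnit (α := MaxGrp M) x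
  · intro c hc a b h
    obtain ⟨e, he, h⟩ := h
    have hu := hc (c.mk' e)
    have h1 : c.mk' e * c.mk' a = c.mk' e * c.mk' b := by rw [← map_mul, h, map_mul]
    exact (Con.eq c).mp (hu.mul_left_cancel h1)

/-- The homomorphism of greatest group images induced by a homomorphism. -/
def MaxGrp.map {F : Type u} [InverseMonoid F] (φ : F →* M) : MaxGrp F →* MaxGrp M :=
  (sigma F).lift (toG.comp φ) (by
    rintro a b ⟨e, he, h⟩
    change toG (φ a) = toG (φ b)
    rw [toG_eq]
    refine ⟨φ e, ?_, ?_⟩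
    · change φ e * φ e = φ e
      rw [← map_mul, he]
    · rw [← map_mul, h, map_mul])

end Sigma

/-- `M` is `E`-unitary: `E(M)` is a unitary subset of `M`. -/
class EUnitary (M : Type u) [InverseMonoid M] : Prop where
  idem_of_mul : ∀ e m : M, IsIdempotentElem e → IsIdempotentElem (e * m) → IsIdempotentElem m

/-- Every element has only finitely many elements above it in the natural partial order. -/
def FiniteAbove (M : Type u) [InverseMonoid M] : Prop :=
  ∀ m : M, {n : M | natLE m n}.Finite

/-- Every `σ`-class has a greatest element in the natural partial order. -/
def IsFInverse (F : Type u) [InverseMonoid F] : Prop :=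
  ∀ g : MaxGrp F, ∃ m : F, toG m = g ∧ ∀ n : F, toG n = g → natLE n m

/-- The set of non-identity elements that are maximal in the natural partial order. -/
def maxNonId (M : Type u) [InverseMonoid M] : Set M :=
  {m | m ≠ 1 ∧ ∀ n : M, natLE m n → n = m}

/-- `S` generates `M` as an inverse monoid. -/
def Generates {M : Type u} [InverseMonoid M] (S : Set M) : Prop :=
  Submonoid.closure (S ∪ (fun a => a⁻¹) '' S) = ⊤

/-- `S` together with the idempotents generates `M` as an inverse monoid. -/
def QuasiGenerates {M : Type u} [InverseMonoid M] (S : Set M) : Prop :=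
  Generates (S ∪ {e : M | IsIdempotentElem e})

/-! ### Group varieties and relatively free groups -/

/-- A group variety, given by a set of laws `w = 1` in countably many variables. -/
structure GroupVariety where
  laws : Set (FreeGroup ℕ)

namespace GroupVariety

variable (U : GroupVariety)

/-- The group `H` satisfies all the laws, i.e. belongs to the variety. -/
def Mem (H : Type u) [Group H] : Prop :=
  ∀ w ∈ U.laws, ∀ f : FreeGroup ℕ →* H, f w = 1

/-- The verbal subgroup of the free group on `X`: generated by all values of the laws. -/
def verbal (X : Type u) : Subgroup (FreeGroup X) :=
  Subgroup.normalClosure {x | ∃ w ∈ U.laws, ∃ f : FreeGroup ℕ →* FreeGroup X, f w = x}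

instance (X : Type u) : (U.verbal X).Normal := Subgroup.normalClosure_normal

/-- The relatively free group on `X` in the variety. -/
abbrev RelFree (X : Type u) : Type u := FreeGroup X ⧸ U.verbal X

/-- The homomorphism of relatively free groups extending a map of the generators. -/
def relMap {X Y : Type u} (φ : X → Y) : U.RelFree X →* U.RelFree Y :=
  QuotientGroup.map _ _ (FreeGroup.map φ) (by
    refine Subgroup.normalClosure_le_normal ?_
    rintro x ⟨w, hw, f, rfl⟩
    exact Subgroup.subset_normalClosure ⟨w, hw, (FreeGroup.map φ).comp f, rfl⟩)

theorem relMap_id {X : Type u} : U.relMap (fun x : X => x) = MonoidHom.id (U.RelFree X) := by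
  ext x
  rfl

theorem relMap_comp {X Y Z : Type u} (φ : X → Y) (χ : Y → Z) :
    (U.relMap χ).comp (U.relMap φ) = U.relMap (χ ∘ φ) := by
  ext x
  rfl

end GroupVariety

/-! ### The derived category of `M → M/σ` as a graph, its subgraphs and paths

The vertices are the elements of `M/σ`; the edge `(g, m)` has label `m`, and it goes from `g`
to `g * toG m`. -/

section Graphs

variable {M : Type u} [InverseMonoid M]

/-- Subgraphs of the graph of the derived category of `M → M/σ`. -/
@[ext] structure SubGr (M : Type u) [InverseMonoid M] where
  verts : Set (MaxGrp M)
  edges : Set (MaxGrp M × M)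
  src_mem : ∀ e ∈ edges, e.1 ∈ verts
  tgt_mem : ∀ e ∈ edges, e.1 * toG e.2 ∈ verts

namespace SubGr

instance : PartialOrder (SubGr M) where
  le X Y := X.verts ⊆ Y.verts ∧ X.edges ⊆ Y.edges
  le_refl X := ⟨subset_rfl, subset_rfl⟩
  le_trans X Y Z h h' := ⟨h.1.trans h'.1, h.2.trans h'.2⟩
  le_antisymm X Y h h' := SubGr.ext (h.1.antisymm h'.1) (h.2.antisymm h'.2)

/-- Unions of two subgraphs. -/
instance : SemilatticeSup (SubGr M) where
  sup X Y :=
    { verts := X.verts ∪ Y.verts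
      edges := X.edges ∪ Y.edges
      src_mem := fun e he => he.imp (X.src_mem e) (Y.src_mem e)
      tgt_mem := fun e he => he.imp (X.tgt_mem e) (Y.tgt_mem e) }
  le_sup_left _ _ := ⟨Set.subset_union_left, Set.subset_union_left⟩
  le_sup_right _ _ := ⟨Set.subset_union_right, Set.subset_union_right⟩
  sup_le _ _ _ h h' := ⟨Set.union_subset h.1 h'.1, Set.union_subset h.2 h'.2⟩

/-- Unions of families of subgraphs. -/
instance : SupSet (SubGr M) where
  sSup 𝒳 :=
    { verts := {v | ∃ X ∈ 𝒳, v ∈ X.verts}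
      edges := {e | ∃ X ∈ 𝒳, e ∈ X.edges}
      src_mem := fun e ⟨X, hX, he⟩ => ⟨X, hX, X.src_mem e he⟩
      tgt_mem := fun e ⟨X, hX, he⟩ => ⟨X, hX, X.tgt_mem e he⟩ }

/-- Intersections of families of subgraphs. -/
instance : InfSet (SubGr M) where
  sInf 𝒳 :=
    { verts := {v | ∀ X ∈ 𝒳, v ∈ X.verts}
      edges := {e | ∀ X ∈ 𝒳, e ∈ X.edges}
      src_mem := fun e he X hX => X.src_mem e (he X hX)
      tgt_mem := fun e he X hX => X.tgt_mem e (he X hX) }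

/-- The subgraph with the only vertex `i` and without edges. -/
def point (i : MaxGrp M) : SubGr M where
  verts := {i}
  edges := ∅
  src_mem := fun _ he => he.elim
  tgt_mem := fun _ he => he.elim

/-- The subgraph consisting of the edge with initial vertex `g` and label `m`. -/
def edge (g : MaxGrp M) (m : M) : SubGr M where
  verts := {g, g * toG m}
  edges := {(g, m)}
  src_mem := by rintro _ rfl; simp
  tgt_mem := by rintro _ rfl; simp

/-- The left action of `M/σ` on subgraphs by translation. -/
instance : SMul (MaxGrp M) (SubGr M) where
  smul g X :=
    { verts := {v | g⁻¹ * v ∈ X.verts}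
      edges := {e | (g⁻¹ * e.1, e.2) ∈ X.edges}
      src_mem := fun e he => X.src_mem _ he
      tgt_mem := fun e he => by
        have := X.tgt_mem _ he
        rwa [mul_assoc] at this }

/-- All edge labels belong to `S`. -/
def LabelsIn (S : Set M) (X : SubGr M) : Prop := ∀ e ∈ X.edges, e.2 ∈ S

end SubGr

/-- Paths that may traverse edges in both directions, in the subgraph of all edges with labels
in `S`. -/
inductive Walk (S : Set M) (i : MaxGrp M) : MaxGrp M → Type u
  | nil : Walk S i i
  | fwd {j k : MaxGrp M} (p : Walk S i j) (m : S) (h : j * toG (m : M) = k) : Walk S i k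
  | bwd {j k : MaxGrp M} (p : Walk S i j) (m : S) (h : k * toG (m : M) = j) : Walk S i k

namespace Walk

variable {S : Set M}

/-- The subgraph spanned by a path. -/
def span {i : MaxGrp M} : {j : MaxGrp M} → Walk S i j → SubGr M
  | _, nil => SubGr.point i
  | _, fwd (j := j) p m _ => p.span ⊔ SubGr.edge j m
  | k, bwd p m _ => p.span ⊔ SubGr.edge k m

/-- The element of `M` that is the value of the label of a path. -/
def label {i : MaxGrp M} : {j : MaxGrp M} → Walk S i j → M
  | _, nil => 1
  | _, fwd p m _ => p.label * (m : M)
  | _, bwd p m _ => p.label * (m : M)⁻¹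

/-- The path as a word in the edges, read in the free group on the edges. -/
def word {i : MaxGrp M} : {j : MaxGrp M} → Walk S i j → FreeGroup (MaxGrp M × S)
  | _, nil => 1
  | _, fwd (j := j) p m _ => p.word * FreeGroup.of (j, m)
  | k, bwd p m _ => p.word * (FreeGroup.of (k, m))⁻¹

/-- Concatenation of paths. -/
def append {i j : MaxGrp M} (p : Walk S i j) : {k : MaxGrp M} → Walk S j k → Walk S i k
  | _, nil => p
  | _, fwd q m h => fwd (p.append q) m h
  | _, bwd q m h => bwd (p.append q) m h

/-- The reverse of a path. -/
def reverse {i : MaxGrp M} : {j : MaxGrp M} → Walk S i j → Walk S j i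
  | _, nil => nil
  | _, fwd p m h => (bwd nil m h).append p.reverse
  | _, bwd p m h => (fwd nil m h).append p.reverse

/-- The left action of `M/σ` on paths. -/
def act (g : MaxGrp M) {i : MaxGrp M} : {j : MaxGrp M} → Walk S i j → Walk S (g * i) (g * j)
  | _, nil => nil
  | _, fwd p m h => fwd (p.act g) m (by rw [mul_assoc, h])
  | _, bwd p m h => bwd (p.act g) m (by rw [mul_assoc, h])

theorem word_append {i j k : MaxGrp M} (p : Walk S i j) (q : Walk S j k) :
    (p.append q).word = p.word * q.word := by
  induction q with
  | nil => simp [append, word]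
  | fwd q m h ih => simp [append, word, ih, mul_assoc]
  | bwd q m h ih => simp [append, word, ih, mul_assoc]

theorem word_reverse {i j : MaxGrp M} (p : Walk S i j) : p.reverse.word = p.word⁻¹ := by
  induction p with
  | nil => simp [reverse, word]
  | fwd p m h ih => simp [reverse, word, word_append, ih]
  | bwd p m h ih => simp [reverse, word, word_append, ih]

theorem word_act (g : MaxGrp M) {i j : MaxGrp M} (p : Walk S i j) :
    (p.act g).word = FreeGroup.map (fun e : MaxGrp M × S => (g * e.1, e.2)) p.word := by
  induction p with
  | nil => simp [act, word]
  | fwd p m h ih => simp [act, word, ih]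
  | bwd p m h ih => simp [act, word, ih]

theorem label_append {i j k : MaxGrp M} (p : Walk S i j) (q : Walk S j k) :
    (p.append q).label = p.label * q.label := by
  induction q with
  | nil => simp [append, label]
  | fwd q m h ih => simp [append, label, ih, mul_assoc]
  | bwd q m h ih => simp [append, label, ih, mul_assoc]

theorem label_reverse {i j : MaxGrp M} (p : Walk S i j) : p.reverse.label = p.label⁻¹ := by
  induction p with
  | nil => simp [reverse, label, inv_idem (one_mul (1 : M))]
  | fwd p m h ih => simp [reverse, label, label_append, ih, mul_inv_rev']
  | bwd p m h ih => simp [reverse, label, label_append, ih, mul_inv_rev', inv_inv']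

theorem label_act (g : MaxGrp M) {i j : MaxGrp M} (p : Walk S i j) :
    (p.act g).label = p.label := by
  induction p with
  | nil => rfl
  | fwd p m h ih => simp [act, label, ih]
  | bwd p m h ih => simp [act, label, ih]

theorem start_mem {i j : MaxGrp M} (p : Walk S i j) : i ∈ p.span.verts := by
  induction p with
  | nil => rfl
  | fwd p m h ih => exact Or.inl ih
  | bwd p m h ih => exact Or.inl ih

theorem end_mem {i j : MaxGrp M} (p : Walk S i j) : j ∈ p.span.verts := by
  cases p with
  | nil => rfl
  | fwd p m h => exact Or.inr (Or.inr h.symm)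
  | bwd p m h => exact Or.inr (Or.inl rfl)

theorem point_le {i : MaxGrp M} {X : SubGr M} (h : i ∈ X.verts) : SubGr.point i ≤ X :=
  ⟨by rintro _ rfl; exact h, fun _ he => he.elim⟩

theorem edge_le {g : MaxGrp M} {m : M} {X : SubGr M} (h : (g, m) ∈ X.edges) :
    SubGr.edge g m ≤ X :=
  ⟨by rintro _ (rfl | rfl); exacts [X.src_mem _ h, X.tgt_mem _ h], by rintro _ rfl; exact h⟩

theorem span_append {i j k : MaxGrp M} (p : Walk S i j) (q : Walk S j k) :
    (p.append q).span = p.span ⊔ q.span := by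
  induction q with
  | nil => exact (sup_eq_left.mpr (point_le p.end_mem)).symm
  | fwd q m h ih => simp [append, span, ih, sup_assoc]
  | bwd q m h ih => simp [append, span, ih, sup_assoc]

theorem span_reverse {i j : MaxGrp M} (p : Walk S i j) : p.reverse.span = p.span := by
  induction p with
  | nil => rfl
  | @fwd j k p m h ih =>
    have hk : SubGr.point k ≤ SubGr.edge j (m : M) := point_le (Or.inr h.symm)
    simp only [reverse, span, span_append, ih]
    rw [sup_eq_right.mpr hk, sup_comm]
  | @bwd j k p m h ih =>
    have hk : SubGr.point k ≤ SubGr.edge k (m : M) := point_le (Or.inl rfl)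
    simp only [reverse, span, span_append, ih]
    rw [sup_eq_right.mpr hk, sup_comm]

theorem toG_label {i j : MaxGrp M} (p : Walk S i j) : i * toG p.label = j := by
  induction p with
  | nil => simp [label]
  | fwd p m h ih => rw [label, map_mul, ← mul_assoc, ih, h]
  | bwd p m h ih => rw [label, map_mul, toG_inv, ← mul_assoc, ih, ← h, mul_inv_cancel_right]

end Walk

namespace SubGr

/-- Connectedness of the underlying undirected graph. -/
def Connected (X : SubGr M) : Prop :=
  X.verts.Nonempty ∧
    ∀ i ∈ X.verts, ∀ j ∈ X.verts, ∃ p : Walk (Set.univ : Set M) i j, p.span ≤ X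

/-- Finite and connected. -/
def FinConn (X : SubGr M) : Prop := X.verts.Finite ∧ X.edges.Finite ∧ X.Connected

/-- The component of `X` that contains the vertex `i`. -/
def component (X : SubGr M) (i : MaxGrp M) : SubGr M where
  verts := {v | ∃ p : Walk (Set.univ : Set M) i v, p.span ≤ X}
  edges := {e | e ∈ X.edges ∧ ∃ p : Walk (Set.univ : Set M) i e.1, p.span ≤ X}
  src_mem := fun _ he => he.2
  tgt_mem := fun e ⟨he, p, hp⟩ =>
    ⟨p.fwd ⟨e.2, trivial⟩ rfl, sup_le hp (Walk.edge_le he)⟩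

open Classical in
/-- The label of a birooted finite connected subgraph: the label of any path from `i` to `j`
that spans `X` (for `E`-unitary `M` it does not depend on the path, see `label_eq`). -/
noncomputable def label (X : SubGr M) (i j : MaxGrp M) : M :=
  if h : ∃ p : Walk (Set.univ : Set M) i j, p.span = X then h.choose.label else 1

/-- The closure of a finite connected subgraph `X` in the graph of all edges with labels in `S`:
the union of all finite connected `Y` with `λ_{(i,j)}(Y) ≥ λ_{(i,j)}(X)` for some common
vertices `i`, `j`. -/
noncomputable def clFC (S : Set M) (X : SubGr M) : SubGr M :=
  sSup {Y | Y.LabelsIn S ∧ Y.FinConn ∧ ∃ i j : MaxGrp M, i ∈ X.verts ∧ j ∈ X.verts ∧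
    i ∈ Y.verts ∧ j ∈ Y.verts ∧ natLE (X.label i j) (Y.label i j)}

/-- The closure of an arbitrary subgraph: the union of the closures of its finite connected
subgraphs. -/
noncomputable def cl (S : Set M) (X : SubGr M) : SubGr M :=
  sSup {Z | ∃ Y : SubGr M, Y ≤ X ∧ Y.FinConn ∧ Z = Y.clFC S}

/-- `X` is the closure of a finite connected subgraph of the graph of all edges with labels
in `S`. -/
def IsClFC (S : Set M) (X : SubGr M) : Prop :=
  ∃ Y : SubGr M, Y.LabelsIn S ∧ Y.FinConn ∧ X = Y.cl S

end SubGr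

end Graphs

/-! ### Properties of labels and of the closure operator needed for the constructions below -/

set_option linter.unusedSectionVars false

section EUnit

variable {M : Type u} [InverseMonoid M] [EUnitary M]

theorem idem_of_toG {h : M} (hh : toG h = 1) : IsIdempotentElem h := by
  rw [← map_one toG, toG_eq] at hh
  obtain ⟨e, he, h1⟩ := hh
  refine EUnitary.idem_of_mul e h he ?_
  rw [h1, mul_one]
  exact he

theorem eq_of_toG_of_dom {a b : M} (h : toG a = toG b) (hd : a * a⁻¹ = b * b⁻¹) : a = b := by
  have h1 : IsIdempotentElem (a⁻¹ * b) := by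
    apply idem_of_toG
    rw [map_mul, toG_inv, h, inv_mul_cancel]
  have h2 : b = a * (a⁻¹ * b) := by
    rw [← mul_assoc, hd, InverseMonoid.mul_inv_mul]
  have h3 : a = b * (a⁻¹ * b) := by
    have : b⁻¹ * a = a⁻¹ * b := by
      rw [← inv_idem h1, mul_inv_rev', inv_inv']
    rw [← this, ← mul_assoc, ← hd, InverseMonoid.mul_inv_mul]
  calc a = b * (a⁻¹ * b) := h3
    _ = a * (a⁻¹ * b) * (a⁻¹ * b) := by rw [← h2]
    _ = a * (a⁻¹ * b) := by rw [mul_assoc, h1]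
    _ = b := h2.symm

theorem idem_mul_eq {e r q : M} (he : IsIdempotentElem e) (h : toG r = toG q)
    (hr : e * (r * r⁻¹) = e) (hq : e * (q * q⁻¹) = e) : e * r = e * q := by
  have key : ∀ x : M, e * (x * x⁻¹) = e → e * x * (e * x)⁻¹ = e := fun x hx => by
    rw [mul_inv_rev', inv_idem he]
    calc e * x * (x⁻¹ * e) = e * (x * x⁻¹) * e := by simp only [mul_assoc]
      _ = e := by rw [hx, he]
  apply eq_of_toG_of_dom
  · rw [map_mul, map_mul, h]
  · rw [key r hr, key q hq]

theorem conj_transfer {e r q f : M} (he : IsIdempotentElem e) (hf : IsIdempotentElem f)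
    (hrq : e * r = e * q) (h : e * (r * f * r⁻¹) = e) : e * (q * f * q⁻¹) = e := by
  have key : ∀ x : M, e * (x * f * x⁻¹) = e * x * f * (e * x)⁻¹ := fun x => by
    have hc := idem_comm he (idem_conj x hf)
    rw [mul_inv_rev', inv_idem he]
    calc e * (x * f * x⁻¹) = e * (e * (x * f * x⁻¹)) := by rw [← mul_assoc e e, he]
      _ = e * x * f * (x⁻¹ * e) := by rw [hc]; simp only [mul_assoc]
  rw [key, ← hrq, ← key, h]

theorem natLE_refl (a : M) : natLE a a := ⟨1, one_mul 1, (one_mul a).symm⟩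

namespace Walk

variable {S T : Set M}

theorem dom_vert {i j : MaxGrp M} (p : Walk S i j) {e f : M}
    (h : e * (p.label * f * (p.label * f)⁻¹) = e) : e * (p.label * p.label⁻¹) = e := by
  have h1 : p.label * f * (p.label * f)⁻¹ * (p.label * p.label⁻¹)
      = p.label * f * (p.label * f)⁻¹ := by
    rw [idem_comm (idem_mul_inv _) (idem_mul_inv _)]
    calc p.label * p.label⁻¹ * (p.label * f * (p.label * f)⁻¹)
        = (p.label * p.label⁻¹ * p.label) * f * (p.label * f)⁻¹ := by simp only [mul_assoc]
      _ = _ := by rw [InverseMonoid.mul_inv_mul]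
  rw [← h, mul_assoc, h1]

/-- Every edge of a path is preceded by an initial segment of the path. -/
theorem dom_edge {i j : MaxGrp M} (p : Walk S i j) :
    ∀ e : M, e * (p.label * p.label⁻¹) = e → ∀ g m, (g, m) ∈ p.span.edges →
      ∃ r : M, i * toG r = g ∧ e * (r * (m * m⁻¹) * r⁻¹) = e := by
  induction p with
  | nil => intro e _ g m h; exact h.elim
  | @fwd j k p m h ih =>
    intro e he g n hn
    rcases hn with hn | hn
    · exact ih e (dom_vert p he) g n hn
    · obtain ⟨rfl, rfl⟩ := Prod.mk.inj hn
      refine ⟨p.label, p.toG_label, ?_⟩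
      simpa only [label, mul_inv_rev', mul_assoc] using he
  | @bwd j k p m h ih =>
    intro e he g n hn
    rcases hn with hn | hn
    · exact ih e (dom_vert p he) g n hn
    · obtain ⟨rfl, rfl⟩ := Prod.mk.inj hn
      refine ⟨p.label * (m : M)⁻¹, (Walk.bwd p m h).toG_label, ?_⟩
      have h1 : p.label * (m : M)⁻¹ * ((m : M) * (m : M)⁻¹) = p.label * (m : M)⁻¹ := by
        rw [mul_assoc, ← mul_assoc (m : M)⁻¹, InverseMonoid.inv_mul_inv]
      rw [h1]
      exact he

theorem dom_le {i j k : MaxGrp M} (p : Walk S i j) (q : Walk T i k) (h : q.span ≤ p.span) :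
    p.label * p.label⁻¹ * (q.label * q.label⁻¹) = p.label * p.label⁻¹ := by
  have hE := idem_mul_inv p.label
  induction q with
  | nil => simp [label, inv_idem (one_mul (1 : M))]
  | @fwd v k q m hm ih =>
    have ih' := ih (le_sup_left.trans h)
    obtain ⟨r, hr, hr'⟩ := p.dom_edge (p.label * p.label⁻¹) hE v m (h.2 (Or.inr rfl))
    have hd : p.label * p.label⁻¹ * (r * r⁻¹) = p.label * p.label⁻¹ := by
      have h1 : r * ((m : M) * (m : M)⁻¹) * r⁻¹ * (r * r⁻¹)
          = r * ((m : M) * (m : M)⁻¹) * r⁻¹ := by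
        rw [mul_assoc _ r⁻¹, ← mul_assoc r⁻¹, InverseMonoid.inv_mul_inv]
      conv_lhs => rw [← hr']
      rw [mul_assoc, h1, hr']
    have hG : toG r = toG q.label := mul_left_cancel (hr.trans q.toG_label.symm)
    have := conj_transfer hE (idem_mul_inv (m : M)) (idem_mul_eq hE hG hd ih') hr'
    simpa only [label, mul_inv_rev', mul_assoc] using this
  | @bwd v k q m hm ih =>
    have ih' := ih (le_sup_left.trans h)
    obtain ⟨r, hr, hr'⟩ := p.dom_edge (p.label * p.label⁻¹) hE k m (h.2 (Or.inr rfl))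
    have hr2 : p.label * p.label⁻¹ * (r * (m : M) * (r * (m : M))⁻¹) = p.label * p.label⁻¹ := by
      rw [mul_inv_rev']
      simpa only [mul_assoc] using hr'
    have hr3 : p.label * p.label⁻¹ * (r * (m : M) * ((m : M)⁻¹ * (m : M)) * (r * (m : M))⁻¹)
        = p.label * p.label⁻¹ := by
      have : r * (m : M) * ((m : M)⁻¹ * (m : M)) = r * (m : M) := by
        rw [mul_assoc, ← mul_assoc (m : M), InverseMonoid.mul_inv_mul]
      rw [this, hr2]
    have hG : toG (r * (m : M)) = toG q.label := by
      apply mul_left_cancel (a := i)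
      rw [q.toG_label, map_mul, ← mul_assoc, hr, hm]
    have := conj_transfer hE (idem_inv_mul (m : M)) (idem_mul_eq hE hG hr2 ih') hr3
    simpa only [label, mul_inv_rev', inv_inv', mul_assoc] using this

theorem label_le {i j : MaxGrp M} (p : Walk S i j) (q : Walk T i j) (h : q.span ≤ p.span) :
    natLE p.label q.label := by
  have hE := idem_mul_inv p.label
  refine ⟨p.label * p.label⁻¹, hE, ?_⟩
  have hG : toG p.label = toG q.label :=
    mul_left_cancel (p.toG_label.trans q.toG_label.symm)
  rw [← idem_mul_eq hE hG hE (dom_le p q h), InverseMonoid.mul_inv_mul]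

theorem natLE_antisymm {a b : M} (h : natLE a b) (h' : natLE b a) : a = b := by
  obtain ⟨e, he, rfl⟩ := h
  obtain ⟨f, hf, h⟩ := h'
  have : e * b = e * (f * (e * b)) := by rw [← h]
  rw [this, ← mul_assoc f, idem_comm hf he, mul_assoc e f, ← mul_assoc e e, he,
    ← mul_assoc, idem_comm he hf, mul_assoc]
  exact h.symm

/-- Coterminal paths that span the same subgraph have the same label. -/
theorem label_congr {i j : MaxGrp M} (p : Walk S i j) (q : Walk T i j) (h : p.span = q.span) :
    p.label = q.label :=
  natLE_antisymm (label_le p q h.ge) (label_le q p h.le)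

end Walk

namespace SubGr

variable {S : Set M}

theorem le_sSup' {𝒳 : Set (SubGr M)} {X : SubGr M} (h : X ∈ 𝒳) : X ≤ sSup 𝒳 :=
  ⟨fun _ hv => ⟨X, h, hv⟩, fun _ he => ⟨X, h, he⟩⟩

theorem sSup_le' {𝒳 : Set (SubGr M)} {Y : SubGr M} (h : ∀ X ∈ 𝒳, X ≤ Y) : sSup 𝒳 ≤ Y :=
  ⟨fun _ ⟨X, hX, hv⟩ => (h X hX).1 hv, fun _ ⟨X, hX, he⟩ => (h X hX).2 he⟩

theorem label_eq {X : SubGr M} {i j : MaxGrp M} (p : Walk (Set.univ : Set M) i j)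
    (h : p.span = X) : X.label i j = p.label := by
  have hex : ∃ p : Walk (Set.univ : Set M) i j, p.span = X := ⟨p, h⟩
  rw [label, dif_pos hex]
  exact Walk.label_congr _ _ (hex.choose_spec.trans h.symm)

theorem exists_loop {X : SubGr M} (hX : X.FinConn) {i : MaxGrp M} (hi : i ∈ X.verts) :
    ∃ p : Walk (Set.univ : Set M) i i, p.span = X := by
  obtain ⟨hV, hE, -, hC⟩ := hX
  have h1 : ∀ s : Set (MaxGrp M), s.Finite → s ⊆ X.verts →
      ∃ p : Walk (Set.univ : Set M) i i, p.span ≤ X ∧ s ⊆ p.span.verts := by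
    intro s hs
    induction s, hs using Set.Finite.induction_on with
    | empty => exact fun _ => ⟨Walk.nil, Walk.point_le hi, Set.empty_subset _⟩
    | @insert v s _ _ ih =>
      intro hsub
      obtain ⟨p, hp, hsp⟩ := ih ((Set.subset_insert _ _).trans hsub)
      obtain ⟨q, hq⟩ := hC i hi v (hsub (Set.mem_insert _ _))
      refine ⟨(p.append q).append q.reverse, ?_, ?_⟩
      · rw [Walk.span_append, Walk.span_append, Walk.span_reverse]
        exact sup_le (sup_le hp hq) hq
      · rw [Walk.span_append, Walk.span_append, Walk.span_reverse]
        refine Set.insert_subset (Or.inr q.end_mem) (hsp.trans ?_)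
        exact fun x hx => Or.inl (Or.inl hx)
  have h2 : ∀ s : Set (MaxGrp M × M), s.Finite → s ⊆ X.edges →
      ∃ p : Walk (Set.univ : Set M) i i, p.span ≤ X ∧ s ⊆ p.span.edges := by
    intro s hs
    induction s, hs using Set.Finite.induction_on with
    | empty => exact fun _ => ⟨Walk.nil, Walk.point_le hi, Set.empty_subset _⟩
    | @insert e s _ _ ih =>
      intro hsub
      obtain ⟨p, hp, hsp⟩ := ih ((Set.subset_insert _ _).trans hsub)
      have he : e ∈ X.edges := hsub (Set.mem_insert _ _)
      obtain ⟨q0, hq0⟩ := hC i hi e.1 (X.src_mem _ he)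
      let q := q0.fwd ⟨e.2, trivial⟩ rfl
      have hq : q.span ≤ X := sup_le hq0 (Walk.edge_le he)
      refine ⟨(p.append q).append q.reverse, ?_, ?_⟩
      · rw [Walk.span_append, Walk.span_append, Walk.span_reverse]
        exact sup_le (sup_le hp hq) hq
      · rw [Walk.span_append, Walk.span_append, Walk.span_reverse]
        refine Set.insert_subset (Or.inr (Or.inr rfl)) (hsp.trans ?_)
        exact fun x hx => Or.inl (Or.inl hx)
  obtain ⟨p, hp, hp'⟩ := h1 _ hV subset_rfl
  obtain ⟨q, hq, hq'⟩ := h2 _ hE subset_rfl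
  refine ⟨p.append q, ?_⟩
  rw [Walk.span_append]
  exact le_antisymm (sup_le hp hq)
    ⟨fun x hx => Or.inl (hp' hx), fun x hx => Or.inr (hq' hx)⟩

theorem exists_walk {X : SubGr M} (hX : X.FinConn) {i j : MaxGrp M} (hi : i ∈ X.verts)
    (hj : j ∈ X.verts) : ∃ p : Walk (Set.univ : Set M) i j, p.span = X := by
  obtain ⟨p, hp⟩ := exists_loop hX hi
  obtain ⟨q, hq⟩ := hX.2.2.2 i hi j hj
  exact ⟨p.append q, by rw [Walk.span_append, hp]; exact sup_eq_left.mpr hq⟩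

theorem finConn_sup {X Y : SubGr M} (hX : X.FinConn) (hY : Y.FinConn) {k : MaxGrp M}
    (hkX : k ∈ X.verts) (hkY : k ∈ Y.verts) : (X ⊔ Y).FinConn := by
  have key : ∀ i ∈ (X ⊔ Y).verts, ∃ p : Walk (Set.univ : Set M) i k, p.span ≤ X ⊔ Y := by
    rintro i (hi | hi)
    · obtain ⟨p, hp⟩ := hX.2.2.2 i hi k hkX
      exact ⟨p, hp.trans le_sup_left⟩
    · obtain ⟨p, hp⟩ := hY.2.2.2 i hi k hkY
      exact ⟨p, hp.trans le_sup_right⟩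
  refine ⟨hX.1.union hY.1, hX.2.1.union hY.2.1, ⟨k, Or.inl hkX⟩, fun i hi j hj => ?_⟩
  obtain ⟨p, hp⟩ := key i hi
  obtain ⟨q, hq⟩ := key j hj
  refine ⟨p.append q.reverse, ?_⟩
  rw [Walk.span_append, Walk.span_reverse]
  exact sup_le hp hq

theorem finConn_point (i : MaxGrp M) : (point i).FinConn := by
  refine ⟨Set.finite_singleton i, Set.finite_empty, ⟨i, rfl⟩, ?_⟩
  rintro _ rfl _ rfl
  exact ⟨Walk.nil, le_rfl⟩

theorem finConn_edge (g : MaxGrp M) (m : M) : (edge g m).FinConn := by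
  refine ⟨Set.toFinite {g, g * toG m}, Set.finite_singleton _, ⟨g, Or.inl rfl⟩, ?_⟩
  have hp : ∀ v ∈ (edge g m).verts, point v ≤ edge g m := fun v hv => Walk.point_le hv
  rintro _ (rfl | rfl) _ (rfl | rfl)
  · exact ⟨Walk.nil, hp _ (Or.inl rfl)⟩
  · exact ⟨Walk.nil.fwd ⟨m, trivial⟩ rfl, sup_le (hp _ (Or.inl rfl)) le_rfl⟩
  · exact ⟨Walk.nil.bwd ⟨m, trivial⟩ rfl, sup_le (hp _ (Or.inr rfl)) le_rfl⟩
  · exact ⟨Walk.nil, hp _ (Or.inr rfl)⟩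

theorem finConn_span {T : Set M} {i j : MaxGrp M} (p : Walk T i j) : p.span.FinConn := by
  induction p with
  | nil => exact finConn_point i
  | @fwd j k p m h ih => exact finConn_sup ih (finConn_edge _ _) p.end_mem (Or.inl rfl)
  | @bwd j k p m h ih => exact finConn_sup ih (finConn_edge _ _) p.end_mem (Or.inr h.symm)

/-- If enlarging `W₁` to `V` preserves the label, then so does enlarging `W ≥ W₁` by `V`. -/
theorem label_sup {W₁ V W : SubGr M} (h₁ : W₁.FinConn) (hV : V.FinConn) (hW : W.FinConn)
    (hWV : W₁ ≤ V) (hWW : W₁ ≤ W) {i j : MaxGrp M} (hi : i ∈ W₁.verts) (hj : j ∈ W₁.verts)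
    (h : V.label i j = W₁.label i j) : (V ⊔ W).label i j = W.label i j := by
  obtain ⟨w₁, hw₁⟩ := exists_walk h₁ hi hj
  obtain ⟨v, hv⟩ := exists_walk hV (hWV.1 hi) (hWV.1 hj)
  obtain ⟨w, hw⟩ := exists_walk hW (hWW.1 hi) (hWW.1 hj)
  rw [label_eq v hv, label_eq w₁ hw₁] at h
  rw [label_eq ((v.append v.reverse).append w), label_eq ((w₁.append w₁.reverse).append w)]
  · simp only [Walk.label_append, Walk.label_reverse, h]
  · simp only [Walk.span_append, Walk.span_reverse, hw₁, hw, sup_idem]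
    exact sup_eq_right.mpr hWW
  · simp only [Walk.span_append, Walk.span_reverse, hv, hw, sup_idem]

theorem label_base {W V : SubGr M} (hW : W.FinConn) (hV : V.FinConn) (hWV : W ≤ V)
    {i j : MaxGrp M} (hi : i ∈ W.verts) (hj : j ∈ W.verts) (h : V.label i j = W.label i j)
    {k l : MaxGrp M} (hk : k ∈ W.verts) (hl : l ∈ W.verts) : V.label k l = W.label k l := by
  obtain ⟨w, hw⟩ := exists_walk hW hi hj
  obtain ⟨v, hv⟩ := exists_walk hV (hWV.1 hi) (hWV.1 hj)
  obtain ⟨p, hp⟩ := exists_walk hW hk hi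
  obtain ⟨q, hq⟩ := exists_walk hW hj hl
  rw [label_eq v hv, label_eq w hw] at h
  rw [label_eq ((p.append v).append q), label_eq ((p.append w).append q)]
  · simp only [Walk.label_append, h]
  · simp only [Walk.span_append, hp, hq, hw, sup_idem]
  · simp only [Walk.span_append, hp, hq, hv]
    rw [sup_eq_right.mpr hWV, sup_eq_left.mpr hWV]

theorem label_sup_of_le {X Y : SubGr M} (hX : X.FinConn) (hY : Y.FinConn) {i j : MaxGrp M}
    (hi : i ∈ X.verts) (hj : j ∈ X.verts) (hi' : i ∈ Y.verts) (hj' : j ∈ Y.verts)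
    (h : natLE (X.label i j) (Y.label i j)) : (X ⊔ Y).label i j = X.label i j := by
  obtain ⟨r, hr⟩ := exists_walk hX hi hj
  obtain ⟨s, hs⟩ := exists_walk hY hi' hj'
  rw [label_eq r hr, label_eq s hs] at h
  rw [label_eq ((r.append r.reverse).append s) (by
    simp only [Walk.span_append, Walk.span_reverse, hr, hs, sup_idem]), label_eq r hr]
  simp only [Walk.label_append, Walk.label_reverse]
  obtain ⟨e, he, h⟩ := h
  have h1 : e * (r.label * r.label⁻¹) = r.label * r.label⁻¹ := by
    rw [h, ← mul_assoc, ← mul_assoc, he]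
  rw [← h1, idem_comm he (idem_mul_inv _), mul_assoc, ← h, InverseMonoid.mul_inv_mul]

/-- `V` is a finite connected enlargement, with the same label, of a finite connected subgraph
of `X`. -/
def Ext (S : Set M) (X V : SubGr M) : Prop :=
  V.FinConn ∧ V.LabelsIn S ∧ ∃ W : SubGr M, W.FinConn ∧ W ≤ X ∧ W ≤ V ∧
    ∃ i ∈ W.verts, ∃ j ∈ W.verts, V.label i j = W.label i j

theorem LabelsIn.mono {X Y : SubGr M} (h : Y.LabelsIn S) (hXY : X ≤ Y) : X.LabelsIn S :=
  fun e he => h e (hXY.2 he)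

theorem LabelsIn.sup {X Y : SubGr M} (hX : X.LabelsIn S) (hY : Y.LabelsIn S) :
    (X ⊔ Y).LabelsIn S := by
  rintro e (he | he)
  exacts [hX e he, hY e he]

theorem Ext.le_cl {X V : SubGr M} (h : Ext S X V) : V ≤ X.cl S := by
  obtain ⟨hV, hS, W, hW, hWX, hWV, i, hi, j, hj, hl⟩ := h
  refine le_trans ?_ (le_sSup' ⟨W, hWX, hW, rfl⟩)
  refine le_sSup' ⟨hS, hV, i, j, hi, hj, hWV.1 hi, hWV.1 hj, ?_⟩
  rw [hl]
  exact natLE_refl _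

theorem Ext.of_le {X V : SubGr M} (hX : X.LabelsIn S) (hV : V.FinConn) (hVX : V ≤ X) :
    Ext S X V := by
  obtain ⟨i, hi⟩ := hV.2.2.1
  exact ⟨hV, hX.mono hVX, V, hV, hVX, le_rfl, i, hi, i, hi, rfl⟩

theorem cl_eq {X : SubGr M} (hX : X.LabelsIn S) : X.cl S = sSup {V | Ext S X V} := by
  refine le_antisymm ?_ (sSup_le' fun V hV => hV.le_cl)
  refine sSup_le' ?_
  rintro _ ⟨W, hWX, hW, rfl⟩
  refine sSup_le' ?_
  rintro Z ⟨hZS, hZ, i, j, hi, hj, hi', hj', hl⟩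
  refine le_trans (le_sup_right : Z ≤ W ⊔ Z) (le_sSup' ?_)
  exact ⟨finConn_sup hW hZ hi hi', (hX.mono hWX).sup hZS, W, hW, hWX, le_sup_left, i, hi, j, hj,
    label_sup_of_le hW hZ hi hj hi' hj' hl⟩

theorem labelsIn_cl (X : SubGr M) : (X.cl S).LabelsIn S := by
  rintro e ⟨_, ⟨W, -, -, rfl⟩, Z, ⟨hZ, -⟩, he⟩
  exact hZ e he

theorem cl_mono {X Y : SubGr M} (h : X ≤ Y) : X.cl S ≤ Y.cl S := by
  refine sSup_le' ?_
  rintro _ ⟨W, hWX, hW, rfl⟩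
  exact le_sSup' ⟨W, hWX.trans h, hW, rfl⟩

theorem le_cl {X : SubGr M} (hX : X.LabelsIn S) : X ≤ X.cl S := by
  constructor
  · intro v hv
    exact (Ext.of_le hX (finConn_point v) (Walk.point_le hv)).le_cl.1 rfl
  · intro e he
    exact (Ext.of_le hX (finConn_edge e.1 e.2) (Walk.edge_le he)).le_cl.2 rfl

theorem Ext.directed {X V₁ V₂ : SubGr M} (hX : X.Connected) (hS : X.LabelsIn S)
    (h₁ : Ext S X V₁) (h₂ : Ext S X V₂) : ∃ V, Ext S X V ∧ V₁ ≤ V ∧ V₂ ≤ V := by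
  obtain ⟨hV₁, hS₁, W₁, hW₁, hWX₁, hWV₁, i₁, hi₁, j₁, hj₁, hl₁⟩ := h₁
  obtain ⟨hV₂, hS₂, W₂, hW₂, hWX₂, hWV₂, i₂, hi₂, j₂, hj₂, hl₂⟩ := h₂
  obtain ⟨r, hr⟩ := hX.2 i₁ (hWX₁.1 hi₁) i₂ (hWX₂.1 hi₂)
  have hWr : (W₁ ⊔ r.span).FinConn := finConn_sup hW₁ (finConn_span r) hi₁ r.start_mem
  have hW : (W₁ ⊔ r.span ⊔ W₂).FinConn := finConn_sup hWr hW₂ (Or.inr r.end_mem) hi₂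
  set W := W₁ ⊔ r.span ⊔ W₂ with hWdef
  have hWX : W ≤ X := sup_le (sup_le hWX₁ hr) hWX₂
  have hle₁ : W₁ ≤ W := le_sup_left.trans le_sup_left
  have hle₂ : W₂ ≤ W := le_sup_right
  have e₁ := label_sup hW₁ hV₁ hW hWV₁ hle₁ hi₁ hj₁ hl₁
  have e₂ := label_sup hW₂ hV₂ hW hWV₂ hle₂ hi₂ hj₂ hl₂
  have hVW₁ : (V₁ ⊔ W).FinConn := finConn_sup hV₁ hW (hWV₁.1 hi₁) (hle₁.1 hi₁)
  have hVW₂ : (V₂ ⊔ W).FinConn := finConn_sup hV₂ hW (hWV₂.1 hi₂) (hle₂.1 hi₂)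
  have hVV : (V₁ ⊔ W ⊔ (V₂ ⊔ W)).FinConn :=
    finConn_sup hVW₁ hVW₂ (Or.inr (hle₁.1 hi₁)) (Or.inr (hle₁.1 hi₁))
  have e₂' := label_base hW hVW₂ le_sup_right (hle₂.1 hi₂) (hle₂.1 hj₂) e₂
    (hle₁.1 hi₁) (hle₁.1 hj₁)
  have e₃ := label_sup hW hVW₁ hVW₂ le_sup_right le_sup_right (hle₁.1 hi₁) (hle₁.1 hj₁) e₁
  refine ⟨V₁ ⊔ W ⊔ (V₂ ⊔ W), ⟨hVV, ?_, W, hW, hWX, le_sup_right.trans le_sup_left,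
    i₁, hle₁.1 hi₁, j₁, hle₁.1 hj₁, e₃.trans e₂'⟩, le_sup_left.trans le_sup_left,
    le_sup_left.trans le_sup_right⟩
  have hWS := hS.mono hWX
  exact (hS₁.sup hWS).sup (hS₂.sup hWS)

theorem Ext.exists_of_finite {X Y : SubGr M} (hX : X.Connected) (hS : X.LabelsIn S)
    (hY : Y.FinConn) (hYX : Y ≤ X.cl S) : ∃ V, Ext S X V ∧ Y ≤ V := by
  rw [cl_eq hS] at hYX
  obtain ⟨i, hi⟩ := hX.1
  have h0 : Ext S X (point i) := Ext.of_le hS (finConn_point i) (Walk.point_le hi)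
  have h1 : ∀ s : Set (MaxGrp M), s.Finite → s ⊆ Y.verts → ∃ V, Ext S X V ∧ s ⊆ V.verts := by
    intro s hs
    induction s, hs using Set.Finite.induction_on with
    | empty => exact fun _ => ⟨_, h0, Set.empty_subset _⟩
    | @insert v s _ _ ih =>
      intro hsub
      obtain ⟨V₁, hV₁, hs₁⟩ := ih ((Set.subset_insert _ _).trans hsub)
      obtain ⟨V₂, hV₂, hv⟩ := hYX.1 (hsub (Set.mem_insert _ _))
      obtain ⟨V, hV, h₁, h₂⟩ := Ext.directed hX hS hV₁ hV₂
      exact ⟨V, hV, Set.insert_subset (h₂.1 hv) (hs₁.trans h₁.1)⟩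
  have h2 : ∀ s : Set (MaxGrp M × M), s.Finite → s ⊆ Y.edges →
      ∃ V, Ext S X V ∧ s ⊆ V.edges := by
    intro s hs
    induction s, hs using Set.Finite.induction_on with
    | empty => exact fun _ => ⟨_, h0, Set.empty_subset _⟩
    | @insert v s _ _ ih =>
      intro hsub
      obtain ⟨V₁, hV₁, hs₁⟩ := ih ((Set.subset_insert _ _).trans hsub)
      obtain ⟨V₂, hV₂, hv⟩ := hYX.2 (hsub (Set.mem_insert _ _))
      obtain ⟨V, hV, h₁, h₂⟩ := Ext.directed hX hS hV₁ hV₂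
      exact ⟨V, hV, Set.insert_subset (h₂.2 hv) (hs₁.trans h₁.2)⟩
  obtain ⟨V₁, hV₁, hs₁⟩ := h1 _ hY.1 subset_rfl
  obtain ⟨V₂, hV₂, hs₂⟩ := h2 _ hY.2.1 subset_rfl
  obtain ⟨V, hV, h₁, h₂⟩ := Ext.directed hX hS hV₁ hV₂
  exact ⟨V, hV, hs₁.trans h₁.1, hs₂.trans h₂.2⟩

/-- The closure of a connected subgraph is closed. -/
theorem cl_cl {X : SubGr M} (hX : X.Connected) (hS : X.LabelsIn S) :
    (X.cl S).cl S = X.cl S := by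
  refine le_antisymm ?_ (le_cl (labelsIn_cl X))
  rw [cl_eq (labelsIn_cl X)]
  refine sSup_le' ?_
  rintro V₂ ⟨hV₂, hS₂, Y, hY, hYX, hYV, i, hi, j, hj, hl⟩
  obtain ⟨V, ⟨hV, hSV, W, hW, hWX, hWV, k, hk, l, hkl, hl'⟩, hYV'⟩ :=
    Ext.exists_of_finite hX hS hY hYX
  have hVV : (V₂ ⊔ V).FinConn := finConn_sup hV₂ hV (hYV.1 hi) (hYV'.1 hi)
  have e := label_sup hY hV₂ hV hYV hYV' hi hj hl
  have e' := label_base hV hVV le_sup_right (hYV'.1 hi) (hYV'.1 hj) e (hWV.1 hk) (hWV.1 hkl)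
  exact le_sup_left.trans (Ext.le_cl (S := S) (X := X)
    ⟨hVV, hS₂.sup hSV, W, hW, hWX, hWV.trans le_sup_right, k, hk, l, hkl, e'.trans hl'⟩)

theorem IsClFC.closed {X : SubGr M} (h : IsClFC S X) : X.cl S = X := by
  obtain ⟨Y, hS, hY, rfl⟩ := h
  exact cl_cl hY.2.2 hS

theorem IsClFC.labelsIn {X : SubGr M} (h : IsClFC S X) : X.LabelsIn S := by
  obtain ⟨Y, -, -, rfl⟩ := h
  exact labelsIn_cl Y

theorem IsClFC.rebase {X : SubGr M} (h : IsClFC S X) {k : MaxGrp M} (hk : k ∈ X.verts) :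
    ∃ Y : SubGr M, Y.LabelsIn S ∧ Y.FinConn ∧ X = Y.cl S ∧ k ∈ Y.verts := by
  obtain ⟨Y, hS, hY, rfl⟩ := h
  obtain ⟨V₁, hV₁, hk₁⟩ := Ext.exists_of_finite hY.2.2 hS (finConn_point k) (Walk.point_le hk)
  obtain ⟨V, hV, h₁, h₂⟩ := Ext.directed hY.2.2 hS hV₁ (Ext.of_le hS hY le_rfl)
  refine ⟨V, hV.2.1, hV.1, le_antisymm (cl_mono h₂) ?_, h₁.1 (hk₁.1 rfl)⟩
  rw [← cl_cl hY.2.2 hS]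
  exact cl_mono hV.le_cl

theorem IsClFC.join {X Y : SubGr M} (hX : IsClFC S X) (hY : IsClFC S Y) {k : MaxGrp M}
    (hkX : k ∈ X.verts) (hkY : k ∈ Y.verts) : IsClFC S ((X ⊔ Y).cl S) := by
  obtain ⟨X', hSX, hX', rfl, hkX'⟩ := hX.rebase hkX
  obtain ⟨Y', hSY, hY', rfl, hkY'⟩ := hY.rebase hkY
  have hS := hSX.sup hSY
  have hC := finConn_sup hX' hY' hkX' hkY'
  refine ⟨X' ⊔ Y', hS, hC, le_antisymm ?_ ?_⟩
  · rw [← cl_cl hC.2.2 hS]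
    exact cl_mono (sup_le (cl_mono le_sup_left) (cl_mono le_sup_right))
  · exact cl_mono (sup_le_sup (le_cl hSX) (le_cl hSY))

theorem isClFC_point (i : MaxGrp M) : IsClFC S ((point i).cl S) :=
  ⟨point i, fun _ he => False.elim he, finConn_point i, rfl⟩

theorem isClFC_edge (g : MaxGrp M) {m : M} (hm : m ∈ S) : IsClFC S ((edge g m).cl S) :=
  ⟨_, by rintro _ rfl; exact hm, finConn_edge g m, rfl⟩

theorem mem_cl_point (i : MaxGrp M) : i ∈ ((point i).cl S).verts :=
  (le_cl (S := S) (X := point i) fun _ he => he.elim).1 rfl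

theorem IsClFC.cl_point_le {X : SubGr M} (hX : IsClFC S X) {i : MaxGrp M} (hi : i ∈ X.verts) :
    (point i).cl S ≤ X := by
  rw [← hX.closed]
  exact cl_mono (Walk.point_le hi)

theorem le_join_left {X Y : SubGr M} (hX : X.LabelsIn S) (hY : Y.LabelsIn S) :
    X ≤ (X ⊔ Y).cl S := le_sup_left.trans (le_cl (hX.sup hY))

theorem le_join_right {X Y : SubGr M} (hX : X.LabelsIn S) (hY : Y.LabelsIn S) :
    Y ≤ (X ⊔ Y).cl S := le_sup_right.trans (le_cl (hX.sup hY))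

theorem IsClFC.join_le {X Y Z : SubGr M} (hZ : IsClFC S Z) (hX : X ≤ Z) (hY : Y ≤ Z) :
    (X ⊔ Y).cl S ≤ Z := by
  rw [← hZ.closed]
  exact cl_mono (sup_le hX hY)

theorem join_assoc {X Y Z : SubGr M} (hX : IsClFC S X) (hY : IsClFC S Y) (hZ : IsClFC S Z)
    {j k : MaxGrp M} (hjX : j ∈ X.verts) (hjY : j ∈ Y.verts) (hkY : k ∈ Y.verts)
    (hkZ : k ∈ Z.verts) :
    ((X ⊔ Y).cl S ⊔ Z).cl S = (X ⊔ (Y ⊔ Z).cl S).cl S := by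
  have hXY := hX.join hY hjX hjY
  have hYZ := hY.join hZ hkY hkZ
  have lX := hX.labelsIn
  have lY := hY.labelsIn
  have lZ := hZ.labelsIn
  have hL := hXY.join hZ ((le_join_right lX lY).1 hkY) hkZ
  have hR := hX.join hYZ hjX ((le_join_left lY lZ).1 hjY)
  have a := le_join_left hXY.labelsIn lZ
  have b := le_join_right hXY.labelsIn lZ
  have c := le_join_left lX hYZ.labelsIn
  have d := le_join_right lX hYZ.labelsIn
  refine le_antisymm (hR.join_le (hR.join_le c ((le_join_left lY lZ).trans d))
    ((le_join_right lY lZ).trans d)) (hL.join_le ((le_join_left lX lY).trans a)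
    (hL.join_le ((le_join_right lX lY).trans a) b))

/-! The action of `M/σ`. -/

theorem smul_smul' (g h : MaxGrp M) (X : SubGr M) : g • h • X = (g * h) • X := by
  apply SubGr.ext
  · ext v
    change h⁻¹ * (g⁻¹ * v) ∈ X.verts ↔ (g * h)⁻¹ * v ∈ X.verts
    rw [mul_inv_rev, mul_assoc]
  · ext e
    change (h⁻¹ * (g⁻¹ * e.1), e.2) ∈ X.edges ↔ ((g * h)⁻¹ * e.1, e.2) ∈ X.edges
    rw [mul_inv_rev, mul_assoc]

theorem one_smul' (X : SubGr M) : (1 : MaxGrp M) • X = X := by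
  apply SubGr.ext
  · ext v
    change 1⁻¹ * v ∈ X.verts ↔ v ∈ X.verts
    rw [inv_one, one_mul]
  · ext e
    change (1⁻¹ * e.1, e.2) ∈ X.edges ↔ e ∈ X.edges
    rw [inv_one, one_mul]

theorem smul_mono (g : MaxGrp M) {X Y : SubGr M} (h : X ≤ Y) : g • X ≤ g • Y :=
  ⟨fun _ hv => h.1 hv, fun _ he => h.2 he⟩

theorem mem_smul (g : MaxGrp M) {X : SubGr M} {v : MaxGrp M} (h : v ∈ X.verts) :
    g * v ∈ (g • X).verts := by
  change g⁻¹ * (g * v) ∈ X.verts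
  rwa [inv_mul_cancel_left]

theorem smul_sup (g : MaxGrp M) (X Y : SubGr M) : g • (X ⊔ Y) = g • X ⊔ g • Y := rfl

theorem span_act {T : Set M} (g : MaxGrp M) {i j : MaxGrp M} (p : Walk T i j) :
    (p.act g).span = g • p.span := by
  have hedge : ∀ (v : MaxGrp M) (m : M), edge (g * v) m = g • edge v m := by
    intro v m
    apply SubGr.ext
    · ext w
      change (w = g * v ∨ w = g * v * toG m) ↔ (g⁻¹ * w = v ∨ g⁻¹ * w = v * toG m)
      rw [inv_mul_eq_iff_eq_mul, inv_mul_eq_iff_eq_mul, mul_assoc]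
    · ext ⟨w, n⟩
      change (w, n) = (g * v, m) ↔ (g⁻¹ * w, n) = (v, m)
      rw [Prod.mk.injEq, Prod.mk.injEq, inv_mul_eq_iff_eq_mul]
  induction p with
  | nil =>
    apply SubGr.ext
    · ext w
      change w = g * i ↔ g⁻¹ * w = i
      rw [inv_mul_eq_iff_eq_mul]
    · rfl
  | fwd p m h ih => simp only [Walk.act, Walk.span, ih, hedge, smul_sup]
  | bwd p m h ih => simp only [Walk.act, Walk.span, ih, hedge, smul_sup]

theorem finConn_smul (g : MaxGrp M) {X : SubGr M} (hX : X.FinConn) : (g • X).FinConn := by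
  obtain ⟨i, hi⟩ := hX.2.2.1
  obtain ⟨p, hp⟩ := exists_loop hX hi
  rw [← hp, ← span_act]
  exact finConn_span _

theorem label_smul (g : MaxGrp M) {X : SubGr M} (hX : X.FinConn) {i j : MaxGrp M}
    (hi : i ∈ X.verts) (hj : j ∈ X.verts) : (g • X).label (g * i) (g * j) = X.label i j := by
  obtain ⟨p, hp⟩ := exists_walk hX hi hj
  rw [label_eq p hp, label_eq (p.act g) (by rw [span_act, hp]), Walk.label_act]

theorem smul_cl_le (g : MaxGrp M) (X : SubGr M) : g • X.cl S ≤ (g • X).cl S := by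
  have key : ∀ W Z : SubGr M, W ≤ X → W.FinConn → Z.LabelsIn S → Z.FinConn →
      (∃ i j : MaxGrp M, i ∈ W.verts ∧ j ∈ W.verts ∧ i ∈ Z.verts ∧ j ∈ Z.verts ∧
        natLE (W.label i j) (Z.label i j)) → g • Z ≤ (g • X).cl S := by
    rintro W Z hWX hW hZS hZ ⟨i, j, hi, hj, hi', hj', hl⟩
    refine le_trans ?_ (le_sSup' ⟨g • W, smul_mono g hWX, finConn_smul g hW, rfl⟩)
    refine le_sSup' ⟨fun e he => hZS (g⁻¹ * e.1, e.2) he, finConn_smul g hZ, g * i, g * j, mem_smul g hi,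
      mem_smul g hj, mem_smul g hi', mem_smul g hj', ?_⟩
    rwa [label_smul g hW hi hj, label_smul g hZ hi' hj']
  constructor
  · rintro v ⟨_, ⟨W, hWX, hW, rfl⟩, Z, ⟨hZS, hZ, h⟩, hv⟩
    exact (key W Z hWX hW hZS hZ h).1 hv
  · rintro e ⟨_, ⟨W, hWX, hW, rfl⟩, Z, ⟨hZS, hZ, h⟩, he⟩
    exact (key W Z hWX hW hZS hZ h).2 he

theorem smul_cl (g : MaxGrp M) (X : SubGr M) : g • X.cl S = (g • X).cl S := by
  refine le_antisymm (smul_cl_le g X) ?_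
  have h := smul_mono g (smul_cl_le (S := S) g⁻¹ (g • X))
  rwa [smul_smul', smul_smul', mul_inv_cancel, one_smul', inv_mul_cancel, one_smul'] at h

theorem IsClFC.smul (g : MaxGrp M) {X : SubGr M} (hX : IsClFC S X) : IsClFC S (g • X) := by
  obtain ⟨Y, hS, hY, rfl⟩ := hX
  exact ⟨g • Y, fun e he => hS (g⁻¹ * e.1, e.2) he, finConn_smul g hY, smul_cl g Y⟩

end SubGr

end EUnit

/-! ### Inverse categories and dual premorphisms -/

open CategoryTheory

/-- Inverse categories: every arrow `f` has a unique `g` with `f g f = f` and `g f g = g`. -/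
class InverseCategory (C : Type u) extends Category.{u} C where
  inv : ∀ {X Y : C}, (X ⟶ Y) → (Y ⟶ X)
  comp_inv_comp : ∀ {X Y : C} (f : X ⟶ Y), (f ≫ inv f) ≫ f = f
  inv_comp_inv : ∀ {X Y : C} (f : X ⟶ Y), (inv f ≫ f) ≫ inv f = inv f
  inv_unique : ∀ {X Y : C} (f : X ⟶ Y) (g : Y ⟶ X),
    (f ≫ g) ≫ f = f → (g ≫ f) ≫ g = g → g = inv f

/-- The natural partial order of an inverse category. -/
def arrLE {C : Type u} [InverseCategory C] {X Y : C} (f g : X ⟶ Y) : Prop :=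
  ∃ h : Y ⟶ Y, h ≫ h = h ∧ f = g ≫ h

/-- Dual premorphisms between inverse categories. -/
structure IsCatDualPremorphism {C D : Type u} [InverseCategory C] [InverseCategory D]
    (Ψ : C ⥤q D) : Prop where
  map_id : ∀ X : C, Ψ.map (𝟙 X) = 𝟙 (Ψ.obj X)
  map_inv : ∀ {X Y : C} (f : X ⟶ Y),
    Ψ.map (InverseCategory.inv f) = InverseCategory.inv (Ψ.map f)
  map_comp : ∀ {X Y Z : C} (f : X ⟶ Y) (g : Y ⟶ Z),
    arrLE (Ψ.map f ≫ Ψ.map g) (Ψ.map (f ≫ g))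

/-- Dual premorphisms between inverse monoids. -/
structure IsDualPremorphism {H M : Type u} [InverseMonoid H] [InverseMonoid M]
    (ψ : H → M) : Prop where
  map_one : ψ 1 = 1
  map_inv : ∀ h : H, ψ h⁻¹ = (ψ h)⁻¹
  map_mul : ∀ h k : H, natLE (ψ h * ψ k) (ψ (h * k))

/-- `M` has an `F`-inverse cover via `U`: there are an `F`-inverse monoid `F` and an
idempotent-separating surjective homomorphism `F → M` such that the kernel of the induced
homomorphism `F/σ → M/σ` belongs to `U`. -/
def HasFInverseCoverVia (M : Type u) [InverseMonoid M] (U : GroupVariety) : Prop :=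
  ∃ (F : Type u) (_ : InverseMonoid F) (φ : F →* M), IsFInverse F ∧ Function.Surjective φ ∧
    (∀ e f : F, IsIdempotentElem e → IsIdempotentElem f → φ e = φ f → e = f) ∧
    U.Mem (MaxGrp.map φ).ker

section Categories

variable {M : Type u} [InverseMonoid M]

/-! ### The Cayley graph of `M/σ` -/

/-- The vertices of the Cayley graph of `M/σ` with respect to `A ⊆ M`. -/
structure Cay (A : Set M) where
  vertex : MaxGrp M

instance (A : Set M) : Quiver (Cay A) where
  Hom i j := {a : A // i.vertex * toG (a : M) = j.vertex}

/-! ### The category of closed subgraphs -/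

/-- The objects of the category `X_cl`; `S` is the set of the labels of the ambient graph. -/
structure Xcl (S : Set M) where
  vertex : MaxGrp M

/-- The category `X_cl`: an arrow from `i` to `j` is the closure of a finite connected subgraph
such that it contains `i` and `j`, and the product is the join. -/
noncomputable instance [EUnitary M] (S : Set M) : Category.{u} (Xcl S) where
  Hom i j := {X : SubGr M // SubGr.IsClFC S X ∧ i.vertex ∈ X.verts ∧ j.vertex ∈ X.verts}
  id i := ⟨(SubGr.point i.vertex).cl S, SubGr.isClFC_point _, SubGr.mem_cl_point _,
    SubGr.mem_cl_point _⟩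
  comp X Y := ⟨(X.1 ⊔ Y.1).cl S, X.2.1.join Y.2.1 X.2.2.2 Y.2.2.1,
    (SubGr.le_join_left X.2.1.labelsIn Y.2.1.labelsIn).1 X.2.2.1,
    (SubGr.le_join_right X.2.1.labelsIn Y.2.1.labelsIn).1 Y.2.2.2⟩
  id_comp X := Subtype.ext (by
    change (_ ⊔ _ : SubGr M).cl S = _
    rw [sup_eq_right.mpr (X.2.1.cl_point_le X.2.2.1), X.2.1.closed])
  comp_id X := Subtype.ext (by
    change (_ ⊔ _ : SubGr M).cl S = _
    rw [sup_eq_left.mpr (X.2.1.cl_point_le X.2.2.2), X.2.1.closed])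
  assoc X Y Z := Subtype.ext
    (SubGr.join_assoc X.2.1 Y.2.1 Z.2.1 X.2.2.2 Y.2.2.1 Y.2.2.2 Z.2.2.1)

theorem join_sandwich [EUnitary M] {S : Set M} {X Y : SubGr M} (hX : SubGr.IsClFC S X)
    (hY : SubGr.IsClFC S Y) {k : MaxGrp M} (hkX : k ∈ X.verts) (hkY : k ∈ Y.verts) :
    ((X ⊔ Y).cl S ⊔ X).cl S = X ↔ Y ≤ X := by
  have hXY := hX.join hY hkX hkY
  constructor
  · intro h
    rw [← h]
    exact (SubGr.le_join_right hX.labelsIn hY.labelsIn).trans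
      (SubGr.le_join_left hXY.labelsIn hX.labelsIn)
  · intro h
    rw [sup_eq_left.mpr h, hX.closed, sup_idem, hX.closed]

noncomputable instance [EUnitary M] (S : Set M) : InverseCategory (Xcl S) where
  inv X := ⟨X.1, X.2.1, X.2.2.2, X.2.2.1⟩
  comp_inv_comp X := Subtype.ext ((join_sandwich X.2.1 X.2.1 X.2.2.1 X.2.2.1).mpr le_rfl)
  inv_comp_inv X := Subtype.ext ((join_sandwich X.2.1 X.2.1 X.2.2.1 X.2.2.1).mpr le_rfl)
  inv_unique X Y h h' := Subtype.ext (le_antisymm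
    ((join_sandwich X.2.1 Y.2.1 X.2.2.1 Y.2.2.2).mp (congrArg Subtype.val h))
    ((join_sandwich Y.2.1 X.2.1 Y.2.2.2 X.2.2.1).mp (congrArg Subtype.val h')))

/-- The graph morphism from the Cayley graph to `X_cl` that maps every edge to its closure. -/
noncomputable def epsXcl [EUnitary M] (A I : Set M) : Cay A ⥤q Xcl (A ∪ I) where
  obj i := ⟨i.vertex⟩
  map {i j} a := ⟨(SubGr.edge i.vertex (a.1 : M)).cl (A ∪ I), SubGr.isClFC_edge _ (Or.inl a.1.2),
    (SubGr.le_cl (by rintro _ rfl; exact Or.inl a.1.2)).1 (Or.inl rfl),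
    (SubGr.le_cl (by rintro _ rfl; exact Or.inl a.1.2)).1 (Or.inr a.2.symm)⟩

/-! ### The quotient `X_cl/G` -/

/-- The elements `(X, g)` of `X_cl/G`, where `G = M/σ`. -/
@[ext] structure XclQuot (S : Set M) where
  graph : SubGr M
  elt : MaxGrp M
  isClFC : SubGr.IsClFC S graph
  one_mem : 1 ∈ graph.verts
  elt_mem : elt ∈ graph.verts

namespace XclQuot

variable [EUnitary M] {S : Set M}

theorem mem_smul_graph (x y : XclQuot S) : x.elt ∈ (x.elt • y.graph).verts := by
  have := SubGr.mem_smul x.elt y.one_mem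
  rwa [mul_one] at this

/-- The product is `(X, g)(Y, h) = (X ∨ gY, gh)`, and the inverse of `(X, g)` is
`(g⁻¹X, g⁻¹)`. -/
noncomputable instance : InverseMonoid (XclQuot S) where
  mul x y :=
    { graph := (x.graph ⊔ x.elt • y.graph).cl S
      elt := x.elt * y.elt
      isClFC := x.isClFC.join (y.isClFC.smul _) x.elt_mem (x.mem_smul_graph y)
      one_mem := (SubGr.le_join_left x.isClFC.labelsIn (y.isClFC.smul _).labelsIn).1 x.one_mem
      elt_mem := (SubGr.le_join_right x.isClFC.labelsIn (y.isClFC.smul _).labelsIn).1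
        (SubGr.mem_smul _ y.elt_mem) }
  one :=
    { graph := (SubGr.point 1).cl S
      elt := 1
      isClFC := SubGr.isClFC_point 1
      one_mem := SubGr.mem_cl_point 1
      elt_mem := SubGr.mem_cl_point 1 }
  inv x :=
    { graph := x.elt⁻¹ • x.graph
      elt := x.elt⁻¹
      isClFC := x.isClFC.smul _
      one_mem := by
        have := SubGr.mem_smul x.elt⁻¹ x.elt_mem
        rwa [inv_mul_cancel] at this
      elt_mem := by
        have := SubGr.mem_smul x.elt⁻¹ x.one_mem
        rwa [mul_one] at this }
  mul_assoc x y z := by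
    refine XclQuot.ext ?_ (mul_assoc _ _ _)
    change ((x.graph ⊔ x.elt • y.graph).cl S ⊔ (x.elt * y.elt) • z.graph).cl S =
      (x.graph ⊔ x.elt • (y.graph ⊔ y.elt • z.graph).cl S).cl S
    rw [SubGr.smul_cl, SubGr.smul_sup, SubGr.smul_smul']
    refine SubGr.join_assoc x.isClFC (y.isClFC.smul _) (z.isClFC.smul _) x.elt_mem
      (x.mem_smul_graph y) (SubGr.mem_smul _ y.elt_mem) ?_
    have := SubGr.mem_smul (x.elt * y.elt) z.one_mem
    rwa [mul_one] at this
  one_mul x := by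
    refine XclQuot.ext ?_ (one_mul _)
    change ((SubGr.point 1).cl S ⊔ (1 : MaxGrp M) • x.graph).cl S = x.graph
    rw [SubGr.one_smul', sup_eq_right.mpr (x.isClFC.cl_point_le x.one_mem), x.isClFC.closed]
  mul_one x := by
    refine XclQuot.ext ?_ (mul_one _)
    change (x.graph ⊔ x.elt • (SubGr.point 1).cl S).cl S = x.graph
    have h : x.elt • (SubGr.point 1).cl S ≤ x.graph := by
      have h1 : SubGr.point 1 ≤ x.elt⁻¹ • x.graph := by
        apply Walk.point_le
        have := SubGr.mem_smul x.elt⁻¹ x.elt_mem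
        rwa [inv_mul_cancel] at this
      have h2 := SubGr.smul_mono x.elt (SubGr.cl_mono (S := S) h1)
      rwa [← SubGr.smul_cl, x.isClFC.closed, SubGr.smul_smul', mul_inv_cancel,
        SubGr.one_smul'] at h2
    rw [sup_eq_left.mpr h, x.isClFC.closed]
  mul_inv_mul x := by
    refine XclQuot.ext ?_ (by exact inv_mul_cancel_right _ _)
    change ((x.graph ⊔ x.elt • x.elt⁻¹ • x.graph).cl S ⊔ (x.elt * x.elt⁻¹) • x.graph).cl S
      = x.graph
    rw [SubGr.smul_smul', mul_inv_cancel, SubGr.one_smul', sup_idem, x.isClFC.closed, sup_idem,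
      x.isClFC.closed]
  inv_mul_inv x := by
    refine XclQuot.ext ?_ (by change x.elt⁻¹ * x.elt * x.elt⁻¹ = x.elt⁻¹; simp)
    change ((x.elt⁻¹ • x.graph ⊔ x.elt⁻¹ • x.graph).cl S ⊔
      (x.elt⁻¹ * x.elt) • x.elt⁻¹ • x.graph).cl S = x.elt⁻¹ • x.graph
    rw [inv_mul_cancel, SubGr.one_smul', sup_idem, (x.isClFC.smul _).closed, sup_idem,
      (x.isClFC.smul _).closed]
  inv_unique x y h h' := by
    have hg : x.elt * y.elt * x.elt = x.elt := congrArg XclQuot.elt h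
    have hg1 : x.elt * y.elt = 1 := mul_eq_right.mp hg
    have hg2 : y.elt = x.elt⁻¹ := (inv_eq_of_mul_eq_one_right hg1).symm
    have hX : ((x.graph ⊔ x.elt • y.graph).cl S ⊔ (x.elt * y.elt) • x.graph).cl S = x.graph :=
      congrArg XclQuot.graph h
    have hY : ((y.graph ⊔ y.elt • x.graph).cl S ⊔ (y.elt * x.elt) • y.graph).cl S = y.graph :=
      congrArg XclQuot.graph h'
    rw [hg1, SubGr.one_smul', join_sandwich x.isClFC (y.isClFC.smul _) x.elt_mem
      (x.mem_smul_graph y)] at hX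
    rw [hg2, inv_mul_cancel, SubGr.one_smul', ← hg2, join_sandwich y.isClFC (x.isClFC.smul _)
      y.elt_mem (y.mem_smul_graph x), hg2] at hY
    refine XclQuot.ext (le_antisymm ?_ hY) hg2
    have h3 := SubGr.smul_mono x.elt⁻¹ hX
    rwa [SubGr.smul_smul', inv_mul_cancel, SubGr.one_smul'] at h3

/-- The generator of `X_cl/G` that corresponds to `a ∈ A`. -/
noncomputable def gen {A I : Set M} (a : A) : XclQuot (A ∪ I) where
  graph := (SubGr.edge 1 (a : M)).cl (A ∪ I)
  elt := toG (a : M)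
  isClFC := SubGr.isClFC_edge 1 (Or.inl a.2)
  one_mem := (SubGr.le_cl (by rintro _ rfl; exact Or.inl a.2)).1 (Or.inl rfl)
  elt_mem := (SubGr.le_cl (by rintro _ rfl; exact Or.inl a.2)).1 (Or.inr (one_mul _).symm)

end XclQuot

/-! ### The free `gU`-category on the Cayley graph -/

/-- The value `[p]_U` of a path in the relatively free group on the edges. -/
def Walk.val {A : Set M} (U : GroupVariety) {i j : MaxGrp M} (p : Walk A i j) :
    U.RelFree (MaxGrp M × A) := QuotientGroup.mk p.word

theorem Walk.val_append {A : Set M} (U : GroupVariety) {i j k : MaxGrp M} (p : Walk A i j)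
    (q : Walk A j k) : (p.append q).val U = p.val U * q.val U := by
  rw [Walk.val, Walk.word_append, QuotientGroup.mk_mul]
  rfl

theorem Walk.val_reverse {A : Set M} (U : GroupVariety) {i j : MaxGrp M} (p : Walk A i j) :
    p.reverse.val U = (p.val U)⁻¹ := by
  rw [Walk.val, Walk.word_reverse, QuotientGroup.mk_inv]
  rfl

/-- The objects of the free `gU`-category on the Cayley graph of `M/σ`. -/
structure CatU (U : GroupVariety) (A : Set M) where
  vertex : MaxGrp M

/-- The arrows from `i` to `j` are the values `[p]_U` of the paths `p` from `i` to `j`. -/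
instance (U : GroupVariety) (A : Set M) : Category.{u} (CatU U A) where
  Hom i j := {x : U.RelFree (MaxGrp M × A) // ∃ p : Walk A i.vertex j.vertex, p.val U = x}
  id i := ⟨1, Walk.nil, rfl⟩
  comp x y := ⟨x.1 * y.1, by
    obtain ⟨p, hp⟩ := x.2
    obtain ⟨q, hq⟩ := y.2
    exact ⟨p.append q, by rw [Walk.val_append, hp, hq]⟩⟩
  id_comp x := Subtype.ext (one_mul _)
  comp_id x := Subtype.ext (mul_one _)
  assoc x y z := Subtype.ext (mul_assoc _ _ _)

instance (U : GroupVariety) (A : Set M) : InverseCategory (CatU U A) where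
  inv x := ⟨x.1⁻¹, by
    obtain ⟨p, hp⟩ := x.2
    exact ⟨p.reverse, by rw [Walk.val_reverse, hp]⟩⟩
  comp_inv_comp x := Subtype.ext (by change x.1 * x.1⁻¹ * x.1 = x.1; simp)
  inv_comp_inv x := Subtype.ext (by change x.1⁻¹ * x.1 * x.1⁻¹ = x.1⁻¹; simp)
  inv_unique x y h _ := Subtype.ext (by
    have h1 : x.1 * y.1 * x.1 = x.1 := congrArg Subtype.val h
    exact (inv_eq_of_mul_eq_one_right (mul_eq_right.mp h1)).symm)

/-- The canonical graph morphism from the Cayley graph to the free `gU`-category. -/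
def epsCatU (U : GroupVariety) (A : Set M) : Cay A ⥤q CatU U A where
  obj i := ⟨i.vertex⟩
  map a := ⟨(Walk.nil.fwd a.1 a.2 : Walk A _ _).val U, _, rfl⟩

/-! ### The group `G^U` -/

/-- The action of `M/σ` on the relatively free group on the edges of the Cayley graph. -/
def actU (U : GroupVariety) (A : Set M) : MaxGrp M →* MulAut (U.RelFree (MaxGrp M × A)) where
  toFun g := MonoidHom.toMulEquiv (U.relMap fun e : MaxGrp M × A => (g * e.1, e.2))
    (U.relMap fun e : MaxGrp M × A => (g⁻¹ * e.1, e.2))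
    (by rw [U.relMap_comp]; simpa [Function.comp_def] using U.relMap_id)
    (by rw [U.relMap_comp]; simpa [Function.comp_def] using U.relMap_id)
  map_one' := by
    ext x
    change U.relMap _ x = x
    simpa using DFunLike.congr_fun (U.relMap_id (X := MaxGrp M × A)) x
  map_mul' g h := by
    ext x
    change U.relMap _ x = U.relMap _ (U.relMap _ x)
    rw [← MonoidHom.comp_apply, U.relMap_comp]
    simp [Function.comp_def, mul_assoc]

theorem actU_val (U : GroupVariety) {A : Set M} (g : MaxGrp M) {i j v w : MaxGrp M}
    (p : Walk A i j) (hv : g * i = v) (hw : g * j = w) :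
    ∃ q : Walk A v w, q.val U = actU U A g (p.val U) := by
  subst hv hw
  refine ⟨p.act g, ?_⟩
  rw [Walk.val, Walk.word_act]
  rfl

/-- The group `G^U` for `G = M/σ`: the subgroup of the semidirect product of the relatively free
group on the edges of the Cayley graph by `G` that consists of the pairs `([p]_U, g)` where `p` is
a path from `1` to `g`. -/
def GU (U : GroupVariety) (A : Set M) :
    Subgroup (U.RelFree (MaxGrp M × A) ⋊[actU U A] MaxGrp M) where
  carrier := {x | ∃ p : Walk A 1 x.right, p.val U = x.left}
  one_mem' := ⟨Walk.nil, rfl⟩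
  mul_mem' := by
    rintro x y ⟨p, hp⟩ ⟨q, hq⟩
    obtain ⟨q', hq'⟩ := actU_val U x.right q (mul_one _) rfl
    exact ⟨p.append q', by rw [Walk.val_append, hp, hq', hq]; rfl⟩
  inv_mem' := by
    rintro x ⟨p, hp⟩
    obtain ⟨q, hq⟩ := actU_val U x.right⁻¹ p.reverse (inv_mul_cancel _) (mul_one _)
    exact ⟨q, by rw [hq, Walk.val_reverse, hp]; rfl⟩

/-- The generator `(e_a, aσ)` of `G^U` that corresponds to `a ∈ A`. -/
def GU.gen (U : GroupVariety) {A : Set M} (a : A) : GU U A :=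
  ⟨⟨QuotientGroup.mk (FreeGroup.of (1, a)), toG (a : M)⟩,
    Walk.nil.fwd a (one_mul _), by rw [Walk.val, Walk.word, Walk.word, one_mul]⟩

/-! ### The descending chains of subgraphs -/

/-- The union of the subgraphs assigned by `P` to the members of a sequence of consecutive
arrows; the one-vertex subgraph at the initial vertex takes care of the empty sequence. -/
def unionAlong {U : GroupVariety} {A : Set M} (P : ∀ {i j : CatU U A}, (i ⟶ j) → SubGr M)
    {i : CatU U A} : {j : CatU U A} → Quiver.Path i j → SubGr M
  | _, .nil => SubGr.point i.vertex
  | _, .cons q x => unionAlong P q ⊔ P x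

/-- `C_0(x)`: the intersection of the closures of the subgraphs spanned by the paths
representing `x`. -/
noncomputable def chainC0 {U : GroupVariety} {A : Set M} (I : Set M) {i j : CatU U A}
    (x : i ⟶ j) : SubGr M :=
  sInf {Y | ∃ p : Walk A i.vertex j.vertex, p.val U = x.1 ∧ Y = p.span.cl (A ∪ I)}

/-- `C_{n+1}(x)` in terms of `P = P_n`: the intersection of the joins
`P_n(x_1) ∨ ⋯ ∨ P_n(x_k)` over all decompositions `x = x_1 ⋯ x_k` into consecutive arrows. -/
noncomputable def chainCStep {U : GroupVariety} {A : Set M} (I : Set M)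
    (P : ∀ {i j : CatU U A}, (i ⟶ j) → SubGr M) {i j : CatU U A} (x : i ⟶ j) : SubGr M :=
  sInf {Y | ∃ q : Quiver.Path i j, composePath q = x ∧ Y = (unionAlong P q).cl (A ∪ I)}

/-- `P_n(x)`: the component of `C_n(x)` containing the initial vertex of `x`. -/
noncomputable def chainP {U : GroupVariety} {A : Set M} (I : Set M) :
    ℕ → ∀ {i j : CatU U A}, (i ⟶ j) → SubGr M
  | 0, i, _, x => (chainC0 I x).component i.vertex
  | n + 1, i, _, x => (chainCStep I (fun {_ _} y => chainP I n y) x).component i.vertex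

end Categories

end FInvCov

open FInvCov

namespace FInvCov

/-! ### The natural partial order -/

section NaturalOrder

variable {M : Type u} [InverseMonoid M]

/-! Covers and dual premorphisms are linked through greatest elements of `σ`-classes. In an
`F`-inverse monoid `F` these elements form a dual premorphism `F/σ → F`. If `F` covers `M` via `U`,
then `F/σ` is an extension of `G` by a group in `U`, so `G^U` maps to it with prescribed values on
the generators (`GU.exists_hom`), and `G^U → F/σ → F → M` is a dual premorphism. It is canonical
because its value at the generator of `a` lies above `a`, which is maximal. Conversely, a canonical
dual premorphism `ψ : G^U → M` yields the cover of all pairs `(m, h)` with `m ≤ ψ h`, where `(ψ h,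
h)` is the top of its `σ`-class and the kernel over `G` embeds in a relatively free group of `U`.

The target `M` may be replaced by `X_cl/G`. Inclusion of closures of finite connected subgraphs is
the reverse of the order of their labels (`SubGr.cl_le_cl_iff`), so a closed subgraph with two roots
carries exactly the information of one element of `M`. This gives a canonical isomorphism
(`exists_mulEquiv_xclQuot`). A dual premorphism on `G^U` then spreads to the free `gU`-category by
translating each arrow to start at `1` and translating its value back.

On underlying graphs, a canonical dual premorphism to `X_cl` is a subadditive assignment `Q` with
prescribed values on edges (`IsSubadditive`). Subadditivity places `Q x` inside the closure of every
path representing `x` and, inductively, inside every join occurring in the chains, so `Q x ≤ P_n(x)`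
and `P_n(x)` contains the terminal vertex of `x`.

Conversely, suppose that all `P_n(x)` contain these vertices. Then they are closed, connected and
descending. Finiteness above leaves only finitely many closed subgraphs through a given vertex
inside the closure of a finite connected one, so each chain stabilises. The limit is subadditive,
since after both chains have stabilised the decomposition `x · y` bounds the next term for `xy`. Its
value at an edge labelled by `a` is correct because maximality of `a` excludes smaller closed
subgraphs joining the ends. The construction commutes with translation by `G`, so its symmetrised
limit descends to `X_cl/G`, which closes the circle 3 → 4 → 5 → 3. -/

theorem natLE_iff {a b : M} : natLE a b ↔ a = a * a⁻¹ * b := by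
  constructor
  · rintro ⟨e, he, h⟩
    have h1 : e * (a * a⁻¹) = a * a⁻¹ := by
      conv_lhs => rw [h]
      conv_rhs => rw [h]
      simp only [← mul_assoc]
      rw [show e * e = e from he]
    rw [← h1, idem_comm he (idem_mul_inv a), mul_assoc, ← h, InverseMonoid.mul_inv_mul]
  · intro h
    exact ⟨_, idem_mul_inv a, h⟩

/-- Conjugation moves an idempotent from the right to the left, so the order does not depend on the
side. -/
theorem natLE_mul_idem {e : M} (he : IsIdempotentElem e) (a : M) : natLE (a * e) a :=
  ⟨a * e * a⁻¹, idem_conj a he, (conj_mul a he).symm⟩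

theorem natLE_self (a : M) : natLE a a := ⟨1, one_mul 1, (one_mul a).symm⟩

theorem natLE_trans {a b c : M} (h : natLE a b) (h' : natLE b c) : natLE a c := by
  obtain ⟨e, he, rfl⟩ := h
  obtain ⟨f, hf, rfl⟩ := h'
  exact ⟨e * f, idem_mul_idem he hf, by rw [mul_assoc]⟩

theorem natLE_inv {a b : M} (h : natLE a b) : natLE a⁻¹ b⁻¹ := by
  obtain ⟨e, he, rfl⟩ := h
  rw [mul_inv_rev', inv_idem he]
  exact natLE_mul_idem he _

theorem natLE_mul {a b c d : M} (h : natLE a b) (h' : natLE c d) :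
    natLE (a * c) (b * d) := by
  obtain ⟨e, he, rfl⟩ := h
  obtain ⟨f, hf, rfl⟩ := h'
  refine ⟨e * (b * f * b⁻¹), idem_mul_idem he (idem_conj b hf), ?_⟩
  have := conj_mul b hf
  calc e * b * (f * d) = e * (b * f) * d := by simp only [mul_assoc]
    _ = e * (b * f * b⁻¹ * b) * d := by rw [this]
    _ = _ := by simp only [mul_assoc]

theorem natLE_map {N : Type u} [InverseMonoid N] (φ : M →* N) {a b : M} (h : natLE a b) :
    natLE (φ a) (φ b) := by
  obtain ⟨e, he, rfl⟩ := h
  exact ⟨φ e, by change φ e * φ e = φ e; rw [← map_mul, he], map_mul _ _ _⟩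

theorem map_inv' {N : Type u} [InverseMonoid N] (φ : M →* N) (a : M) : φ a⁻¹ = (φ a)⁻¹ := by
  apply InverseMonoid.inv_unique
  · rw [← map_mul, ← map_mul, InverseMonoid.mul_inv_mul]
  · rw [← map_mul, ← map_mul, InverseMonoid.inv_mul_inv]

theorem natLE.toG_eq {a b : M} (h : natLE a b) : toG a = toG b := by
  obtain ⟨e, he, rfl⟩ := h
  rw [map_mul, toG_idem he, one_mul]

/-- The identity is maximal; hence the greatest element of the trivial `σ`-class is `1`. -/
theorem eq_one_of_natLE {a : M} (h : natLE 1 a) : a = 1 := by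
  obtain ⟨e, he, h⟩ := h
  have : e = 1 := by
    calc e = e * (e * a) := by rw [← h, mul_one]
      _ = e * a := by rw [← mul_assoc, he]
      _ = 1 := h.symm
  rw [this, one_mul] at h
  exact h.symm

theorem natLE_asymm {a b : M} (h : natLE a b) (h' : natLE b a) : a = b := by
  obtain ⟨e, he, rfl⟩ := h
  obtain ⟨f, hf, h⟩ := h'
  calc e * b = e * (f * (e * b)) := by rw [← h]
    _ = f * (e * b) := by
      rw [← mul_assoc, idem_comm he hf, mul_assoc, ← mul_assoc e e, he]
    _ = b := h.symm

/-- The elements of an inverse monoid generated by `S` are products of members of `S` and of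
their inverses. -/
theorem Generates.induction {S : Set M} (hS : Generates S) {P : M → Prop} (one : P 1)
    (gen : ∀ s ∈ S, P s) (inv : ∀ m, P m → P m⁻¹) (mul : ∀ m n, P m → P n → P (m * n))
    (m : M) : P m := by
  have hm : m ∈ Submonoid.closure (S ∪ (fun a => a⁻¹) '' S) := by
    rw [show Submonoid.closure (S ∪ (fun a => a⁻¹) '' S) = ⊤ from hS]
    trivial
  induction hm using Submonoid.closure_induction with
  | mem x hx =>
    rcases hx with hx | ⟨y, hy, rfl⟩
    exacts [gen x hx, inv y (gen y hy)]
  | one => exact one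
  | mul x y _ _ hx hy => exact mul x y hx hy

end NaturalOrder

theorem IsDualPremorphism.mulEquiv_comp {H M N : Type u} [InverseMonoid H] [InverseMonoid M]
    [InverseMonoid N] {ψ : H → M} (hψ : IsDualPremorphism ψ) (e : M ≃* N) :
    IsDualPremorphism fun h => e (ψ h) where
  map_one := by rw [hψ.map_one, _root_.map_one]
  map_inv h := by rw [hψ.map_inv]; exact map_inv' e.toMonoidHom _
  map_mul h k := by
    rw [← _root_.map_mul]
    exact natLE_map e.toMonoidHom (hψ.map_mul h k)

/-! ### Relatively free groups -/

namespace GroupVariety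

variable (U : GroupVariety)

/-- A homomorphism from the free group on the variables lifts through the quotient map by choosing
preimages of the images of the variables. The lifted value of a law is one of the generators of the
verbal subgroup. -/
theorem mem_relFree (X : Type u) : U.Mem (U.RelFree X) := by
  intro w hw f
  let f' : FreeGroup ℕ →* FreeGroup X :=
    FreeGroup.lift fun n => (QuotientGroup.mk_surjective (f (FreeGroup.of n))).choose
  have h : f = (QuotientGroup.mk' (U.verbal X)).comp f' := by
    ext n
    change _ = ((FreeGroup.lift _ (FreeGroup.of n) : FreeGroup X) : FreeGroup X ⧸ U.verbal X)
    rw [FreeGroup.lift_apply_of]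
    exact (QuotientGroup.mk_surjective (f (FreeGroup.of n))).choose_spec.symm
  rw [h]
  exact (QuotientGroup.eq_one_iff _).mpr (Subgroup.subset_normalClosure ⟨w, hw, f', rfl⟩)

theorem Mem.of_injective {U : GroupVariety} {H K : Type u} [Group H] [Group K] (hK : U.Mem K)
    (f : H →* K) (hf : Function.Injective f) : U.Mem H := by
  intro w hw k
  apply hf
  rw [map_one]
  exact hK w hw (f.comp k)

/-- The universal property of relatively free groups. -/
def relLift {U : GroupVariety} {X H : Type u} [Group H] (hH : U.Mem H) (f : X → H) :
    U.RelFree X →* H :=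
  QuotientGroup.lift _ (FreeGroup.lift f) (by
    intro x hx
    have : U.verbal X ≤ (FreeGroup.lift f).ker := by
      refine Subgroup.normalClosure_le_normal ?_
      rintro x ⟨w, hw, k, rfl⟩
      exact hH w hw ((FreeGroup.lift f).comp k)
    exact this hx)

theorem relLift_of {U : GroupVariety} {X H : Type u} [Group H] (hH : U.Mem H) (f : X → H)
    (x : X) : relLift hH f (QuotientGroup.mk (FreeGroup.of x)) = f x := by
  change FreeGroup.lift f (FreeGroup.of x) = _
  rw [FreeGroup.lift_apply_of]

end GroupVariety

/-! ### The group `G^U` -/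

section GU

variable {M : Type u} [InverseMonoid M] {U : GroupVariety} {A : Set M}

/-- The projection of `G^U` to `G`. -/
def GU.toMaxGrp : GU U A →* MaxGrp M := SemidirectProduct.rightHom.comp (GU U A).subtype

theorem GU.toMaxGrp_gen (a : A) : GU.toMaxGrp (GU.gen U a) = toG (a : M) := rfl

theorem actU_of (g v : MaxGrp M) (a : A) :
    actU U A g (QuotientGroup.mk (FreeGroup.of (v, a))) =
      QuotientGroup.mk (FreeGroup.of (g * v, a)) := rfl

/-- A path is read edge by edge. The edge at `j` labelled by `a` is the translate by `j` of the edge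
`e_a`, and right multiplication by the generator in the semidirect product performs exactly this
translation. -/
theorem GU.closure_gen : Subgroup.closure (Set.range (GU.gen U (A := A))) = ⊤ := by
  rw [eq_top_iff]
  rintro ⟨⟨x, g⟩, p, hp⟩ -
  change Walk A 1 g at p
  change p.val U = x at hp
  subst hp
  induction p with
  | nil => exact Subgroup.one_mem _
  | @fwd j k p a h ih =>
    subst h
    refine (Subgroup.mul_mem _ ih (Subgroup.subset_closure ⟨a, rfl⟩) : _)
      |> (Eq.mp (congrArg (· ∈ Subgroup.closure _) ?_))
    apply Subtype.ext
    refine SemidirectProduct.ext ?_ rfl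
    change p.val U * actU U A j (QuotientGroup.mk (FreeGroup.of (1, a))) = _
    rw [actU_of, mul_one]
    rfl
  | @bwd j k p a h ih =>
    subst h
    refine (Subgroup.mul_mem _ ih (Subgroup.inv_mem _ (Subgroup.subset_closure ⟨a, rfl⟩)) : _)
      |> (Eq.mp (congrArg (· ∈ Subgroup.closure _) ?_))
    apply Subtype.ext
    refine SemidirectProduct.ext ?_ (mul_inv_cancel_right _ _)
    -- The inverse generator carries a translation by the inverse of `toG a`, and the path so far
    -- ends at `k * toG a`. Together they translate by `k`, the initial vertex of the edge traversed
    -- backwards.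
    change p.val U * actU U A (k * toG (a : M)) (actU U A (toG (a : M))⁻¹
      (QuotientGroup.mk (FreeGroup.of (1, a)))⁻¹) = _
    rw [map_inv, map_inv, actU_of, actU_of, mul_one, mul_inv_cancel_right]
    rfl

theorem GU.hom_ext {K : Type u} [Group K] {f g : GU U A →* K}
    (h : ∀ a, f (GU.gen U a) = g (GU.gen U a)) : f = g := by
  refine MonoidHom.eq_of_eqOn_dense GU.closure_gen ?_
  rintro _ ⟨a, rfl⟩
  exact h a

/-- Comparable elements are `σ`-related, so a dual premorphism becomes a homomorphism of groups
modulo `σ`. On the generators it agrees with the projection to `G`. -/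
theorem IsDualPremorphism.toG_eq {ψ : GU U A → M} (hψ : IsDualPremorphism ψ)
    (hgen : ∀ a : A, ψ (GU.gen U a) = a) (h : GU U A) : toG (ψ h) = h.1.right := by
  let f : GU U A →* MaxGrp M :=
    { toFun := fun h => toG (ψ h)
      map_one' := (congrArg toG hψ.map_one).trans (_root_.map_one toG)
      map_mul' := fun h k => by
        rw [← _root_.map_mul]
        exact (hψ.map_mul h k).toG_eq.symm }
  exact DFunLike.congr_fun (GU.hom_ext (f := f) (g := GU.toMaxGrp) fun a => by
    change toG (ψ (GU.gen U a)) = _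
    rw [hgen, GU.toMaxGrp_gen]) h

end GU

/-! ### Covers from dual premorphisms of groups -/

section Cover

variable {M : Type u} [InverseMonoid M] {H : Type u} [Group H]

/-- The cover determined by a dual premorphism `ψ : H → M` from a group: the pairs `(m, h)` with
`m ≤ ψ h`. -/
def Cover (ψ : H → M) : Type u := {x : M × H // natLE x.1 (ψ x.2)}

namespace Cover

variable {ψ : H → M}

/-- The componentwise operations on the cover. -/
abbrev inverseMonoid (hψ : IsDualPremorphism ψ) : InverseMonoid (Cover ψ) where
  mul x y := ⟨(x.1.1 * y.1.1, x.1.2 * y.1.2),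
    natLE_trans (natLE_mul x.2 y.2) (hψ.map_mul _ _)⟩
  one := ⟨(1, 1), by rw [show ψ 1 = 1 from hψ.map_one]; exact natLE_self _⟩
  inv x := ⟨(x.1.1⁻¹, x.1.2⁻¹), by
    rw [show ψ x.1.2⁻¹ = (ψ x.1.2)⁻¹ from hψ.map_inv _]; exact natLE_inv x.2⟩
  mul_assoc x y z := Subtype.ext (Prod.ext (mul_assoc _ _ _) (mul_assoc _ _ _))
  one_mul x := Subtype.ext (Prod.ext (one_mul _) (one_mul _))
  mul_one x := Subtype.ext (Prod.ext (mul_one _) (mul_one _))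
  mul_inv_mul x := Subtype.ext (Prod.ext (InverseMonoid.mul_inv_mul _)
    (InverseMonoid.mul_inv_mul x.1.2))
  inv_mul_inv x := Subtype.ext (Prod.ext (InverseMonoid.inv_mul_inv _)
    (InverseMonoid.inv_mul_inv x.1.2))
  inv_unique x y h h' := Subtype.ext (Prod.ext
    (InverseMonoid.inv_unique _ _ (congrArg (fun z => z.1.1) h) (congrArg (fun z => z.1.1) h'))
    (InverseMonoid.inv_unique x.1.2 y.1.2 (congrArg (fun z => z.1.2) h)
      (congrArg (fun z => z.1.2) h')))

/-- The projection of the cover to `M`. -/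
def fst (hψ : IsDualPremorphism ψ) : letI := inverseMonoid hψ; Cover ψ →* M :=
  letI := inverseMonoid hψ
  { toFun := fun x => x.1.1
    map_one' := rfl
    map_mul' := fun _ _ => rfl }

/-- The projection of the cover to `H`. -/
def snd (hψ : IsDualPremorphism ψ) : letI := inverseMonoid hψ; Cover ψ →* H :=
  letI := inverseMonoid hψ
  { toFun := fun x => x.1.2
    map_one' := rfl
    map_mul' := fun _ _ => rfl }

theorem snd_idem (hψ : IsDualPremorphism ψ) {e : Cover ψ} :
    letI := inverseMonoid hψ; IsIdempotentElem e → e.1.2 = 1 := by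
  intro h
  have h1 : e.1.2 * e.1.2 = e.1.2 := congrArg (fun z => z.1.2) h
  exact mul_eq_left.mp h1

/-- The idempotent `(m m⁻¹, 1)` belongs to the cover because `ψ 1 = 1`, and it cuts `(ψ h, h)` down
to `(m, h)`. -/
theorem natLE_max (hψ : IsDualPremorphism ψ) (x : Cover ψ) :
    letI := inverseMonoid hψ; natLE x ⟨(ψ x.1.2, x.1.2), natLE_self _⟩ := by
  let := inverseMonoid hψ
  obtain ⟨⟨m, h⟩, hx⟩ := x
  refine ⟨⟨(m * m⁻¹, 1), ?_⟩, Subtype.ext (Prod.ext (idem_mul_inv m) (one_mul _)),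
    Subtype.ext (Prod.ext (natLE_iff.mp hx) (one_mul _).symm)⟩
  change natLE _ (ψ 1)
  rw [show ψ 1 = 1 from hψ.map_one]
  exact ⟨_, idem_mul_inv m, (mul_one _).symm⟩

/-- Multiplying by an idempotent leaves the `H`-component unchanged, up to a factor that cancels in
a group. Conversely, two pairs with the same `h` lie below `(ψ h, h)`. -/
theorem toG_eq_iff (hψ : IsDualPremorphism ψ) {x y : Cover ψ} :
    letI := inverseMonoid hψ; toG x = toG y ↔ x.1.2 = y.1.2 := by
  let := inverseMonoid hψ
  constructor
  · intro h
    obtain ⟨e, he, h⟩ := toG_eq.mp h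
    exact mul_left_cancel (congrArg (fun z => z.1.2) h : e.1.2 * x.1.2 = e.1.2 * y.1.2)
  · intro h
    rw [(natLE_max hψ x).toG_eq, (natLE_max hψ y).toG_eq]
    simp only [h]

theorem isFInverse (hψ : IsDualPremorphism ψ) :
    letI := inverseMonoid hψ; IsFInverse (Cover ψ) := by
  let := inverseMonoid hψ
  intro g
  obtain ⟨x, rfl⟩ := toG_surjective g
  refine ⟨⟨(ψ x.1.2, x.1.2), natLE_self _⟩, (natLE_max hψ x).toG_eq.symm, fun y hy => ?_⟩
  have := natLE_max hψ y
  simp only [(toG_eq_iff hψ).mp hy] at this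
  exact this

end Cover

end Cover

theorem hasFInverseCoverVia_of_dualPremorphism {M : Type u} [InverseMonoid M] {A I : Set M}
    (hI : ∀ e ∈ I, IsIdempotentElem e) (hAI : Generates (A ∪ I)) {U : GroupVariety}
    {ψ : GU U A → M} (hψ : IsDualPremorphism ψ) (hgen : ∀ a : A, ψ (GU.gen U a) = a) :
    HasFInverseCoverVia M U := by
  let := Cover.inverseMonoid hψ
  refine ⟨Cover ψ, Cover.inverseMonoid hψ, Cover.fst hψ, Cover.isFInverse hψ, ?_, ?_, ?_⟩
  -- The elements below some value of `ψ` are closed under products and inverses. They include `A`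
  -- because `ψ` is canonical, and `I` because `ψ 1 = 1`.
  · have key : ∀ m : M, ∃ h, natLE m (ψ h) := by
      refine hAI.induction ?_ ?_ ?_ ?_
      · exact ⟨1, by rw [hψ.map_one]; exact natLE_self _⟩
      · rintro s (hs | hs)
        · exact ⟨GU.gen U ⟨s, hs⟩, by rw [hgen]; exact natLE_self _⟩
        · exact ⟨1, by rw [hψ.map_one]; exact ⟨s, hI s hs, (mul_one s).symm⟩⟩
      · rintro m ⟨h, hh⟩
        exact ⟨h⁻¹, by rw [hψ.map_inv]; exact natLE_inv hh⟩
      · rintro m n ⟨h, hh⟩ ⟨k, hk⟩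
        exact ⟨h * k, natLE_trans (natLE_mul hh hk) (hψ.map_mul h k)⟩
    intro m
    obtain ⟨h, hh⟩ := key m
    exact ⟨⟨(m, h), hh⟩, rfl⟩
  · intro e f he hf h
    exact Subtype.ext (Prod.ext h ((Cover.snd_idem hψ he).trans (Cover.snd_idem hψ hf).symm))
  · let sndG : MaxGrp (Cover ψ) →* GU U A := (sigma (Cover ψ)).lift (Cover.snd hψ)
      (fun a b h => (Cover.toG_eq_iff hψ).mp ((Con.eq _).mpr h))
    have hright : ∀ x : (MaxGrp.map (Cover.fst hψ)).ker, (sndG x.1).1.right = 1 := by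
      rintro ⟨x, hx⟩
      obtain ⟨y, rfl⟩ := toG_surjective x
      have h1 : toG y.1.1 = 1 := hx
      change y.1.2.1.right = 1
      rw [← hψ.toG_eq hgen, ← y.2.toG_eq, h1]
    -- Over the trivial element of `G` the action in the semidirect product is trivial. The left
    -- coordinate is therefore multiplicative there, and it embeds the kernel in a relatively free
    -- group.
    let f : (MaxGrp.map (Cover.fst hψ)).ker →* U.RelFree (MaxGrp M × A) :=
      { toFun := fun x => (sndG x.1).1.left
        map_one' := by
          rw [Subgroup.coe_one, map_one]; rfl
        map_mul' := fun x y => by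
          rw [Subgroup.coe_mul, map_mul]
          change (sndG x.1).1.left * actU U A (sndG x.1).1.right _ = _
          rw [hright, map_one]
          rfl }
    refine (U.mem_relFree _).of_injective f ?_
    rw [injective_iff_map_eq_one]
    rintro x hx
    have h2 : sndG x.1 = 1 :=
      Subtype.ext (SemidirectProduct.ext hx (hright x))
    have hinj : Function.Injective sndG := by
      intro y z h
      obtain ⟨y, rfl⟩ := toG_surjective y
      obtain ⟨z, rfl⟩ := toG_surjective z
      exact (Cover.toG_eq_iff hψ).mpr h
    exact Subtype.ext (hinj (h2.trans (map_one sndG).symm))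

/-! ### Dual premorphisms from covers -/

section GUHom

variable {M : Type u} [InverseMonoid M] {K : Type u} [Group K]

/-- The value of a path with respect to an assignment of group elements to the labels. -/
def Walk.eval {A : Set M} (k : A → K) {i : MaxGrp M} : {j : MaxGrp M} → Walk A i j → K
  | _, .nil => 1
  | _, .fwd p a _ => p.eval k * k a
  | _, .bwd p a _ => p.eval k * (k a)⁻¹

theorem Walk.eval_append {A : Set M} (k : A → K) {i j l : MaxGrp M} (p : Walk A i j)
    (q : Walk A j l) : (p.append q).eval k = p.eval k * q.eval k := by
  induction q with
  | nil => simp [append, eval]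
  | fwd q m h ih => simp [append, eval, ih, mul_assoc]
  | bwd q m h ih => simp [append, eval, ih, mul_assoc]

theorem Walk.eval_act {A : Set M} (k : A → K) (g : MaxGrp M) {i j : MaxGrp M}
    (p : Walk A i j) : (p.act g).eval k = p.eval k := by
  induction p with
  | nil => rfl
  | fwd p m h ih => simp [act, eval, ih]
  | bwd p m h ih => simp [act, eval, ih]

/-- An extension of `M/σ` by a group in `U` receives a homomorphism from `G^U`. -/
theorem GU.exists_hom {U : GroupVariety} {A : Set M} (π : K →* MaxGrp M)
    (hπ : Function.Surjective π) (hker : U.Mem π.ker) (k : A → K)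
    (hk : ∀ a, π (k a) = toG (a : M)) : ∃ f : GU U A →* K, ∀ a, f (GU.gen U a) = k a := by
  choose t ht using hπ
  -- The section `t` of `π` turns each edge into an element of the kernel, in the manner of Schreier
  -- generators. Along a path the inner factors `t` cancel.
  let θ : U.RelFree (MaxGrp M × A) →* π.ker := GroupVariety.relLift hker fun e =>
    ⟨t e.1 * k e.2 * (t (e.1 * toG (e.2 : M)))⁻¹, by
      rw [MonoidHom.mem_ker, map_mul, map_mul, map_inv, ht, ht, hk, mul_inv_cancel]⟩
  have hof : ∀ e : MaxGrp M × A, (θ (QuotientGroup.mk (FreeGroup.of e)) : K) =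
      t e.1 * k e.2 * (t (e.1 * toG (e.2 : M)))⁻¹ := fun e => by
    rw [GroupVariety.relLift_of]
  have hθ : ∀ {i j : MaxGrp M} (p : Walk A i j),
      (θ (p.val U) : K) = t i * p.eval k * (t j)⁻¹ := by
    intro i j p
    induction p with
    | nil =>
      change (θ 1 : K) = _
      simp [Walk.eval]
    | @fwd j l p a h ih =>
      subst h
      change (θ (p.val U * QuotientGroup.mk (FreeGroup.of (j, a))) : K) = _
      rw [map_mul, Subgroup.coe_mul, ih, hof]
      simp [Walk.eval, mul_assoc]
    | @bwd j l p a h ih =>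
      subst h
      change (θ (p.val U * (QuotientGroup.mk (FreeGroup.of (l, a)))⁻¹) : K) = _
      rw [map_mul, map_inv, Subgroup.coe_mul, Subgroup.coe_inv, ih, hof]
      simp [Walk.eval, mul_assoc]
  have hval : ∀ (x : GU U A) (p : Walk A 1 x.1.right), p.val U = x.1.left →
      (t 1)⁻¹ * (θ x.1.left : K) * t x.1.right = p.eval k := by
    intro x p hp
    rw [← hp, hθ]
    simp [mul_assoc]
  -- The outer factors remove `t` at the two ends, leaving the product of the values of `k` along
  -- any representing path. This is multiplicative under concatenation, and the formula through `θ`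
  -- shows that it does not depend on the path.
  refine ⟨MonoidHom.mk' (fun x => (t 1)⁻¹ * (θ x.1.left : K) * t x.1.right) ?_, ?_⟩
  · intro x y
    obtain ⟨p, hp⟩ := x.2
    obtain ⟨q, hq⟩ := y.2
    -- The translate of `q` starts at `x.1.right * 1`. It is generalised together with its relevant
    -- properties so that its endpoint can be rewritten.
    have hq' : ∃ q' : Walk A x.1.right (x.1.right * y.1.right),
        q'.val U = actU U A x.1.right y.1.left ∧ q'.eval k = q.eval k := by
      have h1 : ((q.act x.1.right).val U = actU U A x.1.right y.1.left) := by
        rw [← hq, Walk.val, Walk.word_act]; rfl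
      have h2 := Walk.eval_act k x.1.right q
      generalize q.act x.1.right = r at h1 h2
      revert r
      rw [mul_one]
      exact fun r h1 h2 => ⟨r, h1, h2⟩
    obtain ⟨q', h1, h2⟩ := hq'
    rw [hval x p hp, hval y q hq, hval (x * y) (p.append q') (by
      rw [Walk.val_append, hp, h1]; rfl), Walk.eval_append, h2]
  · intro a
    change (t 1)⁻¹ * (θ (GU.gen U a).1.left : K) * t (GU.gen U a).1.right = k a
    rw [hval (GU.gen U a) (Walk.nil.fwd a (one_mul _)) 
      (congrArg QuotientGroup.mk (one_mul (FreeGroup.of ((1 : MaxGrp M), a))))]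
    simp [Walk.eval]

end GUHom

/-- The greatest elements of the `σ`-classes form a dual premorphism. -/
theorem IsFInverse.exists_dualPremorphism {F : Type u} [InverseMonoid F] (hF : IsFInverse F) :
    ∃ m : MaxGrp F → F, IsDualPremorphism m ∧ ∀ n : F, natLE n (m (toG n)) := by
  choose m hm hmax using hF
  refine ⟨m, ⟨?_, ?_, ?_⟩, fun n => hmax _ n rfl⟩
  · exact eq_one_of_natLE (hmax 1 1 (map_one toG))
  · intro h
    refine natLE_asymm ?_ (hmax _ _ ?_)
    · have := natLE_inv (hmax h (m h⁻¹)⁻¹ (by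
        rw [toG_inv, hm]; exact inv_inv h))
      rwa [inv_inv'] at this
    · rw [toG_inv, hm]
  · intro h k
    exact hmax _ _ (by rw [map_mul, hm, hm])

/-- The generator of `a` is sent to the `σ`-class of a preimage `s a`. The greatest element of that
class lies above `s a`, so its image in `M` lies above `a` and equals `a` by maximality. -/
theorem exists_dualPremorphism_of_hasFInverseCoverVia {M : Type u} [InverseMonoid M]
    {A : Set M} (hA : A ⊆ maxNonId M) {U : GroupVariety} (h : HasFInverseCoverVia M U) :
    ∃ ψ : GU U A → M, IsDualPremorphism ψ ∧ ∀ a : A, ψ (GU.gen U a) = a := by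
  obtain ⟨F, _, φ, hF, hφ, -, hker⟩ := h
  obtain ⟨m, hm, hmax⟩ := hF.exists_dualPremorphism
  choose s hs using hφ
  have hπ : Function.Surjective (MaxGrp.map φ) := by
    intro g
    obtain ⟨x, rfl⟩ := toG_surjective g
    refine ⟨toG (s x), ?_⟩
    change toG (φ (s x)) = _
    rw [hs]
  obtain ⟨f, hf⟩ := GU.exists_hom (U := U) (A := A) (MaxGrp.map φ) hπ hker
    (fun a => toG (s a)) (fun a => by
      change toG (φ (s a)) = _
      rw [hs])
  refine ⟨fun h => φ (m (f h)), ⟨?_, ?_, ?_⟩, ?_⟩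
  · have : f 1 = 1 := map_one f
    change φ (m (f 1)) = 1
    rw [this, show m 1 = 1 from hm.map_one, map_one]
  · intro h
    have : f h⁻¹ = (f h)⁻¹ := map_inv f h
    change φ (m (f h⁻¹)) = _
    rw [this, show m (f h)⁻¹ = (m (f h))⁻¹ from hm.map_inv _, map_inv']
  · intro h k
    have : f (h * k) = f h * f k := map_mul f h k
    change natLE _ (φ (m (f (h * k))))
    rw [this, ← map_mul]
    exact natLE_map φ (hm.map_mul _ _)
  · intro a
    have := natLE_map φ (hmax (s a))
    rw [hs] at this
    change φ (m (f (GU.gen U a))) = a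
    rw [hf]
    exact (hA a.2).2 _ this

/-! ### Closed subgraphs and labels -/

section ClosedSubgraphs

variable {M : Type u} [InverseMonoid M] [EUnitary M]

theorem Walk.labelsIn_span {T : Set M} {i j : MaxGrp M} (p : Walk T i j) :
    p.span.LabelsIn T := by
  induction p with
  | nil => exact fun _ he => he.elim
  | fwd p m h ih => exact SubGr.LabelsIn.sup ih (by rintro _ rfl; exact m.2)
  | bwd p m h ih => exact SubGr.LabelsIn.sup ih (by rintro _ rfl; exact m.2)

namespace SubGr

variable {S : Set M}

theorem label_anti {X Y : SubGr M} (hX : X.FinConn) (hY : Y.FinConn) (h : X ≤ Y)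
    {i j : MaxGrp M} (hi : i ∈ X.verts) (hj : j ∈ X.verts) :
    natLE (Y.label i j) (X.label i j) := by
  obtain ⟨p, hp⟩ := exists_walk hX hi hj
  obtain ⟨q, hq⟩ := exists_walk hY (h.1 hi) (h.1 hj)
  rw [label_eq p hp, label_eq q hq]
  exact Walk.label_le q p (by rwa [hp, hq])

/-- Closures of finite connected subgraphs are compared by means of the labels. -/
theorem cl_le_cl_iff {X Y : SubGr M} (hX : X.FinConn) (hY : Y.FinConn) (hXS : X.LabelsIn S)
    (hYS : Y.LabelsIn S) {i j : MaxGrp M} (hi : i ∈ X.verts) (hj : j ∈ X.verts)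
    (hi' : i ∈ Y.verts) (hj' : j ∈ Y.verts) :
    X.cl S ≤ Y.cl S ↔ natLE (Y.label i j) (X.label i j) := by
  constructor
  · intro h
    -- Being finite, `X` lies in a single enlargement `V` of a finite connected `W ≤ Y` that
    -- preserves the label of `W`. Adding `V` to `Y` then preserves the labels of `Y`, while the
    -- union contains `X`.
    obtain ⟨V, ⟨hV, hVS, W, hW, hWY, hWV, k, hk, l, hl, hlab⟩, hXV⟩ :=
      Ext.exists_of_finite hY.2.2 hYS hX ((le_cl hXS).trans h)
    have hVY := finConn_sup hV hY (hXV.1 hi) hi'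
    have e := label_sup hW hV hY hWV hWY hk hl hlab
    rw [← label_base hY hVY le_sup_right (hWY.1 hk) (hWY.1 hl) e hi' hj']
    exact label_anti hX hVY (hXV.trans le_sup_left) hi hj
  · intro h
    rw [← cl_cl hY.2.2 hYS]
    refine cl_mono (le_sup_right.trans (Ext.le_cl (V := Y ⊔ X) ?_))
    exact ⟨finConn_sup hY hX hi' hi, hYS.sup hXS, Y, hY, le_rfl, le_sup_left, i, hi', j, hj',
      label_sup_of_le hY hX hi' hj' hi hj h⟩

/-- Closure is idempotent on connected subgraphs, which is why the union is required to be
connected. Joins of closures can thus be computed on the generating subgraphs. -/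
theorem cl_sup_cl {X Y : SubGr M} (hX : X.LabelsIn S) (hY : Y.LabelsIn S)
    (hC : (X ⊔ Y).Connected) : (X.cl S ⊔ Y.cl S).cl S = (X ⊔ Y).cl S := by
  refine le_antisymm ?_ (cl_mono (sup_le_sup (le_cl hX) (le_cl hY)))
  rw [← cl_cl hC (hX.sup hY)]
  exact cl_mono (sup_le (cl_mono le_sup_left) (cl_mono le_sup_right))

/-- A generating finite subgraph may absorb finitely many label-preserving enlargements without
changing its closure, so both roots can be placed inside it. -/
theorem IsClFC.exists_finConn {X : SubGr M} (h : IsClFC S X) {i j : MaxGrp M}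
    (hi : i ∈ X.verts) (hj : j ∈ X.verts) :
    ∃ Y : SubGr M, Y.LabelsIn S ∧ Y.FinConn ∧ X = Y.cl S ∧ i ∈ Y.verts ∧ j ∈ Y.verts := by
  obtain ⟨Y, hS, hY, rfl, hiY⟩ := h.rebase hi
  obtain ⟨V₁, hV₁, hj₁⟩ := Ext.exists_of_finite hY.2.2 hS (finConn_point j) (Walk.point_le hj)
  obtain ⟨V, hV, h₁, h₂⟩ := Ext.directed hY.2.2 hS hV₁ (Ext.of_le hS hY le_rfl)
  refine ⟨V, hV.2.1, hV.1, le_antisymm (cl_mono h₂) ?_, h₂.1 hiY, h₁.1 (hj₁.1 rfl)⟩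
  rw [← cl_cl hY.2.2 hS]
  exact cl_mono hV.le_cl

end SubGr

/-! ### The isomorphism of `M` with `X_cl/G` -/

/-- The initial vertex is arbitrary so that the paths of two factors can be concatenated. The paths
are typed over `Set.univ`, with the labels restricted separately, because `SubGr.label` is defined
by such paths. -/
theorem exists_walk_label {S : Set M} (hS : Generates S) (m : M) :
    ∀ i j : MaxGrp M, i * toG m = j →
      ∃ p : Walk (Set.univ : Set M) i j, p.span.LabelsIn S ∧ p.label = m := by
  refine hS.induction (P := fun m => ∀ i j : MaxGrp M, i * toG m = j →
      ∃ p : Walk (Set.univ : Set M) i j, p.span.LabelsIn S ∧ p.label = m) ?_ ?_ ?_ ?_ m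
  · intro i j h
    rw [map_one, mul_one] at h
    subst h
    exact ⟨Walk.nil, fun _ he => he.elim, rfl⟩
  · intro s hs i j h
    refine ⟨Walk.nil.fwd ⟨s, trivial⟩ h, ?_, one_mul s⟩
    exact SubGr.LabelsIn.sup (fun _ he => he.elim) (by rintro _ rfl; exact hs)
  · intro m hm i j h
    obtain ⟨p, hp, rfl⟩ := hm j i (by rw [← h, toG_inv, inv_mul_cancel_right])
    exact ⟨p.reverse, by rwa [Walk.span_reverse], p.label_reverse⟩
  · intro m n hm hn i j h
    obtain ⟨p, hp, hpm⟩ := hm i _ rfl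
    obtain ⟨q, hq, hqn⟩ := hn _ j (by rw [← h, map_mul, mul_assoc])
    exact ⟨p.append q, by rw [Walk.span_append]; exact hp.sup hq,
      by rw [p.label_append q, hpm, hqn]⟩

namespace XclQuot

variable {S : Set M}

/-- The element of `X_cl/G` represented by a path starting at `1`. -/
noncomputable def ofWalk {g : MaxGrp M} (p : Walk (Set.univ : Set M) 1 g)
    (hp : p.span.LabelsIn S) : XclQuot S where
  graph := p.span.cl S
  elt := g
  isClFC := ⟨p.span, hp, SubGr.finConn_span p, rfl⟩
  one_mem := (SubGr.le_cl hp).1 p.start_mem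
  elt_mem := (SubGr.le_cl hp).1 p.end_mem

/-- Comparing closures in both directions amounts to comparing labels in both directions, and equal
labels force equal endpoints. This is what makes the isomorphism with `M` multiplicative and
injective. -/
theorem ofWalk_eq_iff {g h : MaxGrp M} (p : Walk (Set.univ : Set M) 1 g)
    (q : Walk (Set.univ : Set M) 1 h) (hp : p.span.LabelsIn S) (hq : q.span.LabelsIn S) :
    ofWalk p hp = ofWalk q hq ↔ p.label = q.label := by
  have key : g = h → ((∀ X Y : SubGr M, X = p.span → Y = q.span → (X.cl S = Y.cl S)) ↔
      p.label = q.label) := by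
    rintro rfl
    have h1 := SubGr.cl_le_cl_iff (SubGr.finConn_span p) (SubGr.finConn_span q) hp hq
      p.start_mem p.end_mem q.start_mem q.end_mem
    have h2 := SubGr.cl_le_cl_iff (SubGr.finConn_span q) (SubGr.finConn_span p) hq hp
      q.start_mem q.end_mem p.start_mem p.end_mem
    rw [SubGr.label_eq p rfl, SubGr.label_eq q rfl] at h1 h2
    constructor
    · intro h
      have h := h _ _ rfl rfl
      exact natLE_asymm (h2.mp h.ge) (h1.mp h.le)
    · rintro h _ _ rfl rfl
      rw [h] at h1 h2
      exact le_antisymm (h1.mpr (natLE_refl _)) (h2.mpr (natLE_refl _))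
  constructor
  · intro e
    refine (key (congrArg XclQuot.elt e)).mp ?_
    rintro _ _ rfl rfl
    exact congrArg XclQuot.graph e
  · intro e
    have hg : g = h := by rw [← p.toG_label, ← q.toG_label, e]
    exact XclQuot.ext ((key hg).mpr e _ _ rfl rfl) hg

theorem exists_ofWalk (x : XclQuot S) :
    ∃ (p : Walk (Set.univ : Set M) 1 x.elt) (hp : p.span.LabelsIn S), x = ofWalk p hp := by
  obtain ⟨Y, hYS, hY, hX, h1, hg⟩ := x.isClFC.exists_finConn x.one_mem x.elt_mem
  obtain ⟨p, rfl⟩ := SubGr.exists_walk hY h1 hg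
  exact ⟨p, hYS, XclQuot.ext hX rfl⟩

/-- The product of `X_cl/G` translates its second subgraph by `g`, just as concatenation requires of
the second path. Labels are invariant under translation. -/
theorem exists_ofWalk_mul {g h : MaxGrp M} (p : Walk (Set.univ : Set M) 1 g)
    (q : Walk (Set.univ : Set M) 1 h) (hp : p.span.LabelsIn S) (hq : q.span.LabelsIn S) :
    ∃ (r : Walk (Set.univ : Set M) 1 (g * h)) (hr : r.span.LabelsIn S),
      ofWalk p hp * ofWalk q hq = ofWalk r hr ∧ r.label = p.label * q.label := by
  have hq' : ∃ q' : Walk (Set.univ : Set M) g (g * h),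
      q'.span = g • q.span ∧ q'.label = q.label := by
    have h1 := SubGr.span_act g q
    have h2 := Walk.label_act g q
    generalize q.act g = r at h1 h2
    revert r
    rw [mul_one]
    exact fun r h1 h2 => ⟨r, h1, h2⟩
  obtain ⟨q', h1, h2⟩ := hq'
  have hS' : q'.span.LabelsIn S := by rw [h1]; exact fun e he => hq (g⁻¹ * e.1, e.2) he
  have hS : (p.append q').span.LabelsIn S := by rw [Walk.span_append]; exact hp.sup hS'
  refine ⟨p.append q', hS, XclQuot.ext ?_ rfl, by rw [Walk.label_append, h2]⟩
  change (p.span.cl S ⊔ g • q.span.cl S).cl S = (p.append q').span.cl S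
  have hC := (SubGr.finConn_span (p.append q')).2.2
  rw [Walk.span_append] at hC ⊢
  rw [SubGr.smul_cl, ← h1, SubGr.cl_sup_cl hp hS' hC]

theorem one_eq_ofWalk :
    (1 : XclQuot S) = ofWalk (Walk.nil : Walk (Set.univ : Set M) 1 1) (fun _ he => he.elim) := rfl

end XclQuot

/-- `M` is isomorphic to `X_cl/G`, and the isomorphism is canonical. -/
theorem exists_mulEquiv_xclQuot {A I : Set M} (hAI : Generates (A ∪ I)) :
    ∃ e : M ≃* XclQuot (A ∪ I), ∀ a : A, e a = XclQuot.gen a := by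
  choose p hp hlab using fun m : M => exists_walk_label hAI m 1 (toG m) (one_mul _)
  let f : M →* XclQuot (A ∪ I) :=
    { toFun := fun m => XclQuot.ofWalk (p m) (hp m)
      map_one' := by
        rw [XclQuot.one_eq_ofWalk]
        exact (XclQuot.ofWalk_eq_iff _ _ _ _).mpr (hlab 1)
      map_mul' := fun m n => by
        obtain ⟨r, hr, h1, h2⟩ := XclQuot.exists_ofWalk_mul (p m) (p n) (hp m) (hp n)
        rw [h1, XclQuot.ofWalk_eq_iff, h2, hlab, hlab, hlab] }
  have hf : Function.Bijective f := by
    constructor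
    · intro m n h
      have := (XclQuot.ofWalk_eq_iff _ _ (hp m) (hp n)).mp h
      rwa [hlab, hlab] at this
    · intro x
      obtain ⟨q, hq, hx⟩ := x.exists_ofWalk
      exact ⟨q.label, ((XclQuot.ofWalk_eq_iff _ _ (hp _) hq).mpr (hlab _)).trans hx.symm⟩
  refine ⟨MulEquiv.ofBijective f hf, fun a => ?_⟩
  have hS : (Walk.nil.fwd ⟨(a : M), trivial⟩ (one_mul _) :
      Walk (Set.univ : Set M) 1 (toG (a : M))).span.LabelsIn (A ∪ I) :=
    SubGr.LabelsIn.sup (fun _ he => he.elim) (by rintro _ rfl; exact Or.inl a.2)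
  have h : (XclQuot.gen a : XclQuot (A ∪ I)) = XclQuot.ofWalk _ hS := by
    refine XclQuot.ext ?_ rfl
    change (SubGr.edge 1 (a : M)).cl (A ∪ I) = (SubGr.point 1 ⊔ SubGr.edge 1 (a : M)).cl (A ∪ I)
    rw [sup_eq_right.mpr (Walk.point_le (Or.inl rfl))]
  rw [h]
  exact (XclQuot.ofWalk_eq_iff _ _ (hp _) hS).mpr ((hlab _).trans (one_mul _).symm)

end ClosedSubgraphs

open CategoryTheory

section Chains

variable {M : Type u} [InverseMonoid M]

/-! ### Connectedness and components -/

namespace SubGr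

theorem connected_of_base {X : SubGr M} {i : MaxGrp M} (hi : i ∈ X.verts)
    (h : ∀ v ∈ X.verts, ∃ p : Walk (Set.univ : Set M) i v, p.span ≤ X) : X.Connected := by
  refine ⟨⟨i, hi⟩, fun v hv w hw => ?_⟩
  obtain ⟨p, hp⟩ := h v hv
  obtain ⟨q, hq⟩ := h w hw
  refine ⟨p.reverse.append q, ?_⟩
  rw [Walk.span_append, Walk.span_reverse]
  exact sup_le hp hq

theorem Connected.sup {X Y : SubGr M} (hX : X.Connected) (hY : Y.Connected) {k : MaxGrp M}
    (hkX : k ∈ X.verts) (hkY : k ∈ Y.verts) : (X ⊔ Y).Connected := by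
  refine connected_of_base (i := k) (Or.inl hkX) ?_
  rintro v (hv | hv)
  · obtain ⟨p, hp⟩ := hX.2 k hkX v hv
    exact ⟨p, hp.trans le_sup_left⟩
  · obtain ⟨p, hp⟩ := hY.2 k hkY v hv
    exact ⟨p, hp.trans le_sup_right⟩

theorem component_le (X : SubGr M) (i : MaxGrp M) : X.component i ≤ X :=
  ⟨fun _ ⟨p, hp⟩ => hp.1 p.end_mem, fun _ he => he.1⟩

theorem component_mono {X Y : SubGr M} (h : X ≤ Y) (i : MaxGrp M) :
    X.component i ≤ Y.component i :=
  ⟨fun _ ⟨p, hp⟩ => ⟨p, hp.trans h⟩, fun _ ⟨he, p, hp⟩ => ⟨h.2 he, p, hp.trans h⟩⟩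

theorem Connected.le_component {X Y : SubGr M} (hX : X.Connected) (h : X ≤ Y) {i : MaxGrp M}
    (hi : i ∈ X.verts) : X ≤ Y.component i := by
  constructor
  · intro v hv
    obtain ⟨p, hp⟩ := hX.2 i hi v hv
    exact ⟨p, hp.trans h⟩
  · intro e he
    obtain ⟨p, hp⟩ := hX.2 i hi e.1 (X.src_mem e he)
    exact ⟨h.2 he, p, hp.trans h⟩

theorem le_sInf' {𝒳 : Set (SubGr M)} {Y : SubGr M} (h : ∀ X ∈ 𝒳, Y ≤ X) : Y ≤ sInf 𝒳 :=
  ⟨fun _ hv X hX => (h X hX).1 hv, fun _ he X hX => (h X hX).2 he⟩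

theorem sInf_le' {𝒳 : Set (SubGr M)} {X : SubGr M} (h : X ∈ 𝒳) : sInf 𝒳 ≤ X :=
  ⟨fun _ hv => hv X h, fun _ he => he X h⟩

theorem span_le_component {T : Set M} {X : SubGr M} {i j : MaxGrp M} (p : Walk T i j)
    (hp : p.span ≤ X) : p.span ≤ X.component i := by
  induction p with
  | nil => exact Walk.point_le ⟨Walk.nil, hp⟩
  | @fwd j k p m h ih =>
    have h1 := ih (le_sup_left.trans hp)
    refine sup_le h1 (Walk.edge_le ⟨hp.2 (Or.inr rfl), ?_⟩)
    exact h1.1 p.end_mem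
  | @bwd j k p m h ih =>
    have h1 := ih (le_sup_left.trans hp)
    obtain ⟨q, hq⟩ := h1.1 p.end_mem
    refine sup_le h1 (Walk.edge_le ⟨hp.2 (Or.inr rfl), q.bwd ⟨(m : M), trivial⟩ h, ?_⟩)
    exact sup_le hq (le_sup_right.trans hp)

theorem connected_component {X : SubGr M} {i : MaxGrp M} (hi : i ∈ X.verts) :
    (X.component i).Connected :=
  connected_of_base (i := i) ⟨Walk.nil, Walk.point_le hi⟩
    fun _ ⟨p, hp⟩ => ⟨p, span_le_component p hp⟩

theorem smul_point (g i : MaxGrp M) : g • point i = point (g * i) := by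
  apply SubGr.ext
  · ext w
    change g⁻¹ * w = i ↔ w = g * i
    rw [inv_mul_eq_iff_eq_mul]
  · rfl

theorem smul_edge (g v : MaxGrp M) (m : M) : g • edge v m = edge (g * v) m := by
  apply SubGr.ext
  · ext w
    change (g⁻¹ * w = v ∨ g⁻¹ * w = v * toG m) ↔ (w = g * v ∨ w = g * v * toG m)
    rw [inv_mul_eq_iff_eq_mul, inv_mul_eq_iff_eq_mul, mul_assoc]
  · ext ⟨w, n⟩
    change (g⁻¹ * w, n) = (v, m) ↔ (w, n) = (g * v, m)
    rw [Prod.mk.injEq, Prod.mk.injEq, inv_mul_eq_iff_eq_mul]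

variable [EUnitary M] {S : Set M}

/-- By directedness, each vertex of the closure lies together with a fixed vertex of `X` in one
finite connected enlargement, which is contained in the closure. -/
theorem Connected.cl {X : SubGr M} (hX : X.Connected) (hS : X.LabelsIn S) :
    (X.cl S).Connected := by
  obtain ⟨i, hi⟩ := hX.1
  have h1 := (le_cl hS).1 hi
  refine connected_of_base h1 fun v hv => ?_
  obtain ⟨V, hV, hvV⟩ := Ext.exists_of_finite hX hS (finConn_point v) (Walk.point_le hv)
  obtain ⟨W, hW, hiV, hWV⟩ := Ext.directed hX hS hV
    (Ext.of_le hS (finConn_point i) (Walk.point_le hi))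
  obtain ⟨p, hp⟩ := hW.1.2.2.2 i (hWV.1 rfl) v (hiV.1 (hvV.1 rfl))
  exact ⟨p, hp.trans hW.le_cl⟩

theorem IsClFC.connected {X : SubGr M} (hX : IsClFC S X) : X.Connected := by
  obtain ⟨Y, hS, hY, rfl⟩ := hX
  exact hY.2.2.cl hS

end SubGr

/-! ### Subadditive assignments of subgraphs to arrows -/

section UnionAlong

variable {U : GroupVariety} {A : Set M} {P Q : ∀ {i j : CatU U A}, (i ⟶ j) → SubGr M}

theorem src_mem_unionAlong {i j : CatU U A} (q : Quiver.Path i j) :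
    i.vertex ∈ (unionAlong P q).verts := by
  induction q with
  | nil => rfl
  | cons q x ih => exact Or.inl ih

theorem tgt_mem_unionAlong (hP : ∀ {i j : CatU U A} (x : i ⟶ j), j.vertex ∈ (P x).verts)
    {i j : CatU U A} (q : Quiver.Path i j) : j.vertex ∈ (unionAlong P q).verts := by
  cases q with
  | nil => rfl
  | cons q x => exact Or.inr (hP x)

theorem connected_unionAlong (hc : ∀ {i j : CatU U A} (x : i ⟶ j), (P x).Connected)
    (hs : ∀ {i j : CatU U A} (x : i ⟶ j), i.vertex ∈ (P x).verts)
    (ht : ∀ {i j : CatU U A} (x : i ⟶ j), j.vertex ∈ (P x).verts)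
    {i j : CatU U A} (q : Quiver.Path i j) : (unionAlong P q).Connected := by
  induction q with
  | nil => exact ⟨⟨_, rfl⟩, by rintro _ rfl _ rfl; exact ⟨Walk.nil, le_rfl⟩⟩
  | cons q x ih => exact ih.sup (hc x) (tgt_mem_unionAlong ht q) (hs x)

theorem labelsIn_unionAlong {S : Set M}
    (hP : ∀ {i j : CatU U A} (x : i ⟶ j), (P x).LabelsIn S)
    {i j : CatU U A} (q : Quiver.Path i j) : (unionAlong P q).LabelsIn S := by
  induction q with
  | nil => exact fun _ he => he.elim
  | cons q x ih =>
    rintro e (he | he)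
    exacts [ih e he, hP x e he]

theorem unionAlong_mono (h : ∀ {i j : CatU U A} (x : i ⟶ j), P x ≤ Q x)
    {i j : CatU U A} (q : Quiver.Path i j) : unionAlong P q ≤ unionAlong Q q := by
  induction q with
  | nil => exact le_rfl
  | cons q x ih => exact sup_le_sup ih (h x)

end UnionAlong

/-! ### Translating arrows of the free category to elements of `G^U` -/

section ToGU

variable {U : GroupVariety} {A : Set M}

/-- The element of `G^U` obtained by translating an arrow of the free `gU`-category to `1`. -/
def CatU.toGU {i j : CatU U A} (x : i ⟶ j) : GU U A :=
  ⟨⟨actU U A i.vertex⁻¹ x.1, i.vertex⁻¹ * j.vertex⟩, by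
    obtain ⟨p, hp⟩ := x.2
    obtain ⟨q, hq⟩ := actU_val U i.vertex⁻¹ p (inv_mul_cancel _) rfl
    exact ⟨q, by rw [hq, hp]⟩⟩

theorem CatU.toGU_id (i : CatU U A) : CatU.toGU (𝟙 i) = 1 :=
  Subtype.ext (SemidirectProduct.ext (map_one (actU U A i.vertex⁻¹)) (inv_mul_cancel _))

/-- The action of `i⁻¹j` in the semidirect product turns translation by `j⁻¹` into translation by
`i⁻¹`, so moving arrows to the initial vertex `1` is functorial. -/
theorem CatU.toGU_comp {i j k : CatU U A} (x : i ⟶ j) (y : j ⟶ k) :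
    CatU.toGU (x ≫ y) = CatU.toGU x * CatU.toGU y := by
  refine Subtype.ext (SemidirectProduct.ext ?_ ?_)
  · change actU U A i.vertex⁻¹ (x.1 * y.1) = actU U A i.vertex⁻¹ x.1 *
      actU U A (i.vertex⁻¹ * j.vertex) (actU U A j.vertex⁻¹ y.1)
    rw [map_mul, ← MulAut.mul_apply, ← map_mul (actU U A), mul_inv_cancel_right]
  · change i.vertex⁻¹ * k.vertex = i.vertex⁻¹ * j.vertex * (j.vertex⁻¹ * k.vertex)
    rw [mul_assoc, mul_inv_cancel_left]

theorem CatU.toGU_inv {i j : CatU U A} (x : i ⟶ j) :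
    CatU.toGU (InverseCategory.inv x) = (CatU.toGU x)⁻¹ := by
  rw [eq_inv_iff_mul_eq_one, ← CatU.toGU_comp, ← CatU.toGU_id]
  congr 1
  exact Subtype.ext (inv_mul_cancel x.1)

theorem CatU.toGU_edge {i j : Cay A} (a : i ⟶ j) :
    CatU.toGU ((epsCatU U A).map a) = GU.gen U a.1 := by
  refine Subtype.ext (SemidirectProduct.ext ?_ ?_)
  · change actU U A i.vertex⁻¹ (QuotientGroup.mk (1 * FreeGroup.of (i.vertex, a.1))) = _
    rw [one_mul, actU_of, inv_mul_cancel]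
    rfl
  · change i.vertex⁻¹ * j.vertex = toG (a.1 : M)
    exact inv_mul_eq_iff_eq_mul.mpr a.2.symm

end ToGU

/-! ### Canonical dual premorphisms as bounds for the chains -/

variable [EUnitary M] {U : GroupVariety} {A : Set M} (I : Set M)

/-- An assignment of closed subgraphs to the arrows of the free `gU`-category, that is a canonical
dual premorphism to `X_cl` in terms of the subgraphs. -/
structure IsSubadditive (Q : ∀ {i j : CatU U A}, (i ⟶ j) → SubGr M) : Prop where
  isClFC : ∀ {i j : CatU U A} (x : i ⟶ j), SubGr.IsClFC (A ∪ I) (Q x)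
  src_mem : ∀ {i j : CatU U A} (x : i ⟶ j), i.vertex ∈ (Q x).verts
  tgt_mem : ∀ {i j : CatU U A} (x : i ⟶ j), j.vertex ∈ (Q x).verts
  map_id : ∀ i : CatU U A, Q (𝟙 i) = (SubGr.point i.vertex).cl (A ∪ I)
  map_inv : ∀ {i j : CatU U A} (x : i ⟶ j), Q (InverseCategory.inv x) = Q x
  map_comp : ∀ {i j k : CatU U A} (x : i ⟶ j) (y : j ⟶ k),
    Q (x ≫ y) ≤ (Q x ⊔ Q y).cl (A ∪ I)
  map_edge : ∀ {i j : Cay A} (a : i ⟶ j),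
    Q ((epsCatU U A).map a) = (SubGr.edge i.vertex (a.1 : M)).cl (A ∪ I)

variable {I} {Q : ∀ {i j : CatU U A}, (i ⟶ j) → SubGr M}

/-- Since products are joins, the order is reverse inclusion: the graph of `f`, taken as a loop at
`j`, is an idempotent that restricts `g` to `f`. -/
theorem arrLE_iff {S : Set M} {i j : Xcl S} {f g : i ⟶ j} : arrLE f g ↔ g.1 ≤ f.1 := by
  constructor
  · rintro ⟨h, -, rfl⟩
    exact SubGr.le_join_left g.2.1.labelsIn h.2.1.labelsIn
  · intro h
    refine ⟨⟨f.1, f.2.1, f.2.2.2, f.2.2.2⟩, Subtype.ext ?_, Subtype.ext ?_⟩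
    · change (f.1 ⊔ f.1).cl S = f.1
      rw [sup_idem, f.2.1.closed]
    · change f.1 = (g.1 ⊔ f.1).cl S
      rw [sup_eq_right.mpr h, f.2.1.closed]

theorem IsCatDualPremorphism.isSubadditive {Ψ : CatU U A ⥤q Xcl (A ∪ I)}
    (hΨ : IsCatDualPremorphism Ψ) (hcan : epsCatU U A ⋙q Ψ = epsXcl A I) :
    IsSubadditive I fun {i j : CatU U A} (x : i ⟶ j) => (Ψ.map x).1 := by
  have hobj : ∀ i : CatU U A, (Ψ.obj i).vertex = i.vertex := fun i => by
    have := Prefunctor.congr_obj hcan ⟨i.vertex⟩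
    exact congrArg Xcl.vertex this
  refine ⟨fun x => (Ψ.map x).2.1, fun {i j} x => ?_, fun {i j} x => ?_, fun i => ?_,
    fun x => ?_, fun x y => ?_, fun {i j} a => ?_⟩
  · rw [← hobj i]
    exact (Ψ.map x).2.2.1
  · rw [← hobj j]
    exact (Ψ.map x).2.2.2
  · rw [hΨ.map_id, ← hobj i]
    rfl
  · rw [hΨ.map_inv]
    rfl
  · exact arrLE_iff.mp (hΨ.map_comp x y)
  -- Equality of prefunctors compares arrows only up to transport along the equality of objects.
  -- Substituting the whole prefunctor reduces it to equality of underlying graphs.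
  · have key : ∀ E : Cay A ⥤q Xcl (A ∪ I), epsCatU U A ⋙q Ψ = E →
        (Ψ.map ((epsCatU U A).map a)).1 = (E.map a).1 := by
      rintro _ rfl
      rfl
    exact key _ hcan

namespace IsSubadditive

/-- The last edge of the path is split off. Its value is the closure of the edge in either
direction, by invariance under inversion, and subadditivity adds it to the value of the rest. This
bounds `Q` by `C_0`. -/
theorem le_cl_span
    (hQ : IsSubadditive I Q)
    {i j : MaxGrp M} (p : Walk A i j) (x : (⟨i⟩ : CatU U A) ⟶ ⟨j⟩)
    (hx : p.val U = x.1) : Q x ≤ p.span.cl (A ∪ I) := by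
  have hS : ∀ {i j : MaxGrp M} (p : Walk A i j), p.span.LabelsIn (A ∪ I) :=
    fun p e he => Or.inl (p.labelsIn_span e he)
  induction p with
  | nil =>
    have : x = 𝟙 _ := Subtype.ext hx.symm
    rw [this, hQ.map_id]
    exact le_rfl
  | @fwd j k p a h ih =>
    let y : (⟨i⟩ : CatU U A) ⟶ ⟨j⟩ := ⟨p.val U, p, rfl⟩
    let e : (⟨j⟩ : Cay A) ⟶ ⟨k⟩ := ⟨a, h⟩
    let z : (⟨j⟩ : CatU U A) ⟶ ⟨k⟩ := (epsCatU U A).map e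
    have hz : Q z = (SubGr.edge j (a : M)).cl (A ∪ I) := hQ.map_edge e
    have : x = y ≫ z := by
      refine Subtype.ext (hx.symm.trans ?_)
      change QuotientGroup.mk _ = QuotientGroup.mk _ * QuotientGroup.mk _
      rw [← QuotientGroup.mk_mul]
      change QuotientGroup.mk (p.word * _) = QuotientGroup.mk (p.word * (1 * _))
      rw [one_mul]
    rw [this]
    refine (hQ.map_comp _ _).trans ?_
    rw [hz]
    have hC := (SubGr.finConn_span (p.fwd a h)).2.2
    change _ ≤ (p.span ⊔ SubGr.edge j (a : M)).cl (A ∪ I)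
    rw [← SubGr.cl_sup_cl (hS p) (by rintro _ rfl; exact Or.inl a.2) hC]
    exact SubGr.cl_mono (sup_le_sup (ih y rfl) le_rfl)
  | @bwd j k p a h ih =>
    let y : (⟨i⟩ : CatU U A) ⟶ ⟨j⟩ := ⟨p.val U, p, rfl⟩
    let e : (⟨k⟩ : Cay A) ⟶ ⟨j⟩ := ⟨a, h⟩
    let z : (⟨k⟩ : CatU U A) ⟶ ⟨j⟩ := (epsCatU U A).map e
    have hz : Q (InverseCategory.inv z) = (SubGr.edge k (a : M)).cl (A ∪ I) :=
      (hQ.map_inv z).trans (hQ.map_edge e)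
    have : x = y ≫ InverseCategory.inv z := by
      refine Subtype.ext (hx.symm.trans ?_)
      change QuotientGroup.mk _ = QuotientGroup.mk _ * (QuotientGroup.mk _)⁻¹
      rw [← QuotientGroup.mk_inv, ← QuotientGroup.mk_mul]
      change QuotientGroup.mk (p.word * _) = QuotientGroup.mk (p.word * (1 * _)⁻¹)
      rw [one_mul]
    rw [this]
    refine (hQ.map_comp _ _).trans ?_
    rw [hz]
    have hC := (SubGr.finConn_span (p.bwd a h)).2.2
    change _ ≤ (p.span ⊔ SubGr.edge k (a : M)).cl (A ∪ I)
    rw [← SubGr.cl_sup_cl (hS p) (by rintro _ rfl; exact Or.inl a.2) hC]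
    exact SubGr.cl_mono (sup_le_sup (ih y rfl) le_rfl)

theorem le_cl_unionAlong
    (hQ : IsSubadditive I Q)
    {i j : CatU U A} (q : Quiver.Path i j) :
    Q (composePath q) ≤ (unionAlong Q q).cl (A ∪ I) := by
  induction q with
  | nil => exact (hQ.map_id i).le
  | cons q x ih =>
    have hS := labelsIn_unionAlong (P := Q) (fun x => (hQ.isClFC x).labelsIn) q
    have hC := connected_unionAlong (P := Q) (fun x => (hQ.isClFC x).connected) hQ.src_mem
      hQ.tgt_mem (q.cons x)
    refine (hQ.map_comp (composePath q) x).trans ?_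
    change _ ≤ (unionAlong Q q ⊔ Q x).cl (A ∪ I)
    rw [← SubGr.cl_sup_cl hS (hQ.isClFC x).labelsIn hC, (hQ.isClFC x).closed]
    exact SubGr.cl_mono (sup_le_sup ih le_rfl)

/-- As `Q x` is connected and contains the initial vertex, it suffices to bound it by `C_n(x)`.
Subadditivity carries such a bound from the factors of any decomposition to `x`, hence from stage
`n` to stage `n + 1`. -/
theorem le_chainP
    (hQ : IsSubadditive I Q)
    (n : ℕ) : ∀ {i j : CatU U A} (x : i ⟶ j), Q x ≤ chainP I n x := by
  induction n with
  | zero =>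
    intro i j x
    refine (hQ.isClFC x).connected.le_component (SubGr.le_sInf' ?_) (hQ.src_mem x)
    rintro _ ⟨p, hp, rfl⟩
    exact hQ.le_cl_span p x hp
  | succ n ih =>
    intro i j x
    refine (hQ.isClFC x).connected.le_component (SubGr.le_sInf' ?_) (hQ.src_mem x)
    rintro _ ⟨q, rfl, rfl⟩
    exact (hQ.le_cl_unionAlong q).trans (SubGr.cl_mono (unionAlong_mono ih q))

theorem tgt_mem_chainP
    (hQ : IsSubadditive I Q)
    (n : ℕ) {i j : CatU U A} (x : i ⟶ j) :
    j.vertex ∈ (chainP I n x).verts :=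
  (hQ.le_chainP n x).1 (hQ.tgt_mem x)

end IsSubadditive

/-! ### From `X_cl/G` to `X_cl` -/

theorem XclQuot.graph_anti {S : Set M} {x y : XclQuot S} (h : natLE x y) :
    y.graph ≤ x.graph := by
  obtain ⟨e, he, rfl⟩ := h
  have h1 : e.elt * e.elt = e.elt := congrArg XclQuot.elt he
  have h2 : e.elt = 1 := mul_eq_left.mp h1
  change _ ≤ (e.graph ⊔ e.elt • y.graph).cl S
  rw [h2, SubGr.one_smul']
  exact SubGr.le_join_right e.isClFC.labelsIn y.isClFC.labelsIn

theorem XclQuot.elt_eq_of_natLE {S : Set M} {x y : XclQuot S} (h : natLE x y) :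
    x.elt = y.elt := by
  obtain ⟨e, he, rfl⟩ := h
  have h1 : e.elt * e.elt = e.elt := congrArg XclQuot.elt he
  change e.elt * y.elt = _
  rw [mul_eq_left.mp h1, one_mul]

theorem XclQuot.natLE_of_graph {S : Set M} {x y : XclQuot S} (h : y.graph ≤ x.graph)
    (he : x.elt = y.elt) : natLE x y := by
  refine ⟨⟨x.graph, 1, x.isClFC, x.one_mem, x.one_mem⟩, ?_, ?_⟩
  · refine XclQuot.ext ?_ (mul_one 1)
    change (x.graph ⊔ (1 : MaxGrp M) • x.graph).cl S = x.graph
    rw [SubGr.one_smul', sup_idem, x.isClFC.closed]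
  · refine XclQuot.ext ?_ (he.trans (one_mul _).symm)
    change x.graph = (x.graph ⊔ (1 : MaxGrp M) • y.graph).cl S
    rw [SubGr.one_smul', sup_eq_left.mpr h, x.isClFC.closed]

theorem IsDualPremorphism.elt_eq {ψ : GU U A → XclQuot (A ∪ I)} (hψ : IsDualPremorphism ψ)
    (hgen : ∀ a : A, ψ (GU.gen U a) = XclQuot.gen a) (h : GU U A) : (ψ h).elt = h.1.right := by
  let f : GU U A →* MaxGrp M :=
    { toFun := fun h => (ψ h).elt
      map_one' := congrArg XclQuot.elt hψ.map_one
      map_mul' := fun h k => (XclQuot.elt_eq_of_natLE (hψ.map_mul h k)).symm }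
  exact DFunLike.congr_fun (GU.hom_ext (f := f) (g := GU.toMaxGrp) fun a =>
    congrArg XclQuot.elt (hgen a)) h

/-- The arrow is moved to start at `1`, evaluated by `ψ`, and the graph is moved back by `i`. The
result contains `j` because the group component of the value is `i⁻¹j`. -/
theorem exists_catDualPremorphism {ψ : GU U A → XclQuot (A ∪ I)} (hψ : IsDualPremorphism ψ)
    (hgen : ∀ a : A, ψ (GU.gen U a) = XclQuot.gen a) :
    ∃ Ψ : CatU U A ⥤q Xcl (A ∪ I), IsCatDualPremorphism Ψ ∧ epsCatU U A ⋙q Ψ = epsXcl A I := by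
  have helt : ∀ {i j : CatU U A} (x : i ⟶ j), (ψ (CatU.toGU x)).elt = i.vertex⁻¹ * j.vertex :=
    fun x => hψ.elt_eq hgen _
  let Ψ : CatU U A ⥤q Xcl (A ∪ I) :=
    { obj := fun i => ⟨i.vertex⟩
      map := fun {i j} x => ⟨i.vertex • (ψ (CatU.toGU x)).graph, (ψ (CatU.toGU x)).isClFC.smul _,
        by
          have := SubGr.mem_smul i.vertex (ψ (CatU.toGU x)).one_mem
          rwa [mul_one] at this,
        by
          have := SubGr.mem_smul i.vertex (ψ (CatU.toGU x)).elt_mem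
          rwa [helt, mul_inv_cancel_left] at this⟩ }
  refine ⟨Ψ, ⟨fun i => Subtype.ext ?_, fun {i j} x => Subtype.ext ?_, fun {i j k} x y => ?_⟩, ?_⟩
  · change i.vertex • (ψ (CatU.toGU (𝟙 i))).graph = (SubGr.point i.vertex).cl (A ∪ I)
    rw [CatU.toGU_id, show ψ 1 = 1 from hψ.map_one]
    change i.vertex • (SubGr.point 1).cl (A ∪ I) = _
    rw [SubGr.smul_cl, SubGr.smul_point, mul_one]
  · change j.vertex • (ψ (CatU.toGU (InverseCategory.inv x))).graph =
      i.vertex • (ψ (CatU.toGU x)).graph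
    rw [CatU.toGU_inv, show ψ (CatU.toGU x)⁻¹ = (ψ (CatU.toGU x))⁻¹ from hψ.map_inv _]
    change j.vertex • (ψ (CatU.toGU x)).elt⁻¹ • (ψ (CatU.toGU x)).graph = _
    rw [helt, SubGr.smul_smul', mul_inv_rev, inv_inv, mul_inv_cancel_left]
  · rw [arrLE_iff]
    change i.vertex • (ψ (CatU.toGU (x ≫ y))).graph ≤
      (i.vertex • (ψ (CatU.toGU x)).graph ⊔ j.vertex • (ψ (CatU.toGU y)).graph).cl (A ∪ I)
    have h := SubGr.smul_mono i.vertex (XclQuot.graph_anti (hψ.map_mul (CatU.toGU x)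
      (CatU.toGU y)))
    rw [CatU.toGU_comp]
    refine h.trans (le_of_eq ?_)
    change i.vertex • ((ψ (CatU.toGU x)).graph ⊔
      (ψ (CatU.toGU x)).elt • (ψ (CatU.toGU y)).graph).cl (A ∪ I) = _
    rw [helt, SubGr.smul_cl, SubGr.smul_sup, SubGr.smul_smul', mul_inv_cancel_left]
  · refine Prefunctor.ext (fun _ => rfl) fun i j a => Subtype.ext ?_
    change i.vertex • (ψ (CatU.toGU ((epsCatU U A).map a))).graph =
      (SubGr.edge i.vertex (a.1 : M)).cl (A ∪ I)
    rw [CatU.toGU_edge, hgen]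
    change i.vertex • (SubGr.edge 1 (a.1 : M)).cl (A ∪ I) = _
    rw [SubGr.smul_cl, SubGr.smul_edge, mul_one]

end Chains

section ClosedFinite

variable {M : Type u} [InverseMonoid M] [EUnitary M] {S : Set M}

/-! ### Consequences of finiteness above -/

namespace SubGr

/-- A closed subgraph through `i` is determined by the label at `(i, i)` of a finite subgraph
generating it. For closed subgraphs of the closure of `Y`, these labels lie above the label of `Y`.
-/
theorem finite_isClFC_le (hfin : FiniteAbove M) {Y : SubGr M} (hY : Y.FinConn)
    (hYS : Y.LabelsIn S) {i : MaxGrp M} (hi : i ∈ Y.verts) :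
    {X : SubGr M | IsClFC S X ∧ i ∈ X.verts ∧ X ≤ Y.cl S}.Finite := by
  classical
  have hex : ∀ X : SubGr M, ∃ R : SubGr M, IsClFC S X ∧ i ∈ X.verts →
      R.LabelsIn S ∧ R.FinConn ∧ X = R.cl S ∧ i ∈ R.verts := fun X => by
    by_cases h : IsClFC S X ∧ i ∈ X.verts
    · obtain ⟨R, hR⟩ := h.1.rebase h.2
      exact ⟨R, fun _ => hR⟩
    · exact ⟨X, fun h' => absurd h' h⟩
  choose R hR using hex
  refine Set.Finite.of_injOn (f := fun X => (R X).label i i) (t := {n | natLE (Y.label i i) n})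
    ?_ ?_ (hfin _)
  · rintro X ⟨h1, h2, h3⟩
    obtain ⟨hS, hF, hX, hiR⟩ := hR X ⟨h1, h2⟩
    rw [hX] at h3
    exact (cl_le_cl_iff hF hY hS hYS hiR hiR hi hi).mp h3
  · rintro X ⟨h1, h2, -⟩ X' ⟨h1', h2', -⟩ h
    obtain ⟨hS, hF, hX, hiR⟩ := hR X ⟨h1, h2⟩
    obtain ⟨hS', hF', hX', hiR'⟩ := hR X' ⟨h1', h2'⟩
    change (R X).label i i = (R X').label i i at h
    rw [hX, hX']
    apply le_antisymm
    · rw [cl_le_cl_iff hF hF' hS hS' hiR hiR hiR' hiR', h]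
      exact natLE_refl _
    · rw [cl_le_cl_iff hF' hF hS' hS hiR' hiR' hiR hiR, h]
      exact natLE_refl _

/-- A closed connected subgraph of the closure of a finite connected subgraph is itself the
closure of a finite connected subgraph. -/
theorem Connected.isClFC (hfin : FiniteAbove M) {X Y : SubGr M} (hX : X.Connected)
    (hcl : X.cl S = X) (hY : Y.FinConn) (hYS : Y.LabelsIn S) (hXY : X ≤ Y.cl S)
    {i : MaxGrp M} (hi : i ∈ X.verts) (hi' : i ∈ Y.verts) : IsClFC S X := by
  have hXS : X.LabelsIn S := by
    rw [← hcl]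
    exact labelsIn_cl X
  let 𝒲 : Set (SubGr M) := {Z | ∃ W : SubGr M, W.FinConn ∧ W ≤ X ∧ i ∈ W.verts ∧ Z = W.cl S}
  have hfin𝒲 : 𝒲.Finite := (finite_isClFC_le hfin hY hYS hi').subset (by
    rintro _ ⟨W, hW, hWX, hiW, rfl⟩
    have hWS := hXS.mono hWX
    exact ⟨⟨W, hWS, hW, rfl⟩, (le_cl hWS).1 hiW, ((cl_mono hWX).trans hcl.le).trans hXY⟩)
  -- Take a maximal member of the finite family of closures. Enlarging its generator `W` by a path
  -- of `X` from `i` cannot enlarge the closure, so every such path already lies in the closure of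
  -- `W`.
  obtain ⟨_, hZ⟩ := hfin𝒲.exists_maximal
    ⟨_, point i, finConn_point i, Walk.point_le hi, rfl, rfl⟩
  obtain ⟨W, hW, hWX, hiW, rfl⟩ := hZ.prop
  have hWS := hXS.mono hWX
  have key : ∀ (v : MaxGrp M) (p : Walk (Set.univ : Set M) i v), p.span ≤ X →
      p.span ≤ W.cl S := by
    intro v p hp
    have hWp : (W ⊔ p.span).FinConn := finConn_sup hW (finConn_span p) hiW p.start_mem
    have hle : W ⊔ p.span ≤ X := sup_le hWX hp
    exact (le_join_right hWS (hXS.mono hp)).trans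
      (hZ.le_of_ge ⟨_, hWp, hle, Or.inl hiW, rfl⟩ (cl_mono le_sup_left))
  refine ⟨W, hWS, hW, le_antisymm (And.intro (fun v hv => ?_) fun e he => ?_)
    ((cl_mono hWX).trans hcl.le)⟩
  · obtain ⟨p, hp⟩ := hX.2 i hi v hv
    exact (key v p hp).1 p.end_mem
  · obtain ⟨p, hp⟩ := hX.2 i hi e.1 (X.src_mem e he)
    refine (key _ (p.fwd ⟨e.2, trivial⟩ rfl) (sup_le hp (Walk.edge_le he))).2 ?_
    exact Or.inr rfl

/-- Closure is monotone. The family must be non-empty: the empty intersection is the full graph,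
whose labels need not lie in `S`. -/
theorem cl_sInf {𝒳 : Set (SubGr M)} (hne : 𝒳.Nonempty) (hcl : ∀ X ∈ 𝒳, X.cl S = X) :
    (sInf 𝒳).cl S = sInf 𝒳 := by
  obtain ⟨X, hX⟩ := hne
  have hS : (sInf 𝒳).LabelsIn S := by
    refine LabelsIn.mono ?_ (sInf_le' hX)
    rw [← hcl X hX]
    exact labelsIn_cl X
  exact le_antisymm (le_sInf' fun Y hY => (cl_mono (sInf_le' hY)).trans (hcl Y hY).le) (le_cl hS)

/-- The closure of the component is connected and stays inside the closed graph `X`, so it cannot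
leave the component. -/
theorem cl_component {X : SubGr M} (hcl : X.cl S = X) {i : MaxGrp M} (hi : i ∈ X.verts) :
    (X.component i).cl S = X.component i := by
  have hS : (X.component i).LabelsIn S := by
    refine LabelsIn.mono ?_ (component_le X i)
    rw [← hcl]
    exact labelsIn_cl X
  have hc := connected_component hi
  refine le_antisymm ?_ (le_cl hS)
  refine (hc.cl hS).le_component ((cl_mono (component_le X i)).trans hcl.le) ?_
  exact (le_cl hS).1 ⟨Walk.nil, Walk.point_le hi⟩

end SubGr

end ClosedFinite

section Limit

variable {M : Type u} [InverseMonoid M] {U : GroupVariety} {A I : Set M}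

/-! ### Translations -/

/-- The left action of `M/σ` on the free `gU`-category. -/
def CatU.translate (g : MaxGrp M) : CatU U A ⥤q CatU U A where
  obj i := ⟨g * i.vertex⟩
  map x := ⟨actU U A g x.1, by
    obtain ⟨p, hp⟩ := x.2
    obtain ⟨q, hq⟩ := actU_val U g p rfl rfl
    exact ⟨q, by rw [hq, hp]⟩⟩

theorem CatU.composePath_translate (g : MaxGrp M) {i j : CatU U A} (q : Quiver.Path i j) :
    composePath ((CatU.translate g).mapPath q) = (CatU.translate g).map (composePath q) := by
  induction q with
  | nil => exact Subtype.ext (map_one (actU U A g)).symm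
  | cons q x ih =>
    refine (congrArg (· ≫ (CatU.translate g).map x) ih).trans ?_
    exact Subtype.ext (map_mul (actU U A g) _ _).symm

theorem SubGr.sInf_le_smul {𝒳 𝒴 : Set (SubGr M)} (g : MaxGrp M)
    (h : ∀ Y ∈ 𝒴, ∃ X ∈ 𝒳, X ≤ g • Y) : sInf 𝒳 ≤ g • sInf 𝒴 := by
  constructor
  · intro v hv Y hY
    obtain ⟨X, hX, hXY⟩ := h Y hY
    exact hXY.1 (hv X hX)
  · intro e he Y hY
    obtain ⟨X, hX, hXY⟩ := h Y hY
    exact hXY.2 (he X hX)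

/-- Translated arrows often have endpoints that agree only propositionally. Comparing the data of
the arrows replaces a transport between hom-sets. -/
theorem arrow_congr {T : Sort*} (Q : ∀ {i j : CatU U A}, (i ⟶ j) → T) {i j i' j' : CatU U A}
    (x : i ⟶ j) (x' : i' ⟶ j') (hi : i.vertex = i'.vertex) (hj : j.vertex = j'.vertex)
    (h : x.1 = x'.1) : Q x = Q x' := by
  obtain ⟨i⟩ := i
  obtain ⟨j⟩ := j
  obtain ⟨i'⟩ := i'
  obtain ⟨j'⟩ := j'
  dsimp only at hi hj
  subst hi hj
  rw [show x = x' from Subtype.ext h]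

theorem CatU.inv_comp {i j k : CatU U A} (x : i ⟶ j) (y : j ⟶ k) :
    InverseCategory.inv (x ≫ y) = InverseCategory.inv y ≫ InverseCategory.inv x :=
  Subtype.ext (mul_inv_rev x.1 y.1)

theorem CatU.inv_inv {i j : CatU U A} (x : i ⟶ j) :
    InverseCategory.inv (InverseCategory.inv x) = x :=
  Subtype.ext (_root_.inv_inv x.1)

theorem CatU.inv_id (i : CatU U A) : InverseCategory.inv (𝟙 i) = 𝟙 i :=
  Subtype.ext inv_one

/-! ### The intersections of the chains -/

theorem chainP_zero_le {i j : CatU U A} (x : i ⟶ j) (p : Walk A i.vertex j.vertex)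
    (hp : p.val U = x.1) : chainP I 0 x ≤ p.span.cl (A ∪ I) :=
  (SubGr.component_le _ _).trans (SubGr.sInf_le' ⟨p, hp, rfl⟩)

/-- The intersection of the chain `P_n(x)`. -/
def chainInf (I : Set M) {i j : CatU U A} (x : i ⟶ j) : SubGr M :=
  sInf (Set.range fun n => chainP I n x)

theorem chainInf_le (n : ℕ) {i j : CatU U A} (x : i ⟶ j) : chainInf I x ≤ chainP I n x :=
  SubGr.sInf_le' ⟨n, rfl⟩

theorem chainInf_le_cl_span {i j : CatU U A} (x : i ⟶ j) (p : Walk A i.vertex j.vertex)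
    (hp : p.val U = x.1) : chainInf I x ≤ p.span.cl (A ∪ I) :=
  (chainInf_le 0 x).trans (chainP_zero_le x p hp)

theorem tgt_mem_chainInf
    (h : ∀ (n : ℕ) (i j : CatU U A) (x : i ⟶ j), j.vertex ∈ (chainP I n x).verts)
    {i j : CatU U A} (x : i ⟶ j) : j.vertex ∈ (chainInf I x).verts := by
  rintro _ ⟨n, rfl⟩
  exact h n i j x

variable [EUnitary M]

theorem SubGr.component_smul_le (g i : MaxGrp M) (X : SubGr M) :
    (g • X).component (g * i) ≤ g • X.component i := by
  have key : ∀ v, (∃ p : Walk (Set.univ : Set M) (g * i) v, p.span ≤ g • X) →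
      ∃ p : Walk (Set.univ : Set M) i (g⁻¹ * v), p.span ≤ X := by
    rintro v ⟨p, hp⟩
    have h : (p.act g⁻¹).span ≤ X := by
      have := SubGr.smul_mono g⁻¹ hp
      rwa [← SubGr.span_act, SubGr.smul_smul', inv_mul_cancel, SubGr.one_smul'] at this
    generalize p.act g⁻¹ = q at h
    revert q
    rw [inv_mul_cancel_left]
    exact fun q h => ⟨q, h⟩
  exact ⟨fun v hv => key v hv, fun e he => ⟨he.1, key _ he.2⟩⟩

/-- Translation carries representing paths and decompositions of `x` to those of the translated
arrow. One inclusion for every `g` suffices, the other being its instance at `g⁻¹`. -/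
theorem chainP_translate_le (g : MaxGrp M) (n : ℕ) : ∀ {i j : CatU U A} (x : i ⟶ j),
    chainP I n ((CatU.translate g).map x) ≤ g • chainP I n x := by
  induction n with
  | zero =>
    intro i j x
    refine (SubGr.component_mono ?_ _).trans (SubGr.component_smul_le g _ _)
    refine SubGr.sInf_le_smul g ?_
    rintro _ ⟨p, hp, rfl⟩
    refine ⟨(p.act g).span.cl (A ∪ I), ⟨p.act g, ?_, rfl⟩, ?_⟩
    · change (p.act g).val U = actU U A g x.1
      rw [← hp, Walk.val, Walk.word_act]
      rfl
    · rw [SubGr.smul_cl, SubGr.span_act]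
  | succ n ih =>
    intro i j x
    refine (SubGr.component_mono ?_ _).trans (SubGr.component_smul_le g _ _)
    refine SubGr.sInf_le_smul g ?_
    rintro _ ⟨q, rfl, rfl⟩
    refine ⟨_, ⟨(CatU.translate g).mapPath q, CatU.composePath_translate g q, rfl⟩, ?_⟩
    rw [SubGr.smul_cl]
    refine SubGr.cl_mono ?_
    induction q with
    | nil => exact (SubGr.smul_point g _).ge
    | cons q y ihq => exact sup_le_sup ihq (ih y)

/-- The properties of the members of the chains that hold if all of them contain the terminal
vertices of the arrows. -/
structure IsGoodAt (I : Set M) {i j : CatU U A} (x : i ⟶ j) (X : SubGr M) : Prop where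
  closed : X.cl (A ∪ I) = X
  connected : X.Connected
  src_mem : i.vertex ∈ X.verts

theorem IsGoodAt.labelsIn {i j : CatU U A} {x : i ⟶ j} {X : SubGr M} (h : IsGoodAt I x X) :
    X.LabelsIn (A ∪ I) := by
  rw [← h.closed]
  exact SubGr.labelsIn_cl X

theorem IsGoodAt.of_sInf {i j : CatU U A} (x : i ⟶ j) {𝒳 : Set (SubGr M)} (hne : 𝒳.Nonempty)
    (hcl : ∀ X ∈ 𝒳, X.cl (A ∪ I) = X) (hi : ∀ X ∈ 𝒳, i.vertex ∈ X.verts) :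
    IsGoodAt I x ((sInf 𝒳).component i.vertex) :=
  ⟨SubGr.cl_component (SubGr.cl_sInf hne hcl) hi, SubGr.connected_component hi,
    ⟨Walk.nil, Walk.point_le hi⟩⟩

theorem Walk.labelsIn_span_union {i j : MaxGrp M} (p : Walk A i j) :
    p.span.LabelsIn (A ∪ I) := fun e he => Or.inl (p.labelsIn_span e he)

/-- By hypothesis each `P_n(x_r)` contains the terminal vertex of `x_r`, which is the initial vertex
of the next factor. The union along a decomposition is therefore connected and its closure is
closed; intersections and components preserve closedness. -/
theorem isGoodAt_chainP
    (h : ∀ (n : ℕ) (i j : CatU U A) (x : i ⟶ j), j.vertex ∈ (chainP I n x).verts)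
    (n : ℕ) : ∀ {i j : CatU U A} (x : i ⟶ j),
    IsGoodAt I x (chainP I n x) := by
  induction n with
  | zero =>
    intro i j x
    refine IsGoodAt.of_sInf x ?_ ?_ ?_
    · obtain ⟨p, hp⟩ := x.2
      exact ⟨_, p, hp, rfl⟩
    · rintro _ ⟨p, -, rfl⟩
      exact SubGr.cl_cl (SubGr.finConn_span p).2.2 p.labelsIn_span_union
    · rintro _ ⟨p, -, rfl⟩
      exact (SubGr.le_cl p.labelsIn_span_union).1 p.start_mem
  | succ n ih =>
    intro i j x
    have hS : ∀ {i j : CatU U A} (q : Quiver.Path i j),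
        (unionAlong (fun {_ _} y => chainP I n y) q).LabelsIn (A ∪ I) := fun q =>
      labelsIn_unionAlong (fun x => (ih x).labelsIn) q
    refine IsGoodAt.of_sInf x ?_ ?_ ?_
    · exact ⟨_, Quiver.Path.nil.cons x, Category.id_comp x, rfl⟩
    · rintro _ ⟨q, -, rfl⟩
      exact SubGr.cl_cl (connected_unionAlong (fun x => (ih x).connected)
        (fun x => (ih x).src_mem) (fun x => h n _ _ x) q) (hS q)
    · rintro _ ⟨q, -, rfl⟩
      exact (SubGr.le_cl (hS q)).1 (src_mem_unionAlong q)

/-- One of the decompositions has `x` as its only factor. The one-vertex graph contributed by the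
empty path is absorbed. -/
theorem chainP_succ_le
    (h : ∀ (n : ℕ) (i j : CatU U A) (x : i ⟶ j), j.vertex ∈ (chainP I n x).verts)
    (n : ℕ) {i j : CatU U A} (x : i ⟶ j) :
    chainP I (n + 1) x ≤ chainP I n x := by
  have hg := isGoodAt_chainP h n x
  have h1 : chainP I (n + 1) x ≤ (SubGr.point i.vertex ⊔ chainP I n x).cl (A ∪ I) :=
    (SubGr.component_le _ _).trans (SubGr.sInf_le'
      ⟨Quiver.Path.nil.cons x, Category.id_comp x, rfl⟩)
  rwa [sup_eq_right.mpr (Walk.point_le hg.src_mem), hg.closed] at h1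

theorem chainP_antitone
    (h : ∀ (n : ℕ) (i j : CatU U A) (x : i ⟶ j), j.vertex ∈ (chainP I n x).verts)
    {i j : CatU U A} (x : i ⟶ j) : Antitone fun n => chainP I n x :=
  antitone_nat_of_succ_le fun n => chainP_succ_le h n x

theorem isClFC_chainP
    (h : ∀ (n : ℕ) (i j : CatU U A) (x : i ⟶ j), j.vertex ∈ (chainP I n x).verts)
    (hfin : FiniteAbove M) (n : ℕ) {i j : CatU U A} (x : i ⟶ j) :
    SubGr.IsClFC (A ∪ I) (chainP I n x) := by
  have hg := isGoodAt_chainP h n x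
  obtain ⟨p, hp⟩ := x.2
  exact hg.connected.isClFC hfin hg.closed (SubGr.finConn_span p) p.labelsIn_span_union
    ((chainP_antitone h x (Nat.zero_le n)).trans (chainP_zero_le x p hp)) hg.src_mem p.start_mem

/-- All terms are closed subgraphs through the initial vertex inside the closure of one representing
path, so they take finitely many values, and a descending sequence is constant once it attains a
minimal value. -/
theorem exists_chainP_eq
    (h : ∀ (n : ℕ) (i j : CatU U A) (x : i ⟶ j), j.vertex ∈ (chainP I n x).verts)
    (hfin : FiniteAbove M) {i j : CatU U A} (x : i ⟶ j) :
    ∃ N, ∀ n, N ≤ n → chainP I n x = chainP I N x := by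
  obtain ⟨p, hp⟩ := x.2
  have hf : (Set.range fun n => chainP I n x).Finite :=
    (SubGr.finite_isClFC_le hfin (SubGr.finConn_span p) (p.labelsIn_span_union (I := I))
      p.start_mem).subset (by
      rintro _ ⟨n, rfl⟩
      exact ⟨isClFC_chainP h hfin n x, (isGoodAt_chainP h n x).src_mem,
        (chainP_antitone h x (Nat.zero_le n)).trans (chainP_zero_le x p hp)⟩)
  obtain ⟨_, hm⟩ := hf.exists_minimal ⟨_, 0, rfl⟩
  obtain ⟨N, rfl⟩ := hm.prop
  exact ⟨N, fun n hn => le_antisymm (chainP_antitone h x hn)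
    (hm.le_of_le ⟨n, rfl⟩ (chainP_antitone h x hn))⟩

theorem chainInf_translate_le (g : MaxGrp M) {i j : CatU U A} (x : i ⟶ j) :
    chainInf I ((CatU.translate g).map x) ≤ g • chainInf I x := by
  refine SubGr.sInf_le_smul g ?_
  rintro _ ⟨n, rfl⟩
  exact ⟨_, ⟨n, rfl⟩, chainP_translate_le g n x⟩

theorem exists_chainP_eq_chainInf
    (h : ∀ (n : ℕ) (i j : CatU U A) (x : i ⟶ j), j.vertex ∈ (chainP I n x).verts)
    (hfin : FiniteAbove M) {i j : CatU U A} (x : i ⟶ j) :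
    ∃ N, ∀ n, N ≤ n → chainP I n x = chainInf I x := by
  obtain ⟨N, hN⟩ := exists_chainP_eq h hfin x
  refine ⟨N, fun n hn => le_antisymm ?_ (chainInf_le n x)⟩
  refine SubGr.le_sInf' ?_
  rintro _ ⟨k, rfl⟩
  rw [hN n hn, ← hN (max N k) (le_max_left _ _)]
  exact chainP_antitone h x (le_max_right _ _)

theorem isClFC_chainInf
    (h : ∀ (n : ℕ) (i j : CatU U A) (x : i ⟶ j), j.vertex ∈ (chainP I n x).verts)
    (hfin : FiniteAbove M) {i j : CatU U A} (x : i ⟶ j) :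
    SubGr.IsClFC (A ∪ I) (chainInf I x) := by
  obtain ⟨N, hN⟩ := exists_chainP_eq_chainInf h hfin x
  rw [← hN N le_rfl]
  exact isClFC_chainP h hfin N x

theorem src_mem_chainInf
    (h : ∀ (n : ℕ) (i j : CatU U A) (x : i ⟶ j), j.vertex ∈ (chainP I n x).verts)
    {i j : CatU U A} (x : i ⟶ j) : i.vertex ∈ (chainInf I x).verts := by
  rintro _ ⟨n, rfl⟩
  exact (isGoodAt_chainP h n x).src_mem

/-- At a common stage where both chains have stabilised, the decomposition `x · y` bounds the next
term for the product by the join of the limits. No interchange of intersections and joins is needed.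
-/
theorem chainInf_comp_le
    (h : ∀ (n : ℕ) (i j : CatU U A) (x : i ⟶ j), j.vertex ∈ (chainP I n x).verts)
    (hfin : FiniteAbove M) {i j k : CatU U A} (x : i ⟶ j) (y : j ⟶ k) :
    chainInf I (x ≫ y) ≤ (chainInf I x ⊔ chainInf I y).cl (A ∪ I) := by
  obtain ⟨N, hN⟩ := exists_chainP_eq_chainInf h hfin x
  obtain ⟨N', hN'⟩ := exists_chainP_eq_chainInf h hfin y
  have h1 : chainP I (max N N' + 1) (x ≫ y) ≤
      (SubGr.point i.vertex ⊔ chainP I (max N N') x ⊔ chainP I (max N N') y).cl (A ∪ I) :=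
    (SubGr.component_le _ _).trans (SubGr.sInf_le' ⟨(Quiver.Path.nil.cons x).cons y,
      congrArg (· ≫ y) (Category.id_comp x), rfl⟩)
  rw [hN _ (le_max_left _ _), hN' _ (le_max_right _ _),
    sup_eq_right.mpr (Walk.point_le (src_mem_chainInf h x))] at h1
  exact (chainInf_le _ _).trans h1

/-- The join of the limits of the chains of an arrow and of its inverse. -/
noncomputable def symmInf (I : Set M) {i j : CatU U A} (x : i ⟶ j) : SubGr M :=
  (chainInf I x ⊔ chainInf I (InverseCategory.inv x)).cl (A ∪ I)

/-- The closure of a maximal edge is minimal among the closed subgraphs connecting its ends. -/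
theorem SubGr.IsClFC.eq_cl_edge {S : Set M} {a : M} (ha : a ∈ maxNonId M) (haS : a ∈ S)
    {X : SubGr M} (hX : SubGr.IsClFC S X) {i : MaxGrp M} (hi : i ∈ X.verts)
    (hj : i * toG a ∈ X.verts) (hle : X ≤ (SubGr.edge i a).cl S) :
    X = (SubGr.edge i a).cl S := by
  obtain ⟨Y, hYS, hY, rfl, hiY, hjY⟩ := hX.exists_finConn hi hj
  have hE := SubGr.finConn_edge i a
  have hES : (SubGr.edge i a).LabelsIn S := by rintro _ rfl; exact haS
  have hlab : (SubGr.edge i a).label i (i * toG a) = a := by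
    rw [SubGr.label_eq (Walk.nil.fwd ⟨a, trivial⟩ rfl)]
    · exact one_mul a
    · exact sup_eq_right.mpr (Walk.point_le (Or.inl rfl))
  -- The inclusion says that the label of `Y` between the ends of the edge is at least `a`. By
  -- maximality it is `a`, and equal labels give equal closures.
  have h1 := (SubGr.cl_le_cl_iff hY hE hYS hES hiY hjY (Or.inl rfl) (Or.inr rfl)).mp hle
  rw [hlab] at h1
  refine le_antisymm hle ((SubGr.cl_le_cl_iff hE hY hES hYS (Or.inl rfl) (Or.inr rfl)
    hiY hjY).mpr ?_)
  rw [hlab, ha.2 _ h1]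
  exact natLE_refl a

/-- Joining the limits for an arrow and its inverse makes invariance under inversion plain
commutativity of the join. Subadditivity survives because `(xy)⁻¹ = y⁻¹x⁻¹`. -/
theorem isSubadditive_symmInf
    (h : ∀ (n : ℕ) (i j : CatU U A) (x : i ⟶ j), j.vertex ∈ (chainP I n x).verts)
    (hfin : FiniteAbove M) (hA : A ⊆ maxNonId M) :
    IsSubadditive I fun {i j : CatU U A} (x : i ⟶ j) => symmInf I x := by
  have hc : ∀ {i j : CatU U A} (x : i ⟶ j), SubGr.IsClFC (A ∪ I) (chainInf I x) :=
    fun x => isClFC_chainInf h hfin x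
  have hcl : ∀ {i j : CatU U A} (x : i ⟶ j), SubGr.IsClFC (A ∪ I) (symmInf I x) := fun x =>
    (hc x).join (hc _) (src_mem_chainInf h x) (tgt_mem_chainInf h (InverseCategory.inv x))
  have hl : ∀ {i j : CatU U A} (x : i ⟶ j), chainInf I x ≤ symmInf I x := fun x =>
    SubGr.le_join_left (hc x).labelsIn (hc _).labelsIn
  have hr : ∀ {i j : CatU U A} (x : i ⟶ j),
      chainInf I (InverseCategory.inv x) ≤ symmInf I x := fun x =>
    SubGr.le_join_right (hc x).labelsIn (hc _).labelsIn
  refine ⟨hcl, fun x => (hl x).1 (src_mem_chainInf h x), fun x => (hl x).1 (tgt_mem_chainInf h x),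
    fun i => ?_, fun x => ?_, fun {i j k} x y => ?_, fun {i j} a => ?_⟩
  · refine le_antisymm ?_ ((hcl _).cl_point_le ((hl _).1 (src_mem_chainInf h _)))
    have h1 : chainInf I (𝟙 i) ≤ (SubGr.point i.vertex).cl (A ∪ I) :=
      chainInf_le_cl_span (𝟙 i) Walk.nil rfl
    refine (SubGr.isClFC_point _).join_le h1 ?_
    rw [CatU.inv_id]
    exact h1
  · change (_ ⊔ _ : SubGr M).cl _ = (_ ⊔ _ : SubGr M).cl _
    rw [CatU.inv_inv, sup_comm]
  · have hj := (hcl x).join (hcl y) ((hl x).1 (tgt_mem_chainInf h x))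
      ((hl y).1 (src_mem_chainInf h y))
    refine hj.join_le ((chainInf_comp_le h hfin x y).trans (SubGr.cl_mono
      (sup_le_sup (hl x) (hl y)))) ?_
    rw [CatU.inv_comp]
    refine (chainInf_comp_le h hfin _ _).trans (SubGr.cl_mono ?_)
    rw [sup_comm]
    exact sup_le_sup (hr x) (hr y)
  · obtain ⟨i⟩ := i
    obtain ⟨j⟩ := j
    obtain ⟨a, ha⟩ := a
    dsimp only at ha
    subst ha
    -- The edge traversed forwards represents the generator, and backwards its inverse, so both
    -- limits lie in the closure of the edge. Since the join contains both ends, minimality gives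
    -- equality.
    refine SubGr.IsClFC.eq_cl_edge (hA a.2) (Or.inl a.2) (hcl _)
      ((hl _).1 (src_mem_chainInf h _)) ((hl _).1 (tgt_mem_chainInf h _)) ?_
    have hsp : SubGr.point i ⊔ SubGr.edge i (a : M) = SubGr.edge i (a : M) :=
      sup_eq_right.mpr (Walk.point_le (Or.inl rfl))
    let p : Walk A i (i * toG (a : M)) := Walk.nil.fwd a rfl
    have hp : p.span = SubGr.edge i (a : M) := hsp
    refine (SubGr.isClFC_edge i (Or.inl a.2)).join_le ?_ ?_
    · rw [← hp]
      exact chainInf_le_cl_span _ p rfl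
    · rw [← hp, ← p.span_reverse]
      exact chainInf_le_cl_span _ p.reverse (p.val_reverse U)

theorem symmInf_translate (g : MaxGrp M) {i j : CatU U A} (x : i ⟶ j) :
    symmInf I ((CatU.translate g).map x) = g • symmInf I x := by
  have key : ∀ (g : MaxGrp M) {i j : CatU U A} (x : i ⟶ j),
      symmInf I ((CatU.translate g).map x) ≤ g • symmInf I x := by
    intro g i j x
    change (_ ⊔ _ : SubGr M).cl _ ≤ g • (_ ⊔ _ : SubGr M).cl _
    rw [SubGr.smul_cl, SubGr.smul_sup]
    refine SubGr.cl_mono (sup_le_sup (chainInf_translate_le g x) ?_)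
    have : InverseCategory.inv ((CatU.translate g).map x) =
        (CatU.translate g).map (InverseCategory.inv x) :=
      Subtype.ext (map_inv (actU U A g) x.1).symm
    rw [this]
    exact chainInf_translate_le g _
  refine le_antisymm (key g x) ?_
  -- The reverse inclusion comes from applying `key` to `g⁻¹` and the translated arrow, and then
  -- translating by `g`.
  have h1 := SubGr.smul_mono g (key g⁻¹ ((CatU.translate g).map x))
  rw [SubGr.smul_smul', mul_inv_cancel, SubGr.one_smul'] at h1
  refine le_trans (le_of_eq ?_) h1
  congr 1
  refine arrow_congr (fun {_ _} x => symmInf I x) _ _ (inv_mul_cancel_left g _).symm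
    (inv_mul_cancel_left g _).symm ?_
  change x.1 = actU U A g⁻¹ (actU U A g x.1)
  rw [← MulAut.mul_apply, ← map_mul (actU U A), inv_mul_cancel, map_one]
  rfl

/-! ### From equivariant assignments to `X_cl/G` -/

/-- The arrow of the free `gU`-category starting at `1` that corresponds to an element
of `G^U`. -/
def GU.arrow (h : GU U A) : (⟨1⟩ : CatU U A) ⟶ ⟨h.1.right⟩ := ⟨h.1.left, h.2⟩

/-- Elements of `G^U` are the arrows starting at `1`. The arrow of `hk` is that of `h` followed by
the translate of that of `k`, and equivariance turns the value on this translate into the translated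
graph in the product of `X_cl/G`. -/
theorem IsSubadditive.exists_dualPremorphism {Q : ∀ {i j : CatU U A}, (i ⟶ j) → SubGr M}
    (hQ : IsSubadditive I Q) (hact : ∀ (g : MaxGrp M) {i j : CatU U A} (x : i ⟶ j),
      Q ((CatU.translate g).map x) = g • Q x) :
    ∃ ψ : GU U A → XclQuot (A ∪ I),
      IsDualPremorphism ψ ∧ ∀ a : A, ψ (GU.gen U a) = XclQuot.gen a := by
  refine ⟨fun h => ⟨Q (GU.arrow h), h.1.right, hQ.isClFC _, hQ.src_mem (GU.arrow h),
      hQ.tgt_mem (GU.arrow h)⟩,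
    ⟨?_, ?_, ?_⟩, ?_⟩
  · exact XclQuot.ext (hQ.map_id _) rfl
  · intro h
    refine XclQuot.ext ?_ rfl
    change Q (GU.arrow h⁻¹) = h.1.right⁻¹ • Q (GU.arrow h)
    rw [← hQ.map_inv (GU.arrow h), ← hact]
    refine arrow_congr Q _ _ (inv_mul_cancel _).symm (mul_one _).symm ?_
    rfl
  · intro h k
    refine XclQuot.natLE_of_graph ?_ rfl
    change Q (GU.arrow (h * k)) ≤ (Q (GU.arrow h) ⊔ h.1.right • Q (GU.arrow k)).cl (A ∪ I)
    let z : (⟨h.1.right⟩ : CatU U A) ⟶ ⟨h.1.right * k.1.right⟩ :=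
      ⟨actU U A h.1.right k.1.left, by
        obtain ⟨p, hp⟩ := k.2
        obtain ⟨q, hq⟩ := actU_val U h.1.right p (mul_one _) rfl
        exact ⟨q, by rw [hq, hp]⟩⟩
    have hz : Q z = h.1.right • Q (GU.arrow k) := by
      rw [← hact]
      exact arrow_congr Q _ _ (mul_one _).symm rfl rfl
    rw [← hz]
    exact hQ.map_comp (GU.arrow h) z
  · intro a
    refine XclQuot.ext ?_ rfl
    change Q (GU.arrow (GU.gen U a)) = (SubGr.edge 1 (a : M)).cl (A ∪ I)
    let e : (⟨1⟩ : Cay A) ⟶ ⟨toG (a : M)⟩ := ⟨a, one_mul _⟩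
    refine Eq.trans ?_ (hQ.map_edge e)
    exact arrow_congr Q _ _ rfl rfl
      (congrArg QuotientGroup.mk (one_mul (FreeGroup.of ((1 : MaxGrp M), a)))).symm

end Limit

end FInvCov

/-! ### The equivalence of the five statements -/

open FInvCov
theorem theorem3 {M : Type u} [InverseMonoid M] [EUnitary M] (hfin : FiniteAbove M)
    (A : Set M) (hA : A ⊆ maxNonId M) (hgen : QuasiGenerates A)
    (I : Set M) (hI : ∀ e ∈ I, IsIdempotentElem e) (hAI : Generates (A ∪ I))
    (U : GroupVariety) :
    List.TFAE [
      HasFInverseCoverVia M U,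
      ∃ ψ : GU U A → M, IsDualPremorphism ψ ∧ ∀ a : A, ψ (GU.gen U a) = a,
      ∃ ψ : GU U A → XclQuot (A ∪ I),
        IsDualPremorphism ψ ∧ ∀ a : A, ψ (GU.gen U a) = XclQuot.gen a,
      ∃ Ψ : CatU U A ⥤q Xcl (A ∪ I),
        IsCatDualPremorphism Ψ ∧ epsCatU U A ⋙q Ψ = epsXcl A I,
      ∀ (n : ℕ) (i j : CatU U A) (x : i ⟶ j), j.vertex ∈ (chainP I n x).verts] := by
  obtain ⟨e, he⟩ := exists_mulEquiv_xclQuot hAI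
  tfae_have 1 → 2 := exists_dualPremorphism_of_hasFInverseCoverVia hA
  tfae_have 2 → 1 := fun ⟨ψ, hψ, hcan⟩ => hasFInverseCoverVia_of_dualPremorphism hI hAI hψ hcan
  tfae_have 2 → 3 := fun ⟨ψ, hψ, hcan⟩ =>
    ⟨fun h => e (ψ h), hψ.mulEquiv_comp e, fun a => (congrArg e (hcan a)).trans (he a)⟩
  tfae_have 3 → 2 := fun ⟨ψ, hψ, hcan⟩ =>
    ⟨fun h => e.symm (ψ h), hψ.mulEquiv_comp e.symm, fun a =>
      (congrArg e.symm ((hcan a).trans (he a).symm)).trans (e.symm_apply_apply _)⟩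
  tfae_have 3 → 4 := fun ⟨ψ, hψ, hcan⟩ => exists_catDualPremorphism hψ hcan
  tfae_have 4 → 5 := fun ⟨Ψ, hΨ, hcan⟩ n i j x => (hΨ.isSubadditive hcan).tgt_mem_chainP n x
  -- The limit of the chains is equivariant, so it gives a dual premorphism to `X_cl/G` directly; an
  -- arbitrary one to `X_cl` need not be equivariant, and 4 leads back to 3 only through the chains.
  tfae_have 5 → 3 := fun h =>
    (isSubadditive_symmInf h hfin hA).exists_dualPremorphism fun g _ _ x => symmInf_translate g x
  tfae_finish
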